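/- Let $N\ge 5$, $\mu>0$, $2<p<2+\frac4N$, $4^*:=\frac{2N}{N-4}$ and $\gamma_p:=\frac N2\left(\frac12-\frac1p\right)$. Let $H^2(\mathbb R^N)$ be the space of real $u\in L^2(\mathbb R^N)$ whose weak gradient and weak Laplacian are in $L^2$, with norm $\left(\|\Delta u\|_2^2+\|\nabla u\|_2^2+\|u\|_2^2\right)^{1/2}$. Let $C_{N,p}$ be the optimal constant in the Gagliardo–Nirenberg inequality $\|u\|_p\le C_{N,p}\|\Delta u\|_2^{\gamma_p}\|u\|_2^{1-\gamma_p}$, $u\in H^2(\mathbb R^N)$, and let $$S:=\inf_{u\in H^2(\mathbb R^N)\setminus\{0\}}\frac{\|\Delta u\|_2^2}{\|u\|_{4^*}^2}.$$ Put $$\mathcal E:=\frac{4^*-p\gamma_p}{2-p\gamma_p}\left(\frac{(2-p\gamma_p)\mu C_{N,p}^p}{(4^*-2)p}\right)^{\frac{4^*-2}{4^*-p\gamma_p}}\left(4^*S^{\frac{4^*}{2}}\right)^{\frac{p\gamma_p-2}{4^*-p\gamma_p}},\qquad c_*:=\left(\frac1{2\mathcal E}\right)^{\frac{2(4^*-p\gamma_p)}{p(1-\gamma_p)(4^*-2)}},$$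 $$r_*:=\left(\frac{(2-p\gamma_p)\,\mu\, 4^*S^{\frac{4^*}{2}}C_{N,p}^p\,c_*^{\frac{p(1-\gamma_p)}{2}}}{(4^*-2)p}\right)^{\frac1{4^*-p\gamma_p}}.$$ For $u\in H^2(\mathbb R^N)$ let $$I(u):=\tfrac12\|\Delta u\|_2^2+\tfrac12\|\nabla u\|_2^2-\tfrac{\mu}{p}\|u\|_p^p-\tfrac1{4^*}\|u\|_{4^*}^{4^*},$$ and for $c>0$ let $$V_r(c):=\left\{u\in H^2(\mathbb R^N):\ u\text{ radial},\ \|u\|_2^2=c,\ \|\Delta u\|_2^2+\|\nabla u\|_2^2<r_*^2\right\}.$$ Then for every $0<c<c_*$ the restriction $I|_{V_r(c)}$ has a critical point $u$ with $I(u)<0$; that is, there is $u\in V_r(c)$ at which $I$ is Fréchet differentiable, with $I(u)<0$ and $I'(u)v=0$ for all radial $v\in H^2(\mathbb R^N)$ with $\int_{\mathbb R^N}uv\,dx=0$. Moreover, the associated Lagrange multiplier $\lambda\in\mathbb R$, for which $I'(u)v=\lambda\int_{\mathbb R^N}uv\,dx$ for all $v\in H^2(\mathbb R^N)$ (i.e.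 $\Delta^2u-\Delta u-\lambda u=\mu|u|^{p-2}u+|u|^{4^*-2}u$ weakly in $\mathbb R^N$), satisfies $\lambda<0$. -/

import Mathlib

open MeasureTheory

noncomputable section

namespace BiharmonicNLS

open scoped ContDiff RealInnerProductSpace

/-- The Euclidean space `ℝ^N`. -/
abbrev Sp (N : ℕ) : Type := EuclideanSpace ℝ (Fin N)

/-- `L²(ℝ^N; F)` with respect to Lebesgue measure. -/
abbrev L2 (N : ℕ) (F : Type) [NormedAddCommGroup F] : Type :=
  Lp F 2 (volume : Measure (Sp N))

/-- `φ ∈ C_c^∞(ℝ^N)`. -/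
def IsTest {N : ℕ} (φ : Sp N → ℝ) : Prop :=
  ContDiff ℝ ∞ φ ∧ HasCompactSupport φ

/-- `g` is the weak gradient of `u`: `∫ u ∂ₑφ = -∫ ⟨g, e⟩ φ` for all test functions `φ` and all
directions `e`. -/
def IsWeakGradient {N : ℕ} (u : Sp N → ℝ) (g : Sp N → Sp N) : Prop :=
  ∀ φ : Sp N → ℝ, IsTest φ → ∀ e : Sp N,
    ∫ x, u x * fderiv ℝ φ x e = -∫ x, ⟪g x, e⟫ * φ x

/-- `w` is the weak (distributional) Laplacian of `u`: `∫ u Δφ = ∫ w φ` for all test functions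
`φ`. -/
def IsWeakLaplacian {N : ℕ} (u w : Sp N → ℝ) : Prop :=
  ∀ φ : Sp N → ℝ, IsTest φ → ∫ x, u x * Laplacian.laplacian φ x = ∫ x, w x * φ x

/-- The Hilbert space `L²(ℝ^N) × L²(ℝ^N; ℝ^N) × L²(ℝ^N)` with norm
`(‖u‖₂² + ‖g‖₂² + ‖w‖₂²)^{1/2}`. -/
abbrev Triples (N : ℕ) : Type :=
  WithLp 2 (L2 N ℝ × WithLp 2 (L2 N (Sp N) × L2 N ℝ))

section Closure

variable {N : ℕ} {φ ψ : Sp N → ℝ}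

lemma IsTest.memLp (h : IsTest φ) : MemLp φ 2 (volume : Measure (Sp N)) :=
  h.1.continuous.memLp_of_hasCompactSupport h.2

lemma IsTest.memLp_fderiv (h : IsTest φ) (e : Sp N) :
    MemLp (fun x => fderiv ℝ φ x e) 2 (volume : Measure (Sp N)) :=
  Continuous.memLp_of_hasCompactSupport
    ((h.1.continuous_fderiv (by simp)).clm_apply continuous_const) (h.2.fderiv_apply ℝ e)

lemma IsTest.memLp_laplacian (h : IsTest φ) :
    MemLp (Laplacian.laplacian φ) 2 (volume : Measure (Sp N)) := by
  rw [InnerProductSpace.laplacian_eq_iteratedFDeriv_orthonormalBasis φ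
    (EuclideanSpace.basisFun (Fin N) ℝ)]
  refine memLp_finsetSum _ fun i _ => ?_
  have hc : Continuous (iteratedFDeriv ℝ 2 φ) :=
    h.1.continuous_iteratedFDeriv (WithTop.coe_le_coe.2 (le_top : (2 : ℕ∞) ≤ ⊤))
  have hs : HasCompactSupport (iteratedFDeriv ℝ 2 φ) := h.2.iteratedFDeriv 2
  refine Continuous.memLp_of_hasCompactSupport
    ((ContinuousMultilinearMap.apply ℝ (fun _ : Fin 2 => Sp N) ℝ _).continuous.comp hc) ?_
  exact hs.comp_left (g := fun T : ContinuousMultilinearMap ℝ (fun _ : Fin 2 => Sp N) ℝ => T _) rfl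

lemma integral_add_mul (u v : L2 N ℝ) (h : MemLp ψ 2 (volume : Measure (Sp N))) :
    ∫ x, (u + v : L2 N ℝ) x * ψ x = (∫ x, u x * ψ x) + ∫ x, v x * ψ x := by
  have hu : Integrable (fun x => u x * ψ x) := (Lp.memLp u).integrable_mul h
  have hv : Integrable (fun x => v x * ψ x) := (Lp.memLp v).integrable_mul h
  rw [← integral_add hu hv]
  refine integral_congr_ae ?_
  filter_upwards [Lp.coeFn_add u v] with x hx
  rw [hx, Pi.add_apply, add_mul]

lemma integral_smul_mul (a : ℝ) (u : L2 N ℝ) :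
    ∫ x, (a • u : L2 N ℝ) x * ψ x = a * ∫ x, u x * ψ x := by
  rw [← integral_const_mul]
  refine integral_congr_ae ?_
  filter_upwards [Lp.coeFn_smul a u] with x hx
  simp [hx, mul_assoc]

lemma integral_add_inner (g k : L2 N (Sp N)) (e : Sp N)
    (h : MemLp ψ 2 (volume : Measure (Sp N))) :
    ∫ x, ⟪(g + k : L2 N (Sp N)) x, e⟫ * ψ x =
      (∫ x, ⟪g x, e⟫ * ψ x) + ∫ x, ⟪k x, e⟫ * ψ x := by
  have hg : Integrable (fun x => ⟪g x, e⟫ * ψ x) :=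
    ((Lp.memLp g).inner_const e).integrable_mul h
  have hk : Integrable (fun x => ⟪k x, e⟫ * ψ x) :=
    ((Lp.memLp k).inner_const e).integrable_mul h
  rw [← integral_add hg hk]
  refine integral_congr_ae ?_
  filter_upwards [Lp.coeFn_add g k] with x hx
  rw [hx, Pi.add_apply, inner_add_left, add_mul]

lemma integral_smul_inner (a : ℝ) (g : L2 N (Sp N)) (e : Sp N) :
    ∫ x, ⟪(a • g : L2 N (Sp N)) x, e⟫ * ψ x = a * ∫ x, ⟪g x, e⟫ * ψ x := by
  rw [← integral_const_mul]
  refine integral_congr_ae ?_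
  filter_upwards [Lp.coeFn_smul a g] with x hx
  simp [hx, mul_assoc, inner_smul_left]

end Closure

/-- The Sobolev space `H²(ℝ^N)` of real `u ∈ L²` with `∇u ∈ L²` and `Δu ∈ L²` in the weak sense.
An element is stored as the triple `(u, ∇u, Δu)` (the last two are determined by `u`), so that the
induced norm is `(‖u‖₂² + ‖∇u‖₂² + ‖Δu‖₂²)^{1/2}`. -/
def H2 (N : ℕ) : Submodule ℝ (Triples N) where
  carrier := {z | IsWeakGradient z.fst z.snd.fst ∧ IsWeakLaplacian z.fst z.snd.snd}
  add_mem' := by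
    rintro y z ⟨hy, hy'⟩ ⟨hz, hz'⟩
    refine ⟨fun φ hφ e => ?_, fun φ hφ => ?_⟩
    · simp only [WithLp.add_fst, WithLp.add_snd]
      rw [integral_add_mul _ _ (hφ.memLp_fderiv e), integral_add_inner _ _ _ hφ.memLp,
        hy φ hφ e, hz φ hφ e]
      ring
    · simp only [WithLp.add_fst, WithLp.add_snd]
      rw [integral_add_mul _ _ hφ.memLp_laplacian, integral_add_mul _ _ hφ.memLp,
        hy' φ hφ, hz' φ hφ]
  zero_mem' := by
    refine ⟨fun φ hφ e => ?_, fun φ hφ => ?_⟩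
    · have h1 := integral_smul_mul (ψ := fun x => fderiv ℝ φ x e) 0 (0 : L2 N ℝ)
      have h2 := integral_smul_inner (ψ := φ) 0 (0 : L2 N (Sp N)) e
      simp only [zero_smul, zero_mul] at h1 h2
      simp only [WithLp.zero_fst, WithLp.zero_snd]
      rw [h1, h2, neg_zero]
    · have h1 := integral_smul_mul (ψ := Laplacian.laplacian φ) 0 (0 : L2 N ℝ)
      have h2 := integral_smul_mul (ψ := φ) 0 (0 : L2 N ℝ)
      simp only [zero_smul, zero_mul] at h1 h2
      simp only [WithLp.zero_fst, WithLp.zero_snd]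
      rw [h1, h2]
  smul_mem' := by
    rintro a z ⟨hz, hz'⟩
    refine ⟨fun φ hφ e => ?_, fun φ hφ => ?_⟩
    · simp only [WithLp.smul_fst, WithLp.smul_snd]
      rw [integral_smul_mul, integral_smul_inner, hz φ hφ e]
      ring
    · simp only [WithLp.smul_fst, WithLp.smul_snd]
      rw [integral_smul_mul, integral_smul_mul, hz' φ hφ]

section Problem

variable {N : ℕ}

/-- The function `u : ℝ^N → ℝ` underlying an element of `H²(ℝ^N)`. -/
def fn (u : H2 N) : Sp N → ℝ := u.1.fst

/-- The weak gradient `∇u`. -/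
def grad (u : H2 N) : Sp N → Sp N := u.1.snd.fst

/-- The weak Laplacian `Δu`. -/
def lap (u : H2 N) : Sp N → ℝ := u.1.snd.snd

/-- `u` is radial: `u(x)` depends only on `|x|`, up to a null set. -/
def IsRadial (u : H2 N) : Prop :=
  ∃ f : ℝ → ℝ, ∀ᵐ x : Sp N, fn u x = f ‖x‖

/-- `‖u‖_t^t = ∫ |u|^t`. -/
def powInt (t : ℝ) (u : H2 N) : ℝ := ∫ x, |fn u x| ^ t

/-- The mass `‖u‖₂² = ∫ u²`. -/
def mass (u : H2 N) : ℝ := ∫ x, fn u x ^ 2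

/-- `‖∇u‖₂²`. -/
def gradSq (u : H2 N) : ℝ := ∫ x, ‖grad u x‖ ^ 2

/-- `‖Δu‖₂²`. -/
def lapSq (u : H2 N) : ℝ := ∫ x, lap u x ^ 2

/-- The critical Sobolev exponent `4^* = 2N/(N-4)`. -/
def critExp (N : ℕ) : ℝ := 2 * N / (N - 4)

/-- The Gagliardo–Nirenberg exponent `γ_t = (N/2)(1/2 - 1/t)`. -/
def gam (N : ℕ) (t : ℝ) : ℝ := N / 2 * (1 / 2 - 1 / t)

/-- The optimal constant `C_{N,t}` in the Gagliardo–Nirenberg inequality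
`‖u‖_t ≤ C ‖Δu‖₂^{γ_t} ‖u‖₂^{1-γ_t}`, `u ∈ H²(ℝ^N)`. -/
def gnConst (N : ℕ) (t : ℝ) : ℝ :=
  sInf {C : ℝ | 0 ≤ C ∧ ∀ u : H2 N,
    powInt t u ^ (1 / t) ≤ C * √(lapSq u) ^ gam N t * √(mass u) ^ (1 - gam N t)}

/-- The optimal Sobolev constant
`S = inf {‖Δu‖₂² / (∫ |u|^{4^*})^{2/4^*} : u ∈ H²(ℝ^N), u ≠ 0}`. -/
def sobConst (N : ℕ) : ℝ :=
  sInf {q : ℝ | ∃ u : H2 N, u ≠ 0 ∧ q = lapSq u / powInt (critExp N) u ^ (2 / critExp N)}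

/-- The constant `𝓔`. -/
def scriptE (N : ℕ) (μ p : ℝ) : ℝ :=
  (critExp N - p * gam N p) / (2 - p * gam N p) *
    ((2 - p * gam N p) * μ * gnConst N p ^ p / ((critExp N - 2) * p)) ^
      ((critExp N - 2) / (critExp N - p * gam N p)) *
    (critExp N * sobConst N ^ (critExp N / 2)) ^
      ((p * gam N p - 2) / (critExp N - p * gam N p))

/-- The threshold mass `c_*`. -/
def cStar (N : ℕ) (μ p : ℝ) : ℝ :=
  (1 / (2 * scriptE N μ p)) ^
    (2 * (critExp N - p * gam N p) / (p * (1 - gam N p) * (critExp N - 2)))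

/-- The radius `r_c`. -/
def rad (N : ℕ) (μ p c : ℝ) : ℝ :=
  ((2 - p * gam N p) * μ * critExp N * sobConst N ^ (critExp N / 2) * gnConst N p ^ p *
      c ^ (p * (1 - gam N p) / 2) / ((critExp N - 2) * p)) ^
    (1 / (critExp N - p * gam N p))

/-- `r_* = r_{c_*}`. -/
def rStar (N : ℕ) (μ p : ℝ) : ℝ := rad N μ p (cStar N μ p)

/-- `S_r(c)`: radial functions in `H²(ℝ^N)` of mass `c`. -/
def Sr (N : ℕ) (c : ℝ) : Set (H2 N) := {u | IsRadial u ∧ mass u = c}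

/-- `V_r(c) = {u ∈ S_r(c) : ‖Δu‖₂² + ‖∇u‖₂² < r_*²}`. -/
def Vr (N : ℕ) (μ p c : ℝ) : Set (H2 N) :=
  {u | u ∈ Sr N c ∧ lapSq u + gradSq u < rStar N μ p ^ 2}

/-- The energy
`I(u) = ½‖Δu‖₂² + ½‖∇u‖₂² - (μ/p)‖u‖_p^p - (1/4^*)‖u‖_{4^*}^{4^*}` on `H²(ℝ^N)`. -/
def energy (μ p : ℝ) (u : H2 N) : ℝ :=
  1 / 2 * lapSq u + 1 / 2 * gradSq u - μ / p * powInt p u -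
    1 / critExp N * powInt (critExp N) u

/-- `u` is a critical point of `I|_{V_r(c)}`. As `V_r(c)` is open in the manifold `S_r(c)`, its
tangent space at `u` consists of the radial `v ∈ H²(ℝ^N)` with `∫ u v = 0`; the differential of `I`
at `u` has to vanish on it. -/
def IsCriticalOnVr (μ p c : ℝ) (u : H2 N) : Prop :=
  u ∈ Vr N μ p c ∧ DifferentiableAt ℝ (energy μ p) u ∧
    ∀ v : H2 N, IsRadial v → ∫ x, fn u x * fn v x = 0 → fderiv ℝ (energy μ p) u v = 0

/-- `l` is a Lagrange multiplier of `u` for the mass constraint: `I'(u) = l u` in the dual of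
`H²(ℝ^N)`, that is, `Δ²u - Δu - l u = μ|u|^{p-2}u + |u|^{4^*-2}u` in the weak sense. -/
def IsLagrangeMultiplier (μ p : ℝ) (u : H2 N) (l : ℝ) : Prop :=
  DifferentiableAt ℝ (energy μ p) u ∧
    ∀ v : H2 N, fderiv ℝ (energy μ p) u v = l * ∫ x, fn u x * fn v x

end Problem

end BiharmonicNLS

end

open MeasureTheory

noncomputable section

namespace BiharmonicNLS

open scoped ContDiff RealInnerProductSpace ENNReal NNReal Topology
open Filter

variable {N : ℕ}

/-! Write `σ(u) = ‖Δu‖₂² + ‖∇u‖₂²` (later `seminormSq`). At mass `c` the Gagliardo–Nirenberg and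
Sobolev inequalities bound the energy from below by `σ/2 - K c^δ σ^(pγ_p/2) - σ^(4^*/2)/Q`, where `K
= (μ/p) C_{N,p}^p`, `δ = p(1-γ_p)/2` and `Q = 4^* S^(4^*/2)`. The constants `c_*` and `r_*` are such
that this bound vanishes at `c = c_*`, `σ = r_*²`. Hence functions of mass below `c_*` have positive
energy on the sphere `σ = r_*²` (`threshold_lt`, `energy_pos_of_seminormSq_eq`). As `p < 2 + 4/N`,
spreading a function out at fixed mass makes its `L^p` term decay more slowly than `σ`, so the
energy takes negative values inside the sphere (`exists_energy_neg`). The critical point is a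
minimiser in this well.

A minimising sequence `u_n` is bounded in `H²` and has a subsequence converging weakly to a radial
`a`. Its `L^p` term converges because the embedding of radial functions is compact
(`tendsto_powInt_of_radial`). The mass and `σ` split into the parts of `a` and of `u_n - a` by
expanding squares, the critical term by the Brezis–Lieb lemma. Compactness at the critical exponent
is not needed: `σ(u_n - a)` is eventually at most barely above `r_*²`, where the critical term is
still dominated by `σ/2` (`exists_radius_gt`). So the remainder has no negative contribution, and
the energy of `a` is at most the infimum. Mass may be lost in the limit, but multiplying by `s ≥ 1`
multiplies a negative energy by at least `s²`. The scaled function therefore never meets the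
positive barrier, and rescaling `a` to mass `c` gives the minimiser (`exists_smul_mem_Vr`).

The minimiser `w` lies strictly inside the sphere, so curves on the mass constraint give criticality
in radial directions, and symmetric criticality extends it to all of `H²` (`eq_zero_of_invariant`).
Testing with `w` itself gives `λc = I'(w)w ≤ 2 I(w) < 0`, because both exponents exceed 2.

The groundwork is the density of test functions in `H²`: an element orthogonal to all of them solves
`u - Δu + Δ²u = 0` weakly, and mollifying and testing with a cutoff times the solution shows that it
vanishes. Density carries the Sobolev inequality and the translation estimate over from test
functions. Radial functions enter as the fixed space of the isometry action, and their smallness at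
infinity comes from packing many disjoint rotated balls. -/

/-! ### Test functions -/

/-- The `i`-th standard basis vector of `ℝ^N`. -/
abbrev stdVec (i : Fin N) : Sp N := EuclideanSpace.basisFun (Fin N) ℝ i

/-- The derivative of `φ` in direction `e`. -/
def dirDeriv (e : Sp N) (φ : Sp N → ℝ) : Sp N → ℝ := fun x => fderiv ℝ φ x e

lemma contDiff_dirDeriv {φ : Sp N → ℝ} (h : ContDiff ℝ ∞ φ) (e : Sp N) :
    ContDiff ℝ ∞ (dirDeriv e φ) :=
  (h.fderiv_right (m := ∞) (by simp)).clm_apply contDiff_const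

lemma IsTest.dirDeriv {φ : Sp N → ℝ} (h : IsTest φ) (e : Sp N) : IsTest (dirDeriv e φ) :=
  ⟨contDiff_dirDeriv h.1 e, h.2.fderiv_apply ℝ e⟩

lemma IsTest.continuous {φ : Sp N → ℝ} (h : IsTest φ) : Continuous φ := h.1.continuous

lemma IsTest.integrable {φ : Sp N → ℝ} (h : IsTest φ) : Integrable φ :=
  h.continuous.integrable_of_hasCompactSupport h.2

lemma laplacian_eq_sum_dirDeriv {φ : Sp N → ℝ} (h : ContDiff ℝ ∞ φ) (x : Sp N) :
    Laplacian.laplacian φ x = ∑ i, dirDeriv (stdVec i) (dirDeriv (stdVec i) φ) x := by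
  rw [InnerProductSpace.laplacian_eq_iteratedFDeriv_orthonormalBasis φ
    (EuclideanSpace.basisFun (Fin N) ℝ)]
  refine Finset.sum_congr rfl fun i _ => ?_
  rw [iteratedFDeriv_two_apply]
  have hd : DifferentiableAt ℝ (fderiv ℝ φ) x :=
    ((h.fderiv_right (m := ∞) (by simp)).differentiable (by simp)) x
  have := (hd.hasFDerivAt.clm_apply (hasFDerivAt_const (stdVec i) x)).fderiv
  change _ = fderiv ℝ (fun y => fderiv ℝ φ y (stdVec i)) x (stdVec i)
  rw [this]
  simp

lemma laplacian_eq_sum_dirDeriv' {φ : Sp N → ℝ} (h : ContDiff ℝ ∞ φ) :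
    Laplacian.laplacian φ = fun x => ∑ i, dirDeriv (stdVec i) (dirDeriv (stdVec i) φ) x :=
  funext (laplacian_eq_sum_dirDeriv h)

lemma contDiff_laplacian {φ : Sp N → ℝ} (h : ContDiff ℝ ∞ φ) :
    ContDiff ℝ ∞ (Laplacian.laplacian φ) := by
  rw [laplacian_eq_sum_dirDeriv' h]
  exact ContDiff.sum fun i _ => contDiff_dirDeriv (contDiff_dirDeriv h _) _

lemma HasCompactSupport.finset_sum {ι : Type*} (s : Finset ι) {f : ι → Sp N → ℝ}
    (h : ∀ i ∈ s, HasCompactSupport (f i)) : HasCompactSupport fun x => ∑ i ∈ s, f i x := by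
  classical
  induction s using Finset.induction_on with
  | empty => exact HasCompactSupport.zero
  | insert a s ha ih =>
    simp only [Finset.sum_insert ha]
    exact (h a (by simp)).add (ih fun i hi => h i (by simp [hi]))

lemma IsTest.laplacian {φ : Sp N → ℝ} (h : IsTest φ) : IsTest (Laplacian.laplacian φ) := by
  refine ⟨contDiff_laplacian h.1, ?_⟩
  rw [laplacian_eq_sum_dirDeriv' h.1]
  exact HasCompactSupport.finset_sum _ fun i _ => ((h.dirDeriv _).dirDeriv _).2

lemma IsTest.mul_left {f φ : Sp N → ℝ} (hf : ContDiff ℝ ∞ f) (h : IsTest φ) :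
    IsTest fun x => f x * φ x :=
  ⟨hf.mul h.1, h.2.mul_left⟩

lemma IsTest.mul_right {f φ : Sp N → ℝ} (h : IsTest φ) (hf : ContDiff ℝ ∞ f) :
    IsTest fun x => φ x * f x :=
  ⟨h.1.mul hf, h.2.mul_right⟩

lemma dirDeriv_mul {f g : Sp N → ℝ} (hf : ContDiff ℝ ∞ f) (hg : ContDiff ℝ ∞ g) (e x : Sp N) :
    dirDeriv e (fun y => f y * g y) x = dirDeriv e f x * g x + f x * dirDeriv e g x := by
  have := ((hf.differentiable (by simp) x).hasFDerivAt.mul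
    (hg.differentiable (by simp) x).hasFDerivAt).fderiv
  unfold dirDeriv
  change (fderiv ℝ (f * g) x) e = _
  rw [this]
  simp
  ring

/-- Integration by parts against a test function. -/
lemma integral_mul_dirDeriv {f φ : Sp N → ℝ} (hf : ContDiff ℝ ∞ f) (h : IsTest φ) (e : Sp N) :
    ∫ x, f x * dirDeriv e φ x = -∫ x, dirDeriv e f x * φ x :=
  integral_mul_fderiv_eq_neg_fderiv_mul_of_integrable
    (h.mul_left (contDiff_dirDeriv hf e)).integrable ((h.dirDeriv e).mul_left hf).integrable
    (h.mul_left hf).integrable (fun x _ => hf.differentiable (by simp) x)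
    (fun x _ => h.1.differentiable (by simp) x)

/-- Only `φ` has compact support: `f` will also be the Laplacian of a mollified function, which need
not have compact support. -/
lemma integral_mul_laplacian {f φ : Sp N → ℝ} (hf : ContDiff ℝ ∞ f) (h : IsTest φ) :
    ∫ x, f x * Laplacian.laplacian φ x = ∫ x, Laplacian.laplacian f x * φ x := by
  rw [laplacian_eq_sum_dirDeriv' h.1, laplacian_eq_sum_dirDeriv' hf]
  simp only [Finset.mul_sum, Finset.sum_mul]
  rw [integral_finsetSum, integral_finsetSum]
  · refine Finset.sum_congr rfl fun i _ => ?_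
    rw [integral_mul_dirDeriv hf (h.dirDeriv _), integral_mul_dirDeriv (contDiff_dirDeriv hf _) h,
      neg_neg]
  · exact fun i _ => (h.mul_left (contDiff_dirDeriv (contDiff_dirDeriv hf _) _)).integrable
  · exact fun i _ => (((h.dirDeriv _).dirDeriv _).mul_left hf).integrable

/-- The gradient of a smooth function. -/
def smoothGrad (φ : Sp N → ℝ) : Sp N → Sp N := fun x => (InnerProductSpace.toDual ℝ (Sp N)).symm (fderiv ℝ φ x)

lemma inner_smoothGrad (φ : Sp N → ℝ) (x e : Sp N) : ⟪smoothGrad φ x, e⟫ = dirDeriv e φ x := by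
  simp [smoothGrad, dirDeriv]

lemma continuous_smoothGrad {φ : Sp N → ℝ} (h : ContDiff ℝ ∞ φ) : Continuous (smoothGrad φ) :=
  (InnerProductSpace.toDual ℝ (Sp N)).symm.continuous.comp (h.continuous_fderiv (by simp))

lemma IsTest.hasCompactSupport_smoothGrad {φ : Sp N → ℝ} (h : IsTest φ) :
    HasCompactSupport (smoothGrad φ) :=
  (h.2.fderiv ℝ).comp_left (g := (InnerProductSpace.toDual ℝ (Sp N)).symm) (map_zero _)

lemma IsTest.memLp_smoothGrad {φ : Sp N → ℝ} (h : IsTest φ) :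
    MemLp (smoothGrad φ) 2 (volume : Measure (Sp N)) :=
  (continuous_smoothGrad h.1).memLp_of_hasCompactSupport h.hasCompactSupport_smoothGrad

/-! ### Basic facts on `H²` -/

lemma memLp_fn (u : H2 N) : MemLp (fn u) 2 (volume : Measure (Sp N)) := Lp.memLp _
lemma memLp_grad (u : H2 N) : MemLp (grad u) 2 (volume : Measure (Sp N)) := Lp.memLp _
lemma memLp_lap (u : H2 N) : MemLp (lap u) 2 (volume : Measure (Sp N)) := Lp.memLp _

lemma isWeakGradient (u : H2 N) : IsWeakGradient (fn u) (grad u) := u.2.1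
lemma isWeakLaplacian (u : H2 N) : IsWeakLaplacian (fn u) (lap u) := u.2.2

/-- The element of `H²` with given function, weak gradient and weak Laplacian. -/
def mkH2 (u : Sp N → ℝ) (g : Sp N → Sp N) (w : Sp N → ℝ) (hu : MemLp u 2 (volume : Measure (Sp N)))
    (hg : MemLp g 2 (volume : Measure (Sp N))) (hw : MemLp w 2 (volume : Measure (Sp N)))
    (h1 : IsWeakGradient u g) (h2 : IsWeakLaplacian u w) : H2 N :=
  ⟨WithLp.toLp 2 (hu.toLp u, WithLp.toLp 2 (hg.toLp g, hw.toLp w)), by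
    have e1 : (hu.toLp u : Sp N → ℝ) =ᵐ[volume] u := hu.coeFn_toLp
    have e2 : (hg.toLp g : Sp N → Sp N) =ᵐ[volume] g := hg.coeFn_toLp
    have e3 : (hw.toLp w : Sp N → ℝ) =ᵐ[volume] w := hw.coeFn_toLp
    refine ⟨fun φ hφ e => ?_, fun φ hφ => ?_⟩
    · refine ((integral_congr_ae ?_).trans (h1 φ hφ e)).trans
        (congrArg Neg.neg (integral_congr_ae ?_)).symm
      · filter_upwards [e1] with x hx
        simp [hx]
      · filter_upwards [e2] with x hx
        simp [hx]
    · refine ((integral_congr_ae ?_).trans (h2 φ hφ)).trans (integral_congr_ae ?_).symm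
      · filter_upwards [e1] with x hx
        simp [hx]
      · filter_upwards [e3] with x hx
        simp [hx]⟩

section mkH2
variable {u : Sp N → ℝ} {g : Sp N → Sp N} {w : Sp N → ℝ}
    (hu : MemLp u 2 (volume : Measure (Sp N)))
    (hg : MemLp g 2 (volume : Measure (Sp N))) (hw : MemLp w 2 (volume : Measure (Sp N)))
    (h1 : IsWeakGradient u g) (h2 : IsWeakLaplacian u w)

lemma fn_mkH2 : fn (mkH2 u g w hu hg hw h1 h2) =ᵐ[volume] u := hu.coeFn_toLp
lemma grad_mkH2 : grad (mkH2 u g w hu hg hw h1 h2) =ᵐ[volume] g := hg.coeFn_toLp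
lemma lap_mkH2 : lap (mkH2 u g w hu hg hw h1 h2) =ᵐ[volume] w := hw.coeFn_toLp
end mkH2

lemma fn_add (u v : H2 N) : fn (u + v) =ᵐ[volume] fn u + fn v := Lp.coeFn_add _ _
lemma fn_smul (a : ℝ) (u : H2 N) : fn (a • u) =ᵐ[volume] a • fn u := Lp.coeFn_smul _ _

lemma locallyIntegrable_of_memLp {F : Type*} [NormedAddCommGroup F] {f : Sp N → F}
    (h : MemLp f 2 (volume : Measure (Sp N))) : LocallyIntegrable f :=
  h.locallyIntegrable (by norm_num)

/-- The weak gradient and the weak Laplacian are determined by the function. -/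
lemma H2_ext {u v : H2 N} (h : fn u =ᵐ[volume] fn v) : u = v := by
  have hl : lap u =ᵐ[volume] lap v := by
    refine ae_eq_of_integral_contDiff_smul_eq (locallyIntegrable_of_memLp (memLp_lap u))
      (locallyIntegrable_of_memLp (memLp_lap v)) fun φ h1 h2 => ?_
    have hu := isWeakLaplacian u φ ⟨h1, h2⟩
    have hv := isWeakLaplacian v φ ⟨h1, h2⟩
    simp only [smul_eq_mul, mul_comm (φ _)]
    rw [← hu, ← hv]
    refine integral_congr_ae ?_
    filter_upwards [h] with x hx
    rw [hx]
  have hg : grad u =ᵐ[volume] grad v := by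
    have key : ∀ i : Fin N, ∀ᵐ x : Sp N, ⟪grad u x, stdVec i⟫ = ⟪grad v x, stdVec i⟫ := by
      intro i
      refine ae_eq_of_integral_contDiff_smul_eq
        (locallyIntegrable_of_memLp ((memLp_grad u).inner_const _))
        (locallyIntegrable_of_memLp ((memLp_grad v).inner_const _)) fun φ h1 h2 => ?_
      have hu := isWeakGradient u φ ⟨h1, h2⟩ (stdVec i)
      have hv := isWeakGradient v φ ⟨h1, h2⟩ (stdVec i)
      simp only [smul_eq_mul, mul_comm (φ _)]
      rw [← neg_inj, ← hu, ← hv]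
      refine integral_congr_ae ?_
      filter_upwards [h] with x hx
      rw [hx]
    filter_upwards [ae_all_iff.2 key] with x hx
    exact PiLp.ext fun i => by simpa [stdVec, EuclideanSpace.inner_single_right] using hx i
  apply Subtype.ext
  refine WithLp.ofLp_injective 2 (Prod.ext (Lp.ext h) ?_)
  exact WithLp.ofLp_injective 2 (Prod.ext (Lp.ext hg) (Lp.ext hl))

/-- The function, weak gradient and weak Laplacian as continuous linear maps. -/
def fnL : H2 N →L[ℝ] L2 N ℝ :=
  (WithLp.fstL 2 ℝ (L2 N ℝ) (WithLp 2 (L2 N (Sp N) × L2 N ℝ))).comp (H2 N).subtypeL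
/-- The weak gradient as a continuous linear map. -/
def gradL : H2 N →L[ℝ] L2 N (Sp N) :=
  ((WithLp.fstL 2 ℝ (L2 N (Sp N)) (L2 N ℝ)).comp
    (WithLp.sndL 2 ℝ (L2 N ℝ) (WithLp 2 (L2 N (Sp N) × L2 N ℝ)))).comp (H2 N).subtypeL
/-- The weak Laplacian as a continuous linear map. -/
def lapL : H2 N →L[ℝ] L2 N ℝ :=
  ((WithLp.sndL 2 ℝ (L2 N (Sp N)) (L2 N ℝ)).comp
    (WithLp.sndL 2 ℝ (L2 N ℝ) (WithLp 2 (L2 N (Sp N) × L2 N ℝ)))).comp (H2 N).subtypeL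

lemma coe_fnL (u : H2 N) : (fnL u : Sp N → ℝ) = fn u := rfl
lemma coe_gradL (u : H2 N) : (gradL u : Sp N → Sp N) = grad u := rfl
lemma coe_lapL (u : H2 N) : (lapL u : Sp N → ℝ) = lap u := rfl

lemma inner_eq (u v : H2 N) :
    ⟪u, v⟫ = ⟪fnL u, fnL v⟫ + (⟪gradL u, gradL v⟫ + ⟪lapL u, lapL v⟫) := by
  rw [Submodule.coe_inner, WithLp.prod_inner_apply, WithLp.prod_inner_apply]
  rfl

lemma inner_fnL (u v : H2 N) : ⟪fnL u, fnL v⟫ = ∫ x, fn u x * fn v x := by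
  rw [L2.inner_def]
  refine integral_congr_ae (Eventually.of_forall fun x => ?_)
  simp [coe_fnL, mul_comm]

lemma mass_eq (u : H2 N) : mass u = ‖fnL u‖ ^ 2 := by
  rw [← real_inner_self_eq_norm_sq, L2.inner_def]
  simp [mass, coe_fnL]

lemma gradSq_eq (u : H2 N) : gradSq u = ‖gradL u‖ ^ 2 := by
  rw [← real_inner_self_eq_norm_sq, L2.inner_def]
  simp [gradSq, coe_gradL]

lemma lapSq_eq (u : H2 N) : lapSq u = ‖lapL u‖ ^ 2 := by
  rw [← real_inner_self_eq_norm_sq, L2.inner_def]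
  simp [lapSq, coe_lapL]

lemma norm_sq_eq (u : H2 N) : ‖u‖ ^ 2 = mass u + (gradSq u + lapSq u) := by
  rw [← real_inner_self_eq_norm_sq, inner_eq, mass_eq, gradSq_eq, lapSq_eq]
  simp only [real_inner_self_eq_norm_sq]

lemma mass_nonneg (u : H2 N) : 0 ≤ mass u := by rw [mass_eq]; positivity
lemma gradSq_nonneg (u : H2 N) : 0 ≤ gradSq u := by rw [gradSq_eq]; positivity
lemma lapSq_nonneg (u : H2 N) : 0 ≤ lapSq u := by rw [lapSq_eq]; positivity

lemma mass_smul (a : ℝ) (u : H2 N) : mass (a • u) = a ^ 2 * mass u := by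
  simp [mass_eq, norm_smul, mul_pow]
lemma gradSq_smul (a : ℝ) (u : H2 N) : gradSq (a • u) = a ^ 2 * gradSq u := by
  simp [gradSq_eq, norm_smul, mul_pow]
lemma lapSq_smul (a : ℝ) (u : H2 N) : lapSq (a • u) = a ^ 2 * lapSq u := by
  simp [lapSq_eq, norm_smul, mul_pow]

lemma mass_pos {u : H2 N} (hu : u ≠ 0) : 0 < mass u := by
  refine lt_of_le_of_ne (mass_nonneg u) fun h => hu (H2_ext ?_)
  rw [mass_eq] at h
  have h0 : fnL u = fnL 0 := by
    rw [map_zero]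
    simpa using h.symm
  rw [← coe_fnL, ← coe_fnL, h0]

/-- Pairing of an `L²` function with a fixed `L²` function as a continuous functional. -/
lemma continuous_integral_mul {ψ : Sp N → ℝ} (h : MemLp ψ 2 (volume : Measure (Sp N))) :
    Continuous fun f : L2 N ℝ => ∫ x, f x * ψ x := by
  have : (fun f : L2 N ℝ => ∫ x, f x * ψ x) = fun f : L2 N ℝ => ⟪h.toLp ψ, f⟫ := by
    funext f
    rw [L2.inner_def]
    refine integral_congr_ae ?_
    filter_upwards [h.coeFn_toLp] with x hx
    simp [hx]
  rw [this]
  fun_prop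

lemma continuous_integral_inner_mul {ψ : Sp N → ℝ} (h : MemLp ψ 2 (volume : Measure (Sp N)))
    (e : Sp N) : Continuous fun f : L2 N (Sp N) => ∫ x, ⟪f x, e⟫ * ψ x := by
  have h' : MemLp (fun x => ψ x • e) 2 (volume : Measure (Sp N)) :=
    ((ContinuousLinearMap.id ℝ ℝ).smulRight e).comp_memLp' h
  have : (fun f : L2 N (Sp N) => ∫ x, ⟪f x, e⟫ * ψ x) =
      fun f : L2 N (Sp N) => ⟪h'.toLp _, f⟫ := by
    funext f
    rw [L2.inner_def]
    refine integral_congr_ae ?_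
    filter_upwards [h'.coeFn_toLp] with x hx
    simp [hx, inner_smul_left, real_inner_comm, mul_comm]
  rw [this]
  fun_prop

/-- For a fixed test function each defining identity equates two continuous functionals of the
triple. The resulting completeness is what Riesz representation and weak compactness in `H²` rest
on. -/
lemma isClosed_H2 : IsClosed (H2 N : Set (Triples N)) := by
  have : (H2 N : Set (Triples N)) =
      (⋂ (φ : Sp N → ℝ) (_ : IsTest φ) (e : Sp N), {z | ∫ x, z.fst x * fderiv ℝ φ x e =
        -∫ x, ⟪z.snd.fst x, e⟫ * φ x}) ∩
      ⋂ (φ : Sp N → ℝ) (_ : IsTest φ), {z | ∫ x, z.fst x * Laplacian.laplacian φ x =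
        ∫ x, z.snd.snd x * φ x} := by
    ext z
    simp only [Set.mem_inter_iff, Set.mem_iInter, Set.mem_ofPred_eq]
    rfl
  have hs : Continuous fun z : Triples N => z.snd := (WithLp.sndL 2 ℝ _ _).continuous
  have hf : Continuous fun z : Triples N => z.fst := (WithLp.fstL 2 ℝ _ _).continuous
  have hsf : Continuous fun z : Triples N => z.snd.fst := (WithLp.fstL 2 ℝ _ _).continuous.comp hs
  have hss : Continuous fun z : Triples N => z.snd.snd := (WithLp.sndL 2 ℝ _ _).continuous.comp hs
  rw [this]
  refine IsClosed.inter ?_ ?_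
  · refine isClosed_iInter fun φ => isClosed_iInter fun hφ => isClosed_iInter fun e => ?_
    exact isClosed_eq ((continuous_integral_mul (hφ.memLp_fderiv e)).comp hf)
      ((continuous_integral_inner_mul hφ.memLp e).comp hsf).neg
  · refine isClosed_iInter fun φ => isClosed_iInter fun hφ => ?_
    exact isClosed_eq ((continuous_integral_mul hφ.memLp_laplacian).comp hf)
      ((continuous_integral_mul hφ.memLp).comp hss)

instance instCompleteSpaceH2 : CompleteSpace (H2 N) := isClosed_H2.completeSpace_coe

/-- A test function as an element of `H²`. -/
def ofTest (φ : Sp N → ℝ) (h : IsTest φ) : H2 N :=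
  mkH2 φ (smoothGrad φ) (Laplacian.laplacian φ) h.memLp h.memLp_smoothGrad h.memLp_laplacian
    (fun ψ hψ e => by
      simp only [inner_smoothGrad]
      exact integral_mul_dirDeriv h.1 hψ e)
    (fun ψ hψ => integral_mul_laplacian h.1 hψ)

lemma fn_ofTest {φ : Sp N → ℝ} (h : IsTest φ) : fn (ofTest φ h) =ᵐ[volume] φ := fn_mkH2 ..
lemma grad_ofTest {φ : Sp N → ℝ} (h : IsTest φ) : grad (ofTest φ h) =ᵐ[volume] smoothGrad φ :=
  grad_mkH2 ..
lemma lap_ofTest {φ : Sp N → ℝ} (h : IsTest φ) :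
    lap (ofTest φ h) =ᵐ[volume] Laplacian.laplacian φ := lap_mkH2 ..

/-! ### The Sobolev inequality for test functions -/

lemma fderiv_fderiv_apply {φ : Sp N → ℝ} (h : ContDiff ℝ ∞ φ) (x a b : Sp N) :
    fderiv ℝ (fderiv ℝ φ) x a b = dirDeriv a (dirDeriv b φ) x := by
  have hd : DifferentiableAt ℝ (fderiv ℝ φ) x :=
    ((h.fderiv_right (m := ∞) (by simp)).differentiable (by simp)) x
  have := (hd.hasFDerivAt.clm_apply (hasFDerivAt_const b x)).fderiv
  change _ = fderiv ℝ (fun y => fderiv ℝ φ y b) x a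
  rw [this]
  simp

lemma dirDeriv_comm {φ : Sp N → ℝ} (h : ContDiff ℝ ∞ φ) (e e' : Sp N) :
    dirDeriv e (dirDeriv e' φ) = dirDeriv e' (dirDeriv e φ) := by
  funext x
  rw [← fderiv_fderiv_apply h, ← fderiv_fderiv_apply h]
  exact ((h.contDiffAt (x := x)).isSymmSndFDerivAt
    (by simp only [minSmoothness_of_isRCLikeNormedField]; exact WithTop.coe_le_coe.2 le_top)).eq e e'

/-- Two integrations by parts and the symmetry of second derivatives turn `∫ (∂ᵢ∂ⱼφ)²` into `∫ ∂ᵢ²φ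
∂ⱼ²φ`. Thus the Laplacian alone controls all second derivatives in `L²`. -/
lemma integral_hessian_sq {φ : Sp N → ℝ} (h : IsTest φ) :
    ∑ i, ∑ j, ∫ x, dirDeriv (stdVec i) (dirDeriv (stdVec j) φ) x ^ 2 =
      ∫ x, Laplacian.laplacian φ x ^ 2 := by
  have key : ∀ i j : Fin N, ∫ x, dirDeriv (stdVec i) (dirDeriv (stdVec j) φ) x ^ 2 =
      ∫ x, dirDeriv (stdVec i) (dirDeriv (stdVec i) φ) x *
        dirDeriv (stdVec j) (dirDeriv (stdVec j) φ) x := by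
    intro i j
    have hi := h.dirDeriv (stdVec i)
    have hj := h.dirDeriv (stdVec j)
    have hij := hj.dirDeriv (stdVec i)
    have hii := hi.dirDeriv (stdVec i)
    simp only [pow_two]
    rw [integral_mul_dirDeriv hij.1 hj, integral_mul_dirDeriv hii.1 hj,
      dirDeriv_comm h.1 (stdVec i) (stdVec j), dirDeriv_comm hi.1 (stdVec i) (stdVec j)]
  simp only [key]
  have hint : ∀ i j : Fin N, Integrable fun x => dirDeriv (stdVec i) (dirDeriv (stdVec i) φ) x *
        dirDeriv (stdVec j) (dirDeriv (stdVec j) φ) x := fun i j =>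
    (((h.dirDeriv _).dirDeriv _).mul_left ((h.dirDeriv _).dirDeriv _).1).integrable
  rw [laplacian_eq_sum_dirDeriv' h.1]
  simp only [pow_two, Finset.sum_mul_sum]
  rw [integral_finsetSum _ fun i _ => integrable_finsetSum _ fun j _ => hint i j]
  refine Finset.sum_congr rfl fun i _ => ?_
  rw [integral_finsetSum _ fun j _ => hint i j]

/-- Cauchy–Schwarz: the operator norm is at most the Hilbert–Schmidt norm. -/
lemma sq_opNorm_le_sum {F : Type*} [NormedAddCommGroup F] [NormedSpace ℝ F] (A : Sp N →L[ℝ] F) :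
    ‖A‖ ^ 2 ≤ ∑ i, ‖A (stdVec i)‖ ^ 2 := by
  have h0 : 0 ≤ ∑ i, ‖A (stdVec i)‖ ^ 2 := Finset.sum_nonneg fun i _ => by positivity
  rw [← Real.le_sqrt (norm_nonneg _) h0]
  refine A.opNorm_le_bound (Real.sqrt_nonneg _) fun v => ?_
  have hv : A v = ∑ i, v i • A (stdVec i) := by
    conv_lhs => rw [← (EuclideanSpace.basisFun (Fin N) ℝ).sum_repr v]
    simp
  rw [hv, EuclideanSpace.norm_eq, mul_comm]
  refine (norm_sum_le _ _).trans ?_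
  simp only [norm_smul]
  exact Real.sum_mul_le_sqrt_mul_sqrt _ _ _

lemma eLpNorm_two_le_of_integral_sq_le {F G : Type*} [NormedAddCommGroup F]
    [NormedAddCommGroup G] {f : Sp N → F} {g : Sp N → G}
    (hf : MemLp f 2 (volume : Measure (Sp N))) (hg : MemLp g 2 (volume : Measure (Sp N)))
    (h : ∫ x, ‖f x‖ ^ 2 ≤ ∫ x, ‖g x‖ ^ 2) :
    eLpNorm f 2 (volume : Measure (Sp N)) ≤ eLpNorm g 2 volume := by
  rw [hf.eLpNorm_eq_integral_rpow_norm (by simp) (by simp),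
    hg.eLpNorm_eq_integral_rpow_norm (by simp) (by simp)]
  refine ENNReal.ofReal_le_ofReal (Real.rpow_le_rpow ?_ ?_ (by simp))
  · exact integral_nonneg fun x => by positivity
  · simpa using h

lemma sq_norm_hessian_le {φ : Sp N → ℝ} (h : ContDiff ℝ ∞ φ) (x : Sp N) :
    ‖fderiv ℝ (fderiv ℝ φ) x‖ ^ 2 ≤
      ∑ i, ∑ j, dirDeriv (stdVec i) (dirDeriv (stdVec j) φ) x ^ 2 := by
  refine (sq_opNorm_le_sum _).trans (Finset.sum_le_sum fun i _ => ?_)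
  refine (sq_opNorm_le_sum _).trans (Finset.sum_le_sum fun j _ => ?_)
  rw [fderiv_fderiv_apply h, Real.norm_eq_abs, sq_abs]

lemma IsTest.memLp_hessian {φ : Sp N → ℝ} (h : IsTest φ) :
    MemLp (fderiv ℝ (fderiv ℝ φ)) 2 (volume : Measure (Sp N)) := by
  have hc : ContDiff ℝ ∞ (fderiv ℝ φ) := h.1.fderiv_right (m := ∞) (by simp)
  exact (hc.continuous_fderiv (by simp)).memLp_of_hasCompactSupport ((h.2.fderiv ℝ).fderiv ℝ)

lemma integral_sq_norm_hessian_le {φ : Sp N → ℝ} (h : IsTest φ) :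
    ∫ x, ‖fderiv ℝ (fderiv ℝ φ) x‖ ^ 2 ≤ ∫ x, ‖Laplacian.laplacian φ x‖ ^ 2 := by
  have hij : ∀ i j : Fin N, Integrable fun x =>
      dirDeriv (stdVec i) (dirDeriv (stdVec j) φ) x ^ 2 := fun i j => by
    have := ((h.dirDeriv (stdVec j)).dirDeriv (stdVec i))
    simpa only [pow_two] using (this.mul_left this.1).integrable
  have hi : ∀ i : Fin N, Integrable fun x =>
      ∑ j, dirDeriv (stdVec i) (dirDeriv (stdVec j) φ) x ^ 2 :=
    fun i => integrable_finsetSum _ fun j _ => hij i j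
  have e : ∫ x, ‖Laplacian.laplacian φ x‖ ^ 2 =
      ∫ x, ∑ i, ∑ j, dirDeriv (stdVec i) (dirDeriv (stdVec j) φ) x ^ 2 := by
    simp only [Real.norm_eq_abs, sq_abs]
    rw [← integral_hessian_sq h, integral_finsetSum _ fun i _ => hi i]
    exact Finset.sum_congr rfl fun i _ => (integral_finsetSum _ fun j _ => hij i j).symm
  rw [e]
  exact integral_mono_of_nonneg (Eventually.of_forall fun x => by positivity)
    (integrable_finsetSum _ fun i _ => hi i)
    (Eventually.of_forall fun x => sq_norm_hessian_le h.1 x)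

lemma eLpNorm_hessian_le {φ : Sp N → ℝ} (h : IsTest φ) :
    eLpNorm (fderiv ℝ (fderiv ℝ φ)) 2 (volume : Measure (Sp N)) ≤
      eLpNorm (Laplacian.laplacian φ) 2 (volume : Measure (Sp N)) :=
  eLpNorm_two_le_of_integral_sq_le (F := Sp N →L[ℝ] Sp N →L[ℝ] ℝ)
    (f := fderiv ℝ (fderiv ℝ φ)) h.memLp_hessian h.memLp_laplacian
    (integral_sq_norm_hessian_le h)

lemma two_lt_critExp (hN : 5 ≤ N) : 2 < critExp N := by
  have h : (5 : ℝ) ≤ N := by exact_mod_cast hN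
  rw [critExp, lt_div_iff₀ (by linarith)]
  linarith

/-- The first-order Sobolev inequality is used twice, from `D²φ` to `Dφ` and from `Dφ` to `φ`; the
Hessian is then bounded by the Laplacian. -/
lemma exists_sobolev_test (hN : 5 ≤ N) : ∃ C : ℝ≥0, ∀ φ : Sp N → ℝ, IsTest φ →
    eLpNorm φ (ENNReal.ofReal (critExp N)) volume ≤
      C * eLpNorm (Laplacian.laplacian φ) 2 volume := by
  have h5 : (5 : ℝ) ≤ N := by exact_mod_cast hN
  -- The intermediate exponent: `1/q = 1/2 - 1/N` and `1/4^* = 1/q - 1/N`.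
  let q : ℝ≥0 := ⟨2 * N / (N - 2), div_nonneg (by positivity) (by linarith)⟩
  have hq : (q : ℝ) = 2 * N / (N - 2) := rfl
  have hfr : (Module.finrank ℝ (Sp N) : ℝ) = N := by simp
  have hpos : 0 < Module.finrank ℝ (Sp N) := by simp; omega
  have hq1 : 1 ≤ q := by
    rw [← NNReal.coe_le_coe, hq, NNReal.coe_one, le_div_iff₀ (by linarith)]
    linarith
  refine ⟨SNormLESNormFDerivOfEqConst ℝ (volume : Measure (Sp N)) q *
    SNormLESNormFDerivOfEqConst (Sp N →L[ℝ] ℝ) (volume : Measure (Sp N)) (2 : ℝ≥0),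
    fun φ hφ => ?_⟩
  have e1 := eLpNorm_le_eLpNorm_fderiv_of_eq (volume : Measure (Sp N)) (u := φ)
    (hφ.1.of_le (by simp)) hφ.2 (p := q) (p' := (critExp N).toNNReal) hq1 hpos (by
      rw [hfr, Real.coe_toNNReal _ (by linarith [two_lt_critExp hN]), NNReal.coe_inv, hq, critExp]
      have : (N : ℝ) - 4 ≠ 0 := by linarith
      have : (N : ℝ) - 2 ≠ 0 := by linarith
      field_simp
      ring)
  have e2 := eLpNorm_le_eLpNorm_fderiv_of_eq (volume : Measure (Sp N)) (u := fderiv ℝ φ)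
    (hφ.1.fderiv_right (m := 1) (by norm_cast)) (hφ.2.fderiv ℝ) (p := 2) (p' := q)
    (by norm_num) hpos (by
      rw [hfr, hq]
      have : (N : ℝ) - 2 ≠ 0 := by linarith
      push_cast
      field_simp)
  refine e1.trans ?_
  rw [ENNReal.coe_mul, mul_assoc]
  gcongr
  refine e2.trans ?_
  gcongr
  exact eLpNorm_hessian_le hφ

/-! ### Averages and convolutions -/

/-- Hölder's inequality against the constant 1; for a probability measure this is Jensen's
inequality. -/
lemma rpow_lintegral_le {α : Type*} [MeasurableSpace α] (ν : Measure α) {q : ℝ} (hq : 1 < q)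
    {f : α → ℝ≥0∞} (hf : AEMeasurable f ν) :
    (∫⁻ y, f y ∂ν) ^ q ≤ ν Set.univ ^ (q - 1) * ∫⁻ y, f y ^ q ∂ν := by
  have hpq := Real.HolderConjugate.conjExponent hq
  have h := ENNReal.lintegral_mul_le_Lp_mul_Lq ν hpq hf (aemeasurable_const (b := (1 : ℝ≥0∞)))
  have h1 : (∫⁻ y, f y ∂ν) ≤
      (∫⁻ y, f y ^ q ∂ν) ^ (1 / q) * ν Set.univ ^ (1 / q.conjExponent) := by
    simpa using h
  have hq0 : 0 < q := by linarith
  calc (∫⁻ y, f y ∂ν) ^ q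
      ≤ ((∫⁻ y, f y ^ q ∂ν) ^ (1 / q) * ν Set.univ ^ (1 / q.conjExponent)) ^ q := by
        gcongr
    _ = ν Set.univ ^ (q - 1) * ∫⁻ y, f y ^ q ∂ν := by
        rw [ENNReal.mul_rpow_of_nonneg _ _ hq0.le, ← ENNReal.rpow_mul, ← ENNReal.rpow_mul, mul_comm]
        congr 2
        · rw [Real.conjExponent]
          have : q - 1 ≠ 0 := by linarith
          field_simp
        · rw [one_div_mul_cancel hq0.ne', ENNReal.rpow_one]

/-- Minkowski's inequality in the form of Jensen's inequality followed by Tonelli's theorem. -/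
lemma lintegral_rpow_lintegral_le {β : Type*} [MeasurableSpace β] (ν : Measure β) [SFinite ν]
    {q : ℝ} (hq : 1 < q) {F : Sp N → β → ℝ≥0∞} (hF : Measurable (Function.uncurry F)) :
    ∫⁻ x, (∫⁻ y, F x y ∂ν) ^ q ≤ ν Set.univ ^ (q - 1) * ∫⁻ y, ∫⁻ x, F x y ^ q ∂volume ∂ν := by
  have hFq : Measurable (Function.uncurry fun x y => F x y ^ q) := hF.pow_const q
  calc ∫⁻ x, (∫⁻ y, F x y ∂ν) ^ q
      ≤ ∫⁻ x, ν Set.univ ^ (q - 1) * ∫⁻ y, F x y ^ q ∂ν :=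
        lintegral_mono fun x => rpow_lintegral_le ν hq
          (hF.comp (measurable_const.prodMk measurable_id)).aemeasurable
    _ = ν Set.univ ^ (q - 1) * ∫⁻ x, ∫⁻ y, F x y ^ q ∂ν :=
        lintegral_const_mul _ hFq.lintegral_prod_right
    _ = _ := by rw [lintegral_lintegral_swap hFq.aemeasurable]

/-- The convolution of `f` with `ψ`. -/
def conv (ψ f : Sp N → ℝ) : Sp N → ℝ := fun x => ∫ t, f t * ψ (x - t)

lemma conv_eq_convolution (ψ f : Sp N → ℝ) :
    conv ψ f = convolution f ψ (ContinuousLinearMap.mul ℝ ℝ) volume := rfl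

lemma contDiff_conv {ψ f : Sp N → ℝ} (hψ : IsTest ψ) (hf : LocallyIntegrable f) :
    ContDiff ℝ ∞ (conv ψ f) := by
  rw [conv_eq_convolution]
  exact hψ.2.contDiff_convolution_right _ hf hψ.1

lemma dirDeriv_conv {ψ f : Sp N → ℝ} (hψ : IsTest ψ) (hf : LocallyIntegrable f) (e : Sp N) :
    dirDeriv e (conv ψ f) = conv (dirDeriv e ψ) f := by
  funext x
  have h := (hψ.2.hasFDerivAt_convolution_right (ContinuousLinearMap.mul ℝ ℝ) hf
    (hψ.1.of_le (by simp)) x).fderiv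
  rw [← conv_eq_convolution] at h
  unfold dirDeriv
  rw [h, convolution_precompR_apply _ hf (hψ.2.fderiv ℝ) (hψ.1.continuous_fderiv (by simp))]
  rfl

lemma laplacian_conv {ψ f : Sp N → ℝ} (hψ : IsTest ψ) (hf : LocallyIntegrable f) (x : Sp N) :
    Laplacian.laplacian (conv ψ f) x =
      ∑ i, conv (dirDeriv (stdVec i) (dirDeriv (stdVec i) ψ)) f x := by
  rw [laplacian_eq_sum_dirDeriv (contDiff_conv hψ hf)]
  simp only [dirDeriv_conv hψ hf, dirDeriv_conv (hψ.dirDeriv _) hf]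

/-- Young's inequality for `L¹ * L²`: with `|ψ| dy` as a finite measure, the convolution is bounded
by an integral of translates of `|f|`, all of which have the same `L²` norm. -/
lemma memLp_conv {ψ f : Sp N → ℝ} (hψ : IsTest ψ) (hm : Measurable f)
    (hf : MemLp f 2 (volume : Measure (Sp N))) :
    MemLp (conv ψ f) 2 (volume : Measure (Sp N)) := by
  refine ⟨(contDiff_conv hψ (locallyIntegrable_of_memLp hf)).continuous.aestronglyMeasurable, ?_⟩
  set ν : Measure (Sp N) := volume.withDensity fun y => ‖ψ y‖ₑ with hν
  have hψm : Measurable fun y => ‖ψ y‖ₑ := hψ.continuous.measurable.enorm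
  have hfin : ν Set.univ < ⊤ := by
    rw [hν, withDensity_apply _ MeasurableSet.univ, Measure.restrict_univ]
    exact hψ.integrable.2
  have : IsFiniteMeasure ν := ⟨hfin⟩
  have hF : Measurable (Function.uncurry fun x y : Sp N => ‖f (x - y)‖ₑ) :=
    (hm.comp measurable_sub).enorm
  have hle : ∀ x, ‖conv ψ f x‖ₑ ≤ ∫⁻ y, ‖f (x - y)‖ₑ ∂ν := by
    intro x
    refine (enorm_integral_le_lintegral_enorm _).trans_eq ?_
    have hx : Measurable fun y => ‖f (x - y)‖ₑ := (hm.comp (measurable_const.sub measurable_id)).enorm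
    rw [hν, lintegral_withDensity_eq_lintegral_mul _ hψm hx]
    rw [← lintegral_sub_left_eq_self _ x]
    refine lintegral_congr fun y => ?_
    simp [enorm_mul, mul_comm]
  have h2 := lintegral_rpow_lintegral_le ν (q := 2) (by norm_num) hF
  have hconst : ∀ y : Sp N, ∫⁻ x, ‖f (x - y)‖ₑ ^ (2 : ℝ) = ∫⁻ x, ‖f x‖ₑ ^ (2 : ℝ) := fun y =>
    lintegral_sub_right_eq_self (fun x => ‖f x‖ₑ ^ (2 : ℝ)) y
  simp only [hconst, lintegral_const] at h2
  have hf2 : ∫⁻ x, ‖f x‖ₑ ^ (2 : ℝ) < ⊤ := by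
    simpa using lintegral_rpow_enorm_lt_top_of_eLpNorm_lt_top (by simp) (by simp) hf.2
  refine (eLpNorm_lt_top_iff_lintegral_rpow_enorm_lt_top (by simp) (by simp)).2 ?_
  refine lt_of_le_of_lt ?_ (h2.trans_lt ?_)
  · refine lintegral_mono fun x => ?_
    simp only [ENNReal.toReal_ofNat]
    gcongr
    exact hle x
  · refine ENNReal.mul_lt_top (ENNReal.rpow_lt_top_of_nonneg (by norm_num) hfin.ne) ?_
    exact ENNReal.mul_lt_top hf2 hfin

lemma measurable_fn (u : H2 N) : Measurable (fn u) := (Lp.stronglyMeasurable _).measurable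

/-! ### Reflected translates and dilates of test functions -/

lemma isTest_comp_sub {ψ : Sp N → ℝ} (hψ : IsTest ψ) (x : Sp N) : IsTest fun t => ψ (x - t) :=
  ⟨hψ.1.comp (contDiff_const.sub contDiff_id),
    hψ.2.comp_homeomorph (Homeomorph.subLeft x)⟩

lemma dirDeriv_comp_sub {ψ : Sp N → ℝ} (hψ : ContDiff ℝ ∞ ψ) (x e : Sp N) :
    dirDeriv e (fun t => ψ (x - t)) = fun t => -dirDeriv e ψ (x - t) := by
  funext t
  have h := ((hψ.differentiable (by simp) (x - t)).hasFDerivAt.comp t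
    ((hasFDerivAt_const x t).sub (hasFDerivAt_id t))).fderiv
  change fderiv ℝ (ψ ∘ fun t => x - t) t e = _
  refine (congrArg (fun A : Sp N →L[ℝ] ℝ => A e) h).trans ?_
  simp [dirDeriv]

lemma dirDeriv_neg (f : Sp N → ℝ) (e : Sp N) :
    dirDeriv e (fun t => -f t) = fun t => -dirDeriv e f t := by
  funext t
  simp [dirDeriv]

/-- The two sign changes cancel. Hence testing a weak identity with `t ↦ ψ (x - t)` gives the same
identity, at the point `x`, for convolutions with `ψ`. -/
lemma laplacian_comp_sub {ψ : Sp N → ℝ} (hψ : IsTest ψ) (x t : Sp N) :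
    Laplacian.laplacian (fun t => ψ (x - t)) t = Laplacian.laplacian ψ (x - t) := by
  rw [laplacian_eq_sum_dirDeriv (isTest_comp_sub hψ x).1, laplacian_eq_sum_dirDeriv hψ.1]
  refine Finset.sum_congr rfl fun i _ => ?_
  rw [dirDeriv_comp_sub hψ.1, dirDeriv_neg, dirDeriv_comp_sub (contDiff_dirDeriv hψ.1 _)]
  simp

lemma dirDeriv_comp_smul {φ : Sp N → ℝ} (hφ : ContDiff ℝ ∞ φ) (a : ℝ) (e : Sp N) :
    dirDeriv e (fun x => φ (a • x)) = fun x => a * dirDeriv e φ (a • x) := by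
  funext x
  have h := ((hφ.differentiable (by simp) (a • x)).hasFDerivAt.comp x
    ((hasFDerivAt_id x).const_smul a)).fderiv
  change fderiv ℝ (φ ∘ fun x => a • x) x e = _
  refine (congrArg (fun A : Sp N →L[ℝ] ℝ => A e) h).trans ?_
  simp [dirDeriv]

lemma dirDeriv_const_mul {φ : Sp N → ℝ} (hφ : ContDiff ℝ ∞ φ) (a : ℝ) (e : Sp N) :
    dirDeriv e (fun x => a * φ x) = fun x => a * dirDeriv e φ x := by
  funext x
  have h := ((hφ.differentiable (by simp) x).hasFDerivAt.const_mul a).fderiv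
  refine (congrArg (fun A : Sp N →L[ℝ] ℝ => A e) h).trans ?_
  simp [dirDeriv]

lemma contDiff_comp_smul {φ : Sp N → ℝ} (hφ : ContDiff ℝ ∞ φ) (a : ℝ) :
    ContDiff ℝ ∞ fun x : Sp N => φ (a • x) :=
  hφ.comp (contDiff_const_smul a)

lemma IsTest.comp_smul {φ : Sp N → ℝ} (hφ : IsTest φ) {a : ℝ} (ha : a ≠ 0) :
    IsTest fun x => φ (a • x) :=
  ⟨contDiff_comp_smul hφ.1 a, hφ.2.comp_homeomorph (Homeomorph.smulOfNeZero a ha)⟩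

lemma laplacian_comp_smul {φ : Sp N → ℝ} (hφ : ContDiff ℝ ∞ φ) (a : ℝ) (x : Sp N) :
    Laplacian.laplacian (fun x => φ (a • x)) x = a ^ 2 * Laplacian.laplacian φ (a • x) := by
  rw [laplacian_eq_sum_dirDeriv (contDiff_comp_smul hφ a), laplacian_eq_sum_dirDeriv hφ,
    Finset.mul_sum]
  refine Finset.sum_congr rfl fun i _ => ?_
  rw [dirDeriv_comp_smul hφ, dirDeriv_const_mul (contDiff_comp_smul (contDiff_dirDeriv hφ _) _),
    dirDeriv_comp_smul (contDiff_dirDeriv hφ _)]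
  ring

/-- A radial cutoff function, equal to `1` on the unit ball. -/
def cutoff (x : Sp N) : ℝ := Real.smoothTransition (2 - ‖x‖ ^ 2)

lemma isTest_cutoff : IsTest (cutoff : Sp N → ℝ) := by
  refine ⟨Real.smoothTransition.contDiff.comp (contDiff_const.sub (contDiff_norm_sq ℝ)), ?_⟩
  refine HasCompactSupport.of_support_subset_isCompact (isCompact_closedBall (0 : Sp N) 2) ?_
  intro x hx
  rw [mem_closedBall_zero_iff]
  by_contra! h
  refine hx (Real.smoothTransition.zero_of_nonpos ?_)
  nlinarith

lemma cutoff_eq_one {x : Sp N} (hx : ‖x‖ ≤ 1) : cutoff x = 1 := by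
  refine Real.smoothTransition.one_of_one_le ?_
  nlinarith [norm_nonneg x]

/-! ### Density of test functions in `H²` -/

lemma laplacian_mul {f g : Sp N → ℝ} (hf : ContDiff ℝ ∞ f) (hg : ContDiff ℝ ∞ g) (x : Sp N) :
    Laplacian.laplacian (fun y => f y * g y) x = Laplacian.laplacian f x * g x +
      2 * ∑ i, dirDeriv (stdVec i) f x * dirDeriv (stdVec i) g x +
        f x * Laplacian.laplacian g x := by
  rw [laplacian_eq_sum_dirDeriv (hf.mul hg), laplacian_eq_sum_dirDeriv hf,
    laplacian_eq_sum_dirDeriv hg, Finset.sum_mul, Finset.mul_sum, Finset.mul_sum,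
    ← Finset.sum_add_distrib, ← Finset.sum_add_distrib]
  refine Finset.sum_congr rfl fun i _ => ?_
  have hdf := contDiff_dirDeriv hf (stdVec i)
  have hdg := contDiff_dirDeriv hg (stdVec i)
  have e1 : dirDeriv (stdVec i) (fun y => f y * g y) =
      fun y => dirDeriv (stdVec i) f y * g y + f y * dirDeriv (stdVec i) g y :=
    funext fun y => dirDeriv_mul hf hg _ y
  have h := (((hdf.mul hg).differentiable (by simp) x).hasFDerivAt.add
    ((hf.mul hdg).differentiable (by simp) x).hasFDerivAt).fderiv
  have e2 : dirDeriv (stdVec i) (fun y => dirDeriv (stdVec i) f y * g y +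
      f y * dirDeriv (stdVec i) g y) x = dirDeriv (stdVec i) (fun y => dirDeriv (stdVec i) f y * g y) x
        + dirDeriv (stdVec i) (fun y => f y * dirDeriv (stdVec i) g y) x :=
    congrArg (fun A : Sp N →L[ℝ] ℝ => A (stdVec i)) h
  rw [e1, e2, dirDeriv_mul hdf hg, dirDeriv_mul hf hdg]
  ring

/-- The weak form of `U - ΔU + Δ²U = 0` tested with `ηU`. -/
lemma integral_cutoff_identity {U η : Sp N → ℝ} (hU : ContDiff ℝ ∞ U) (hη : IsTest η)
    (heq : ∀ x, U x - Laplacian.laplacian U x + Laplacian.laplacian (Laplacian.laplacian U) x = 0) :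
    ∫ x, (η x * (U x ^ 2 + ∑ i, dirDeriv (stdVec i) U x ^ 2 + Laplacian.laplacian U x ^ 2) +
      ∑ i, dirDeriv (stdVec i) η x *
        (dirDeriv (stdVec i) U x * (U x + 2 * Laplacian.laplacian U x)) +
      Laplacian.laplacian η x * (U x * Laplacian.laplacian U x)) = 0 := by
  have hηU : IsTest fun x => η x * U x := hη.mul_right hU
  have hL := contDiff_laplacian hU
  have i1 : Integrable fun x => U x * (η x * U x) := (hηU.mul_left hU).integrable
  have i2 : ∀ i : Fin N, Integrable fun x =>
      dirDeriv (stdVec i) U x * dirDeriv (stdVec i) (fun x => η x * U x) x := fun i =>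
    ((hηU.dirDeriv (stdVec i)).mul_left (contDiff_dirDeriv hU (stdVec i))).integrable
  have i3 : Integrable fun x => Laplacian.laplacian U x *
      Laplacian.laplacian (fun x => η x * U x) x := (hηU.laplacian.mul_left hL).integrable
  have e1 : ∀ i : Fin N, ∫ x, dirDeriv (stdVec i) U x * dirDeriv (stdVec i) (fun x => η x * U x) x =
      -∫ x, dirDeriv (stdVec i) (dirDeriv (stdVec i) U) x * (η x * U x) := fun i =>
    integral_mul_dirDeriv (contDiff_dirDeriv hU _) hηU _
  have e2 := integral_mul_laplacian hL hηU
  have j2 : ∀ i : Fin N, Integrable fun x =>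
      dirDeriv (stdVec i) (dirDeriv (stdVec i) U) x * (η x * U x) := fun i =>
    (hηU.mul_left (contDiff_dirDeriv (contDiff_dirDeriv hU _) _)).integrable
  have e3 : ∑ i, ∫ x, dirDeriv (stdVec i) U x * dirDeriv (stdVec i) (fun x => η x * U x) x =
      -∫ x, Laplacian.laplacian U x * (η x * U x) := by
    simp only [e1, Finset.sum_neg_distrib]
    rw [← integral_finsetSum _ fun i _ => j2 i]
    simp only [laplacian_eq_sum_dirDeriv hU, Finset.sum_mul]
  have j3 : Integrable fun x => Laplacian.laplacian U x * (η x * U x) :=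
    (hηU.mul_left hL).integrable
  have j4 : Integrable fun x => Laplacian.laplacian (Laplacian.laplacian U) x * (η x * U x) :=
    (hηU.mul_left (contDiff_laplacian hL)).integrable
  have i12 : Integrable fun x => U x * (η x * U x) +
      ∑ i, dirDeriv (stdVec i) U x * dirDeriv (stdVec i) (fun x => η x * U x) x :=
    i1.add (integrable_finsetSum _ fun i _ => i2 i)
  have i13 : Integrable fun x => U x * (η x * U x) - Laplacian.laplacian U x * (η x * U x) :=
    i1.sub j3
  -- Expanding the derivatives of `ηU`, the terms in which `η` is not differentiated form `η (U² +
  -- |∇U|² + (ΔU)²)`; every other term carries a derivative of `η`.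
  calc _ = ∫ x, (U x * (η x * U x) +
        ∑ i, dirDeriv (stdVec i) U x * dirDeriv (stdVec i) (fun x => η x * U x) x +
        Laplacian.laplacian U x * Laplacian.laplacian (fun x => η x * U x) x) := by
        refine integral_congr_ae (Eventually.of_forall fun x => ?_)
        simp only [dirDeriv_mul hη.1 hU, laplacian_mul hη.1 hU]
        have s1 : ∑ i, dirDeriv (stdVec i) U x *
            (dirDeriv (stdVec i) η x * U x + η x * dirDeriv (stdVec i) U x) =
            U x * ∑ i, dirDeriv (stdVec i) η x * dirDeriv (stdVec i) U x +
              η x * ∑ i, dirDeriv (stdVec i) U x ^ 2 := by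
          rw [Finset.mul_sum, Finset.mul_sum, ← Finset.sum_add_distrib]
          exact Finset.sum_congr rfl fun i _ => by ring
        have s2 : ∑ i, dirDeriv (stdVec i) η x *
            (dirDeriv (stdVec i) U x * (U x + 2 * Laplacian.laplacian U x)) =
            (U x + 2 * Laplacian.laplacian U x) *
              ∑ i, dirDeriv (stdVec i) η x * dirDeriv (stdVec i) U x := by
          rw [Finset.mul_sum]
          exact Finset.sum_congr rfl fun i _ => by ring
        rw [s1, s2]
        ring
    _ = (∫ x, U x * (η x * U x)) + (-∫ x, Laplacian.laplacian U x * (η x * U x)) +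
        ∫ x, Laplacian.laplacian (Laplacian.laplacian U) x * (η x * U x) := by
        rw [integral_add i12 i3, integral_add i1 (integrable_finsetSum _ fun i _ => i2 i),
          integral_finsetSum _ fun i _ => i2 i, e2, e3]
    _ = ∫ x, (U x * (η x * U x) - Laplacian.laplacian U x * (η x * U x) +
        Laplacian.laplacian (Laplacian.laplacian U) x * (η x * U x)) := by
        rw [integral_add i13 j4, integral_sub i1 j3, sub_eq_add_neg]
    _ = 0 := by
        rw [← integral_zero (Sp N) ℝ]
        refine integral_congr_ae (Eventually.of_forall fun x => ?_)
        have := heq x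
        simp only
        linear_combination (η x * U x) * this

/-- The weak identity is used with cutoffs `η_n(x) = χ(x/(n+1))`. Their first and second derivatives
are of order `1/(n+1)` and `1/(n+1)²`, while `A`, `B i` and `D` below are integrable. Dominated
convergence leaves `∫ A = 0`, and `A` is a sum of squares containing `U²`. -/
lemma eq_zero_of_smooth_solution {U : Sp N → ℝ} (hU : ContDiff ℝ ∞ U)
    (h0 : MemLp U 2 (volume : Measure (Sp N)))
    (h1 : ∀ i : Fin N, MemLp (dirDeriv (stdVec i) U) 2 (volume : Measure (Sp N)))
    (h2 : MemLp (Laplacian.laplacian U) 2 (volume : Measure (Sp N)))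
    (heq : ∀ x, U x - Laplacian.laplacian U x + Laplacian.laplacian (Laplacian.laplacian U) x = 0) :
    U = 0 := by
  set A : Sp N → ℝ := fun x =>
    U x ^ 2 + ∑ i, dirDeriv (stdVec i) U x ^ 2 + Laplacian.laplacian U x ^ 2 with hA
  set B : Fin N → Sp N → ℝ := fun i x =>
    dirDeriv (stdVec i) U x * (U x + 2 * Laplacian.laplacian U x) with hB
  set D : Sp N → ℝ := fun x => U x * Laplacian.laplacian U x with hD
  have iA : Integrable A :=
    (h0.integrable_sq.add (integrable_finsetSum _ fun i _ => (h1 i).integrable_sq)).add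
      h2.integrable_sq
  have iB : ∀ i, Integrable (B i) := fun i => (h1 i).integrable_mul (h0.add (h2.const_mul 2))
  have iD : Integrable D := h0.integrable_mul h2
  set a : ℕ → ℝ := fun n => 1 / ((n : ℝ) + 1) with ha
  have ha0 : ∀ n, 0 < a n := fun n => by positivity
  have ha1 : ∀ n, a n ≤ 1 := fun n => by
    rw [ha]; simp only; rw [div_le_one (by positivity)]; linarith [n.cast_nonneg (α := ℝ)]
  have hat : Tendsto a atTop (𝓝 0) := tendsto_one_div_add_atTop_nhds_zero_nat
  set η : ℕ → Sp N → ℝ := fun n x => cutoff (a n • x) with hη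
  have hηt : ∀ n, IsTest (η n) := fun n => isTest_cutoff.comp_smul (ha0 n).ne'
  have hid := fun n => integral_cutoff_identity hU (hηt n) heq
  have hct : IsTest (cutoff : Sp N → ℝ) := isTest_cutoff
  obtain ⟨C0, hC0⟩ := hct.2.exists_bound_of_continuous hct.continuous
  have hC1' : ∀ i : Fin N, ∃ C, ∀ x, ‖dirDeriv (stdVec i) cutoff x‖ ≤ C := fun i =>
    (hct.dirDeriv (stdVec i)).2.exists_bound_of_continuous (hct.dirDeriv (stdVec i)).continuous
  choose C1 hC1 using hC1'
  obtain ⟨C2, hC2⟩ := hct.laplacian.2.exists_bound_of_continuous hct.laplacian.continuous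
  have d1 : ∀ n i x, dirDeriv (stdVec i) (η n) x = a n * dirDeriv (stdVec i) cutoff (a n • x) :=
    fun n i x => congrFun (dirDeriv_comp_smul hct.1 (a n) (stdVec i)) x
  have d2 : ∀ n x, Laplacian.laplacian (η n) x =
      a n ^ 2 * Laplacian.laplacian cutoff (a n • x) := fun n x => laplacian_comp_smul hct.1 (a n) x
  have hlim : Tendsto (fun n => ∫ x, (η n x * A x + ∑ i, dirDeriv (stdVec i) (η n) x * B i x +
      Laplacian.laplacian (η n) x * D x)) atTop (𝓝 (∫ x, A x)) := by
    refine tendsto_integral_of_dominated_convergence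
      (fun x => C0 * ‖A x‖ + ∑ i, C1 i * ‖B i x‖ + C2 * ‖D x‖) ?_ ?_ ?_ ?_
    · intro n
      refine AEStronglyMeasurable.add (AEStronglyMeasurable.add
        ((hηt n).continuous.aestronglyMeasurable.mul iA.1) ?_)
        ((hηt n).laplacian.continuous.aestronglyMeasurable.mul iD.1)
      exact Finset.aestronglyMeasurable_fun_sum _ fun i _ =>
        ((hηt n).dirDeriv _).continuous.aestronglyMeasurable.mul (iB i).1
    · exact ((iA.norm.const_mul _).add (integrable_finsetSum _ fun i _ =>
        ((iB i).norm.const_mul _))).add (iD.norm.const_mul _)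
    · intro n
      refine Eventually.of_forall fun x => ?_
      refine (norm_add_le _ _).trans (add_le_add ((norm_add_le _ _).trans (add_le_add ?_ ?_)) ?_)
      · rw [norm_mul]
        gcongr
        exact hC0 _
      · refine (norm_sum_le _ _).trans (Finset.sum_le_sum fun i _ => ?_)
        rw [norm_mul, d1, norm_mul, Real.norm_of_nonneg (ha0 n).le]
        gcongr
        exact (mul_le_of_le_one_left (norm_nonneg _) (ha1 n)).trans (hC1 i _)
      · rw [norm_mul, d2, norm_mul, Real.norm_of_nonneg (by positivity)]
        gcongr
        exact (mul_le_of_le_one_left (norm_nonneg _) (pow_le_one₀ (ha0 n).le (ha1 n))).trans (hC2 _)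
    · refine Eventually.of_forall fun x => ?_
      have hη1 : Tendsto (fun n => η n x) atTop (𝓝 1) := by
        have : Tendsto (fun n => a n • x) atTop (𝓝 ((0 : ℝ) • x)) := hat.smul_const x
        have h3 := (hct.continuous.tendsto _).comp this
        rw [zero_smul, cutoff_eq_one (by simp)] at h3
        exact h3
      have hb : ∀ (f : Sp N → ℝ) (C : ℝ), (∀ x, ‖f x‖ ≤ C) → ∀ b : ℕ → ℝ, Tendsto b atTop (𝓝 0) →
          Tendsto (fun n => b n * f (a n • x)) atTop (𝓝 0) := by
        intro f C hf b hb
        refine squeeze_zero_norm (a := fun n => ‖b n‖ * C) (fun n => ?_) (by simpa using hb.norm.mul_const C)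
        rw [norm_mul]
        gcongr
        exact hf _
      have t1 : ∀ i, Tendsto (fun n => dirDeriv (stdVec i) (η n) x * B i x) atTop (𝓝 0) := by
        intro i
        simp only [d1]
        simpa using (hb _ _ (hC1 i) a hat).mul_const (B i x)
      have t2 : Tendsto (fun n => Laplacian.laplacian (η n) x * D x) atTop (𝓝 0) := by
        simp only [d2]
        simpa using (hb _ _ hC2 (fun n => a n ^ 2) (by simpa using hat.pow 2)).mul_const (D x)
      have := ((hη1.mul_const (A x)).add (tendsto_finsetSum Finset.univ fun i _ => t1 i)).add t2
      simpa using this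
  have hA0 : ∫ x, A x = 0 := by
    refine tendsto_nhds_unique hlim ?_
    simp only [hA, hB, hD, hid]
    exact tendsto_const_nhds
  have hAn : ∀ x, 0 ≤ A x := fun x => by positivity
  have hae : A =ᵐ[volume] 0 := (integral_eq_zero_iff_of_nonneg hAn iA).1 hA0
  refine (Continuous.ae_eq_iff_eq volume hU.continuous continuous_const).1 ?_
  filter_upwards [hae] with x hx
  have hx' : U x ^ 2 + ∑ i, dirDeriv (stdVec i) U x ^ 2 + Laplacian.laplacian U x ^ 2 = 0 := hx
  have : 0 ≤ ∑ i, dirDeriv (stdVec i) U x ^ 2 := Finset.sum_nonneg fun i _ => sq_nonneg _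
  have : U x ^ 2 = 0 := by nlinarith [sq_nonneg (U x), sq_nonneg (Laplacian.laplacian U x)]
  exact pow_eq_zero_iff two_ne_zero |>.1 this

lemma laplacian_conv_eq {ψ f : Sp N → ℝ} (hψ : IsTest ψ) (hf : LocallyIntegrable f) :
    Laplacian.laplacian (conv ψ f) = conv (Laplacian.laplacian ψ) f := by
  funext x
  rw [laplacian_conv hψ hf]
  unfold conv
  rw [← integral_finsetSum]
  · simp only [laplacian_eq_sum_dirDeriv hψ.1, Finset.mul_sum]
  · intro i _
    have h := ((hψ.dirDeriv (stdVec i)).dirDeriv (stdVec i))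
    exact h.2.convolutionExists_right (ContinuousLinearMap.mul ℝ ℝ) hf h.continuous x

lemma laplacian_conv_fn (u : H2 N) {ψ : Sp N → ℝ} (hψ : IsTest ψ) :
    Laplacian.laplacian (conv ψ (fn u)) = conv ψ (lap u) := by
  rw [laplacian_conv_eq hψ (locallyIntegrable_of_memLp (memLp_fn u))]
  funext x
  have h := isWeakLaplacian u _ (isTest_comp_sub hψ x)
  simp only [laplacian_comp_sub hψ] at h
  exact h

/-- The gradient pairing becomes `-∫ Δu φ`: the weak gradient is tested with the `∂ᵢφ`, then the
weak Laplacian with `φ`. The result is the distribution `u - Δu + Δ²u` applied to `φ`. -/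
lemma inner_ofTest (u : H2 N) {φ : Sp N → ℝ} (hφ : IsTest φ) :
    ⟪u, ofTest φ hφ⟫ = (∫ x, fn u x * φ x) - (∫ x, lap u x * φ x) +
      ∫ x, lap u x * Laplacian.laplacian φ x := by
  have e1 : ⟪fnL u, fnL (ofTest φ hφ)⟫ = ∫ x, fn u x * φ x := by
    rw [inner_fnL]
    refine integral_congr_ae ?_
    filter_upwards [fn_ofTest hφ] with x hx
    rw [hx]
  have e3 : ⟪lapL u, lapL (ofTest φ hφ)⟫ = ∫ x, lap u x * Laplacian.laplacian φ x := by
    rw [L2.inner_def]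
    refine integral_congr_ae ?_
    filter_upwards [lap_ofTest hφ] with x hx
    simp only [coe_lapL, hx]
    simp [mul_comm]
  have e2 : ⟪gradL u, gradL (ofTest φ hφ)⟫ = -∫ x, lap u x * φ x := by
    rw [L2.inner_def]
    have s : ∀ x, ⟪grad u x, smoothGrad φ x⟫ =
        ∑ i, ⟪grad u x, stdVec i⟫ * dirDeriv (stdVec i) φ x := by
      intro x
      rw [← (EuclideanSpace.basisFun (Fin N) ℝ).sum_inner_mul_inner]
      refine Finset.sum_congr rfl fun i _ => ?_
      rw [real_inner_comm (smoothGrad φ x), inner_smoothGrad]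
    have i1 : ∀ i : Fin N, Integrable fun x => ⟪grad u x, stdVec i⟫ * dirDeriv (stdVec i) φ x :=
      fun i => ((memLp_grad u).inner_const _).integrable_mul (hφ.dirDeriv _).memLp
    have i2 : ∀ i : Fin N, Integrable fun x =>
        fn u x * dirDeriv (stdVec i) (dirDeriv (stdVec i) φ) x :=
      fun i => (memLp_fn u).integrable_mul ((hφ.dirDeriv _).dirDeriv _).memLp
    calc _ = ∫ x, ∑ i, ⟪grad u x, stdVec i⟫ * dirDeriv (stdVec i) φ x := by
          refine integral_congr_ae ?_
          filter_upwards [grad_ofTest hφ] with x hx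
          simp only [coe_gradL, hx, s]
      _ = ∑ i, -∫ x, fn u x * dirDeriv (stdVec i) (dirDeriv (stdVec i) φ) x := by
          rw [integral_finsetSum _ fun i _ => i1 i]
          refine Finset.sum_congr rfl fun i _ => ?_
          rw [← neg_eq_iff_eq_neg]
          exact (isWeakGradient u _ (hφ.dirDeriv (stdVec i)) (stdVec i)).symm
      _ = -∫ x, fn u x * Laplacian.laplacian φ x := by
          rw [Finset.sum_neg_distrib, ← integral_finsetSum _ fun i _ => i2 i]
          simp only [laplacian_eq_sum_dirDeriv hφ.1, Finset.mul_sum]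
      _ = _ := by rw [isWeakLaplacian u φ hφ]
  rw [inner_eq, e1, e2, e3]
  ring

/-- Each convolution of `u` with a test function is a smooth solution of `U - ΔU + Δ²U = 0` with
`U`, `∇U`, `ΔU` in `L²`, hence zero. -/
lemma eq_zero_of_orthogonal_tests {u : H2 N}
    (h : ∀ φ (hφ : IsTest φ), ⟪u, ofTest φ hφ⟫ = 0) : u = 0 := by
  have hconv : ∀ ψ : Sp N → ℝ, IsTest ψ → conv ψ (fn u) = 0 := by
    intro ψ hψ
    have hlf := locallyIntegrable_of_memLp (memLp_fn u)
    have hll := locallyIntegrable_of_memLp (memLp_lap u)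
    refine eq_zero_of_smooth_solution (contDiff_conv hψ hlf)
      (memLp_conv hψ (measurable_fn u) (memLp_fn u)) (fun i => ?_) ?_ fun x => ?_
    · rw [dirDeriv_conv hψ hlf]
      exact memLp_conv (hψ.dirDeriv _) (measurable_fn u) (memLp_fn u)
    · rw [laplacian_conv_eq hψ hlf]
      exact memLp_conv hψ.laplacian (measurable_fn u) (memLp_fn u)
    · rw [laplacian_conv_fn u hψ, laplacian_conv_eq hψ hll]
      have := h _ (isTest_comp_sub hψ x)
      rw [inner_ofTest] at this
      simp only [laplacian_comp_sub hψ] at this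
      exact this
  refine H2_ext ?_
  have hz : fn (0 : H2 N) =ᵐ[volume] 0 := Lp.coeFn_zero _ _ _
  refine EventuallyEq.trans ?_ hz.symm
  refine ae_eq_zero_of_integral_contDiff_smul_eq_zero
    (locallyIntegrable_of_memLp (memLp_fn u)) fun φ h1 h2 => ?_
  -- The convolution with the reflection of `φ`, evaluated at the origin, is `∫ u φ`.
  have ht : IsTest fun t => φ (0 - t) := isTest_comp_sub ⟨h1, h2⟩ 0
  have := congrFun (hconv _ ht) 0
  simpa [conv, mul_comm] using this

/-- The subspace of test functions in `H²`. -/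
def testSubmodule (N : ℕ) : Submodule ℝ (H2 N) where
  carrier := {u | ∃ (φ : Sp N → ℝ) (h : IsTest φ), u = ofTest φ h}
  add_mem' := by
    rintro _ _ ⟨φ, hφ, rfl⟩ ⟨ψ, hψ, rfl⟩
    refine ⟨φ + ψ, ⟨hφ.1.add hψ.1, hφ.2.add hψ.2⟩, H2_ext ?_⟩
    exact (fn_add _ _).trans (((fn_ofTest hφ).add (fn_ofTest hψ)).trans (fn_ofTest _).symm)
  zero_mem' :=
    ⟨0, ⟨contDiff_zero_fun, HasCompactSupport.zero⟩, H2_ext ((Lp.coeFn_zero _ _ _).trans (fn_ofTest _).symm)⟩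
  smul_mem' := by
    rintro a _ ⟨φ, hφ, rfl⟩
    refine ⟨a • φ, ⟨contDiff_const.smul hφ.1, hφ.2.smul_left⟩, H2_ext ?_⟩
    exact (fn_smul _ _).trans (((fn_ofTest hφ).const_smul a).trans (fn_ofTest _).symm)

lemma exists_seq_tendsto_of_orthogonal {E : Type*} [NormedAddCommGroup E] [InnerProductSpace ℝ E]
    [CompleteSpace E] (K : Submodule ℝ E) (h : ∀ z : E, (∀ k ∈ K, ⟪z, k⟫ = 0) → z = 0) (u : E) :
    ∃ x : ℕ → E, (∀ n, x n ∈ K) ∧ Tendsto x atTop (𝓝 u) := by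
  have hd : K.topologicalClosure = ⊤ := by
    rw [Submodule.topologicalClosure_eq_top_iff, Submodule.eq_bot_iff]
    intro z hz
    refine h z fun k hk => ?_
    rw [real_inner_comm]
    exact hz k hk
  have hu : u ∈ closure (K : Set E) := by
    rw [← Submodule.topologicalClosure_coe, hd]
    trivial
  exact mem_closure_iff_seq_limit.1 hu

lemma exists_tests_tendsto (u : H2 N) : ∃ (φ : ℕ → Sp N → ℝ) (h : ∀ n, IsTest (φ n)),
    Tendsto (fun n => ofTest (φ n) (h n)) atTop (𝓝 u) := by
  have hK : ∀ φ (hφ : IsTest φ), ofTest φ hφ ∈ testSubmodule N := fun φ hφ => ⟨φ, hφ, rfl⟩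
  obtain ⟨x, hx, hlim⟩ := exists_seq_tendsto_of_orthogonal (E := H2 N) (testSubmodule N)
    (fun z hz => eq_zero_of_orthogonal_tests fun φ hφ => hz (ofTest φ hφ) (hK φ hφ)) u
  choose φ hφ e using hx
  refine ⟨φ, hφ, ?_⟩
  simpa only [← e] using hlim

/-! ### Hölder's inequality and interpolation -/

section Holder
variable {α : Type*} [MeasurableSpace α] {m : Measure α} {F G : α → ℝ} {a b : ℝ}

lemma lintegral_ofReal_rpow_mul_rpow_le (hF : Integrable F m) (hG : Integrable G m)
    (hF0 : ∀ x, 0 ≤ F x) (hG0 : ∀ x, 0 ≤ G x) (ha : 0 ≤ a) (hb : 0 ≤ b) (hab : a + b = 1) :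
    ∫⁻ x, ENNReal.ofReal (F x ^ a * G x ^ b) ∂m ≤
      ENNReal.ofReal ((∫ x, F x ∂m) ^ a * (∫ x, G x ∂m) ^ b) := by
  have h := ENNReal.lintegral_mul_norm_pow_le (μ := m) hF.1.aemeasurable.ennreal_ofReal
    hG.1.aemeasurable.ennreal_ofReal ha hb hab
  rw [← ofReal_integral_eq_lintegral_ofReal hF (Eventually.of_forall hF0),
    ← ofReal_integral_eq_lintegral_ofReal hG (Eventually.of_forall hG0),
    ENNReal.ofReal_rpow_of_nonneg (integral_nonneg hF0) ha,
    ENNReal.ofReal_rpow_of_nonneg (integral_nonneg hG0) hb,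
    ← ENNReal.ofReal_mul (Real.rpow_nonneg (integral_nonneg hF0) _)] at h
  refine le_trans (le_of_eq (lintegral_congr fun x => ?_)) h
  rw [ENNReal.ofReal_rpow_of_nonneg (hF0 x) ha, ENNReal.ofReal_rpow_of_nonneg (hG0 x) hb,
    ← ENNReal.ofReal_mul (Real.rpow_nonneg (hF0 x) _)]

lemma integrable_rpow_mul_rpow (hF : Integrable F m) (hG : Integrable G m)
    (hF0 : ∀ x, 0 ≤ F x) (hG0 : ∀ x, 0 ≤ G x) (ha : 0 ≤ a) (hb : 0 ≤ b) (hab : a + b = 1) :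
    Integrable (fun x => F x ^ a * G x ^ b) m := by
  refine ⟨((hF.1.aemeasurable.pow_const a).mul (hG.1.aemeasurable.pow_const b)).aestronglyMeasurable,
    ?_⟩
  rw [hasFiniteIntegral_iff_ofReal (Eventually.of_forall fun x =>
    mul_nonneg (Real.rpow_nonneg (hF0 x) _) (Real.rpow_nonneg (hG0 x) _))]
  exact (lintegral_ofReal_rpow_mul_rpow_le hF hG hF0 hG0 ha hb hab).trans_lt ENNReal.ofReal_lt_top

lemma integral_rpow_mul_rpow_le (hF : Integrable F m) (hG : Integrable G m)
    (hF0 : ∀ x, 0 ≤ F x) (hG0 : ∀ x, 0 ≤ G x) (ha : 0 ≤ a) (hb : 0 ≤ b) (hab : a + b = 1) :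
    ∫ x, F x ^ a * G x ^ b ∂m ≤ (∫ x, F x ∂m) ^ a * (∫ x, G x ∂m) ^ b := by
  have h := lintegral_ofReal_rpow_mul_rpow_le hF hG hF0 hG0 ha hb hab
  rw [← ofReal_integral_eq_lintegral_ofReal (integrable_rpow_mul_rpow hF hG hF0 hG0 ha hb hab)
    (Eventually.of_forall fun x =>
      mul_nonneg (Real.rpow_nonneg (hF0 x) _) (Real.rpow_nonneg (hG0 x) _))] at h
  exact (ENNReal.ofReal_le_ofReal_iff (mul_nonneg (Real.rpow_nonneg (integral_nonneg hF0) _)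
    (Real.rpow_nonneg (integral_nonneg hG0) _))).1 h

/-- The integrand of the interpolation inequality between `L²` and `L^q`. -/
lemma abs_rpow_eq_interpolation (y : ℝ) {q t : ℝ} (hq : 2 < q) (ht : 2 ≤ t) :
    |y| ^ t = (y ^ 2) ^ ((q - t) / (q - 2)) * (|y| ^ q) ^ ((t - 2) / (q - 2)) := by
  have hq2 : q - 2 ≠ 0 := by linarith
  have e : (2 : ℝ) * ((q - t) / (q - 2)) + q * ((t - 2) / (q - 2)) = t := by
    field_simp
    ring
  rw [← sq_abs, ← Real.rpow_natCast, ← Real.rpow_mul (abs_nonneg y), ← Real.rpow_mul (abs_nonneg y),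
    ← Real.rpow_add' (abs_nonneg y)]
  · rw [Nat.cast_ofNat, e]
  · rw [Nat.cast_ofNat, e]
    linarith

variable {f : α → ℝ} {q t : ℝ}

lemma integrable_abs_rpow_interpolation (h2 : Integrable (fun x => f x ^ 2) m)
    (hq : Integrable (fun x => |f x| ^ q) m) (hq2 : 2 < q) (ht : 2 ≤ t) (htq : t ≤ q) :
    Integrable (fun x => |f x| ^ t) m := by
  simp only [abs_rpow_eq_interpolation _ hq2 ht]
  refine integrable_rpow_mul_rpow h2 hq (fun x => sq_nonneg _) (fun x => by positivity)
    (div_nonneg (by linarith) (by linarith)) (div_nonneg (by linarith) (by linarith)) ?_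
  have : q - 2 ≠ 0 := by linarith
  field_simp
  ring

lemma integral_abs_rpow_interpolation (h2 : Integrable (fun x => f x ^ 2) m)
    (hq : Integrable (fun x => |f x| ^ q) m) (hq2 : 2 < q) (ht : 2 ≤ t) (htq : t ≤ q) :
    ∫ x, |f x| ^ t ∂m ≤ (∫ x, f x ^ 2 ∂m) ^ ((q - t) / (q - 2)) *
      (∫ x, |f x| ^ q ∂m) ^ ((t - 2) / (q - 2)) := by
  simp only [abs_rpow_eq_interpolation _ hq2 ht]
  refine integral_rpow_mul_rpow_le h2 hq (fun x => sq_nonneg _) (fun x => by positivity)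
    (div_nonneg (by linarith) (by linarith)) (div_nonneg (by linarith) (by linarith)) ?_
  have : q - 2 ≠ 0 := by linarith
  field_simp
  ring

lemma integrable_abs_rpow_iff (hf : AEStronglyMeasurable f m) (ht : 0 < t) :
    Integrable (fun x => |f x| ^ t) m ↔ MemLp f (ENNReal.ofReal t) m := by
  have := integrable_norm_rpow_iff hf (p := ENNReal.ofReal t) (by simpa using ht) (by simp)
  simpa [ENNReal.toReal_ofReal ht.le] using this

lemma eLpNorm_ofReal_eq (hf : MemLp f (ENNReal.ofReal t) m) (ht : 0 < t) :
    eLpNorm f (ENNReal.ofReal t) m = ENNReal.ofReal ((∫ x, |f x| ^ t ∂m) ^ (1 / t)) := by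
  rw [hf.eLpNorm_eq_integral_rpow_norm (by simpa using ht) (by simp), ENNReal.toReal_ofReal ht.le]
  simp [one_div]

end Holder

/-! ### The Sobolev inequality in `H²` -/

/-- Approximation by test functions converges only in `H²` a priori, so the left side passes to the
limit by Fatou along an a.e. convergent subsequence. -/
lemma exists_eLpNorm_sobolev (hN : 5 ≤ N) : ∃ C : ℝ≥0, ∀ u : H2 N,
    eLpNorm (fn u) (ENNReal.ofReal (critExp N)) volume ≤ C * eLpNorm (lap u) 2 volume := by
  obtain ⟨C, hC⟩ := exists_sobolev_test hN
  refine ⟨C, fun u => ?_⟩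
  obtain ⟨φ, hφ, hlim⟩ := exists_tests_tendsto u
  have h1 : Tendsto (fun n => fnL (ofTest (φ n) (hφ n))) atTop (𝓝 (fnL u)) :=
    (fnL.continuous.tendsto u).comp hlim
  have h2 : Tendsto (fun n => lapL (ofTest (φ n) (hφ n))) atTop (𝓝 (lapL u)) :=
    (lapL.continuous.tendsto u).comp hlim
  obtain ⟨ns, hns, hae⟩ := (tendstoInMeasure_of_tendsto_Lp h1).exists_seq_tendsto_ae
  have hle := Lp.eLpNorm_lim_le_liminf_eLpNorm (p := ENNReal.ofReal (critExp N))
    (fun n => (Lp.aestronglyMeasurable (fnL (ofTest (φ (ns n)) (hφ (ns n)))))) (fn u) hae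
  refine hle.trans ?_
  have hb : ∀ n, eLpNorm (fnL (ofTest (φ n) (hφ n))) (ENNReal.ofReal (critExp N)) volume ≤
      C * ‖lapL (ofTest (φ n) (hφ n))‖ₑ := by
    intro n
    rw [coe_fnL, eLpNorm_congr_ae (fn_ofTest (hφ n)), Lp.enorm_def, coe_lapL,
      eLpNorm_congr_ae (lap_ofTest (hφ n))]
    exact hC _ (hφ n)
  have ht : Tendsto (fun n => (C : ℝ≥0∞) * ‖lapL (ofTest (φ (ns n)) (hφ (ns n)))‖ₑ) atTop
      (𝓝 (C * ‖lapL u‖ₑ)) :=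
    ENNReal.Tendsto.const_mul ((h2.comp hns.tendsto_atTop).enorm) (Or.inr ENNReal.coe_ne_top)
  rw [Lp.enorm_def, coe_lapL] at ht
  rw [← ht.liminf_eq]
  exact liminf_le_liminf (Eventually.of_forall fun n => hb (ns n))

lemma powInt_nonneg (t : ℝ) (u : H2 N) : 0 ≤ powInt t u :=
  integral_nonneg fun x => by positivity

lemma integrable_fn_sq (u : H2 N) : Integrable fun x => fn u x ^ 2 := (memLp_fn u).integrable_sq

lemma eLpNorm_lap (u : H2 N) : eLpNorm (lap u) 2 volume = ENNReal.ofReal √(lapSq u) := by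
  rw [← coe_lapL, ← Lp.enorm_def, lapSq_eq, Real.sqrt_sq (norm_nonneg _), ofReal_norm]

lemma memLp_fn_critExp (hN : 5 ≤ N) (u : H2 N) :
    MemLp (fn u) (ENNReal.ofReal (critExp N)) (volume : Measure (Sp N)) := by
  obtain ⟨C, hC⟩ := exists_eLpNorm_sobolev hN
  refine ⟨(memLp_fn u).1, (hC u).trans_lt ?_⟩
  rw [eLpNorm_lap]
  exact ENNReal.mul_lt_top ENNReal.coe_lt_top ENNReal.ofReal_lt_top

lemma exists_sobolev (hN : 5 ≤ N) : ∃ C : ℝ, 0 < C ∧ ∀ u : H2 N,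
    powInt (critExp N) u ^ (1 / critExp N) ≤ C * √(lapSq u) := by
  have h2 := two_lt_critExp hN
  obtain ⟨C, hC⟩ := exists_eLpNorm_sobolev hN
  refine ⟨C + 1, by positivity, fun u => ?_⟩
  have h := hC u
  rw [eLpNorm_ofReal_eq (memLp_fn_critExp hN u) (by linarith), eLpNorm_lap,
    ← ENNReal.ofReal_coe_nnreal, ← ENNReal.ofReal_mul (by positivity),
    ENNReal.ofReal_le_ofReal_iff (by positivity)] at h
  refine h.trans ?_
  gcongr
  linarith

lemma integrable_abs_rpow (hN : 5 ≤ N) {t : ℝ} (ht : 2 ≤ t) (ht' : t ≤ critExp N) (u : H2 N) :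
    Integrable fun x => |fn u x| ^ t :=
  integrable_abs_rpow_interpolation (integrable_fn_sq u)
    ((integrable_abs_rpow_iff (memLp_fn u).1 (by linarith [two_lt_critExp hN])).2
      (memLp_fn_critExp hN u)) (two_lt_critExp hN) ht ht'

lemma memLp_fn_ofReal (hN : 5 ≤ N) {t : ℝ} (ht : 2 ≤ t) (ht' : t ≤ critExp N) (u : H2 N) :
    MemLp (fn u) (ENNReal.ofReal t) (volume : Measure (Sp N)) :=
  (integrable_abs_rpow_iff (memLp_fn u).1 (by linarith)).1 (integrable_abs_rpow hN ht ht' u)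

lemma powInt_smul (t : ℝ) (a : ℝ) (u : H2 N) : powInt t (a • u) = |a| ^ t * powInt t u := by
  unfold powInt
  rw [← integral_const_mul]
  refine integral_congr_ae ?_
  filter_upwards [fn_smul a u] with x hx
  rw [hx, Pi.smul_apply, smul_eq_mul, abs_mul, Real.mul_rpow (abs_nonneg _) (abs_nonneg _)]

lemma powInt_pos (hN : 5 ≤ N) {t : ℝ} (ht : 2 ≤ t) (ht' : t ≤ critExp N) {u : H2 N} (hu : u ≠ 0) :
    0 < powInt t u := by
  refine lt_of_le_of_ne (powInt_nonneg t u) fun h => ?_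
  have h0 : (fun x => |fn u x| ^ t) =ᵐ[volume] 0 :=
    (integral_eq_zero_iff_of_nonneg (fun x => by positivity) (integrable_abs_rpow hN ht ht' u)).1
      h.symm
  refine (mass_pos hu).ne' ?_
  unfold mass
  rw [← integral_zero (Sp N) ℝ]
  refine integral_congr_ae ?_
  filter_upwards [h0] with x hx
  have hx' : |fn u x| ^ t = 0 := hx
  rw [Real.rpow_eq_zero (abs_nonneg _) (by linarith), abs_eq_zero] at hx'
  simp [hx']

/-! ### The Gagliardo–Nirenberg inequality and the optimal constants -/

lemma critExp_eq (hN : 5 ≤ N) : critExp N - 2 = 8 / (N - 4) := by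
  have h : (5 : ℝ) ≤ N := by exact_mod_cast hN
  have : (N : ℝ) - 4 ≠ 0 := by linarith
  rw [critExp]
  field_simp
  ring

lemma gam_nonneg {t : ℝ} (ht : 2 ≤ t) : 0 ≤ gam N t := by
  unfold gam
  have : 1 / t ≤ 1 / 2 := one_div_le_one_div_of_le (by norm_num) ht
  have : (0 : ℝ) ≤ N := by positivity
  apply mul_nonneg <;> linarith

lemma mul_gam {t : ℝ} (ht : t ≠ 0) : t * gam N t = N * (t - 2) / 4 := by
  unfold gam
  field_simp
  ring

lemma gam_le_one (hN : 5 ≤ N) {t : ℝ} (ht : 2 ≤ t) (ht' : t ≤ critExp N) : gam N t ≤ 1 := by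
  have h : (5 : ℝ) ≤ N := by exact_mod_cast hN
  have h0 : 0 < t := by linarith
  have : t * gam N t ≤ t * 1 := by
    rw [mul_gam h0.ne']
    rw [critExp, le_div_iff₀ (by linarith)] at ht'
    linarith
  exact le_of_mul_le_mul_left this h0

/-- Interpolation between `L²` and `L^(4^*)` followed by the Sobolev inequality. It shows that the
infimum defining `gnConst` runs over a nonempty set. -/
lemma exists_gagliardoNirenberg (hN : 5 ≤ N) {t : ℝ} (ht : 2 ≤ t) (ht' : t ≤ critExp N) :
    ∃ C : ℝ, 0 ≤ C ∧ ∀ u : H2 N,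
      powInt t u ^ (1 / t) ≤ C * √(lapSq u) ^ gam N t * √(mass u) ^ (1 - gam N t) := by
  obtain ⟨C, hC0, hC⟩ := exists_sobolev hN
  have h5 : (5 : ℝ) ≤ N := by exact_mod_cast hN
  have hq := two_lt_critExp hN
  have hN4 : (N : ℝ) - 4 ≠ 0 := by linarith
  have ht0 : 0 < t := by linarith
  refine ⟨C ^ gam N t, by positivity, fun u => ?_⟩
  have h := integral_abs_rpow_interpolation (integrable_fn_sq u)
    (integrable_abs_rpow hN hq.le le_rfl u) hq ht ht'
  have h1 : powInt t u ≤ mass u ^ ((critExp N - t) / (critExp N - 2)) *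
      powInt (critExp N) u ^ ((t - 2) / (critExp N - 2)) := h
  have e1 : (t - 2) / (critExp N - 2) * (1 / t) = 1 / critExp N * gam N t := by
    rw [critExp_eq hN, critExp, gam]
    field_simp
    ring
  have e2 : (critExp N - t) / (critExp N - 2) * (1 / t) = 1 / 2 * (1 - gam N t) := by
    have : critExp N - t = (critExp N - 2) - (t - 2) := by ring
    rw [this, critExp_eq hN, gam]
    field_simp
    ring
  calc powInt t u ^ (1 / t)
      ≤ (mass u ^ ((critExp N - t) / (critExp N - 2)) *
          powInt (critExp N) u ^ ((t - 2) / (critExp N - 2))) ^ (1 / t) :=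
        Real.rpow_le_rpow (powInt_nonneg t u) h1 (by positivity)
    _ = (powInt (critExp N) u ^ (1 / critExp N)) ^ gam N t * √(mass u) ^ (1 - gam N t) := by
        have hm := mass_nonneg u
        have hpn := powInt_nonneg (critExp N) u
        rw [Real.mul_rpow (by positivity) (by positivity), ← Real.rpow_mul hm, ← Real.rpow_mul hpn,
          e1, e2, Real.rpow_mul hm, Real.rpow_mul hpn, ← Real.sqrt_eq_rpow, mul_comm]
    _ ≤ (C * √(lapSq u)) ^ gam N t * √(mass u) ^ (1 - gam N t) := by
        gcongr
        · exact Real.rpow_nonneg (powInt_nonneg _ u) _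
        · exact gam_nonneg ht
        · exact hC u
    _ = _ := by rw [Real.mul_rpow hC0.le (Real.sqrt_nonneg _)]

lemma exists_powInt_le_norm (hN : 5 ≤ N) {t : ℝ} (ht : 2 ≤ t) (ht' : t ≤ critExp N) :
    ∃ K : ℝ, 0 ≤ K ∧ ∀ u : H2 N, powInt t u ^ (1 / t) ≤ K * ‖u‖ := by
  obtain ⟨C, hC0, hC⟩ := exists_gagliardoNirenberg hN ht ht'
  refine ⟨C, hC0, fun u => (hC u).trans ?_⟩
  have hl : √(lapSq u) ≤ ‖u‖ := by
    rw [Real.sqrt_le_left (norm_nonneg _), norm_sq_eq]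
    linarith [mass_nonneg u, gradSq_nonneg u]
  have hm : √(mass u) ≤ ‖u‖ := by
    rw [Real.sqrt_le_left (norm_nonneg _), norm_sq_eq]
    linarith [lapSq_nonneg u, gradSq_nonneg u]
  have hg := gam_nonneg (N := N) ht
  have hg' := gam_le_one hN ht ht'
  rw [mul_assoc]
  gcongr
  calc √(lapSq u) ^ gam N t * √(mass u) ^ (1 - gam N t)
      ≤ ‖u‖ ^ gam N t * ‖u‖ ^ (1 - gam N t) := by
        gcongr
    _ = ‖u‖ := by
        rw [← Real.rpow_add' (norm_nonneg _) (by simp)]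
        simp

lemma exists_ne_zero (N : ℕ) : ∃ u : H2 N, u ≠ 0 := by
  refine ⟨ofTest cutoff isTest_cutoff, fun h => ?_⟩
  have h1 : (cutoff : Sp N → ℝ) =ᵐ[volume] fun _ => 0 := by
    refine (fn_ofTest isTest_cutoff).symm.trans ?_
    rw [h]
    exact Lp.coeFn_zero _ _ _
  have h2 := (Continuous.ae_eq_iff_eq volume isTest_cutoff.continuous continuous_const).1 h1
  have h3 := congrFun h2 0
  rw [cutoff_eq_one (by simp)] at h3
  exact one_ne_zero h3

lemma gnConst_nonneg (N : ℕ) (t : ℝ) : 0 ≤ gnConst N t := Real.sInf_nonneg fun _ h => h.1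

lemma powInt_rpow_le_gnConst (hN : 5 ≤ N) {t : ℝ} (ht : 2 ≤ t) (ht' : t ≤ critExp N) (u : H2 N) :
    powInt t u ^ (1 / t) ≤ gnConst N t * √(lapSq u) ^ gam N t * √(mass u) ^ (1 - gam N t) := by
  set X := √(lapSq u) ^ gam N t * √(mass u) ^ (1 - gam N t) with hX
  have hX0 : 0 ≤ X := by positivity
  obtain ⟨C, hC⟩ := exists_gagliardoNirenberg hN ht ht'
  rw [mul_assoc, ← hX]
  -- When the product on the right vanishes, any admissible constant already forces the left side to
  -- be at most zero; otherwise one divides by it and passes to the infimum.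
  rcases hX0.eq_or_lt with h | h
  · have := hC.2 u
    rw [mul_assoc, ← hX, ← h, mul_zero] at this
    rw [← h, mul_zero]
    exact this
  · rw [← div_le_iff₀ h]
    refine le_csInf ⟨C, hC⟩ fun D hD => ?_
    rw [div_le_iff₀ h]
    have := hD.2 u
    rwa [mul_assoc] at this

lemma powInt_le_gnConst (hN : 5 ≤ N) {t : ℝ} (ht : 2 ≤ t) (ht' : t ≤ critExp N) (u : H2 N) :
    powInt t u ≤ gnConst N t ^ t * lapSq u ^ (t * gam N t / 2) *
      mass u ^ (t * (1 - gam N t) / 2) := by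
  have h := powInt_rpow_le_gnConst hN ht ht' u
  have ht0 : 0 < t := by linarith
  have hl := lapSq_nonneg u
  have hm := mass_nonneg u
  have hg := gnConst_nonneg N t
  have h1 := Real.rpow_le_rpow (Real.rpow_nonneg (powInt_nonneg t u) _) h ht0.le
  rw [← Real.rpow_mul (powInt_nonneg t u), one_div_mul_cancel ht0.ne', Real.rpow_one,
    Real.mul_rpow (by positivity) (by positivity), Real.mul_rpow hg (by positivity),
    Real.sqrt_eq_rpow, Real.sqrt_eq_rpow, ← Real.rpow_mul hl, ← Real.rpow_mul hm,
    ← Real.rpow_mul hl, ← Real.rpow_mul hm] at h1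
  convert h1 using 3 <;> ring_nf

lemma gnConst_pos (hN : 5 ≤ N) {t : ℝ} (ht : 2 ≤ t) (ht' : t ≤ critExp N) : 0 < gnConst N t := by
  refine lt_of_le_of_ne (gnConst_nonneg N t) fun h => ?_
  obtain ⟨u, hu⟩ := exists_ne_zero N
  have h1 := powInt_rpow_le_gnConst hN ht ht' u
  rw [← h, zero_mul, zero_mul] at h1
  exact absurd (Real.rpow_pos_of_pos (powInt_pos hN ht ht' hu) (1 / t)) (not_lt.2 h1)

lemma sobConst_pos (hN : 5 ≤ N) : 0 < sobConst N := by
  obtain ⟨C, hC0, hC⟩ := exists_sobolev hN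
  have hq := two_lt_critExp hN
  -- `sInf ∅ = 0` in `ℝ`, so positivity requires a nonzero competitor.
  obtain ⟨u0, hu0⟩ := exists_ne_zero N
  refine lt_of_lt_of_le (by positivity : 0 < 1 / C ^ 2) (le_csInf ⟨_, u0, hu0, rfl⟩ ?_)
  rintro _ ⟨u, hu, rfl⟩
  have hp := powInt_pos hN hq.le le_rfl hu
  rw [div_le_div_iff₀ (by positivity) (by positivity), one_mul]
  have h := pow_le_pow_left₀ (Real.rpow_nonneg hp.le _) (hC u) 2
  rw [mul_pow, Real.sq_sqrt (lapSq_nonneg u), ← Real.rpow_natCast, ← Real.rpow_mul hp.le] at h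
  rw [mul_comm (lapSq u)]
  convert h using 2
  push_cast
  ring

lemma powInt_critExp_le (hN : 5 ≤ N) (u : H2 N) :
    sobConst N ^ (critExp N / 2) * powInt (critExp N) u ≤ lapSq u ^ (critExp N / 2) := by
  have hq := two_lt_critExp hN
  have hS := sobConst_pos hN
  rcases eq_or_ne u 0 with rfl | hu
  · have : powInt (critExp N) (0 : H2 N) = 0 := by
      have := powInt_smul (critExp N) 0 (0 : H2 N)
      rwa [zero_smul, abs_zero, Real.zero_rpow (by linarith), zero_mul] at this
    rw [this, mul_zero]
    exact Real.rpow_nonneg (lapSq_nonneg _) _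
  · have hp := powInt_pos hN hq.le le_rfl hu
    have h : sobConst N ≤ lapSq u / powInt (critExp N) u ^ (2 / critExp N) := by
      refine csInf_le ⟨0, ?_⟩ ⟨u, hu, rfl⟩
      rintro _ ⟨v, -, rfl⟩
      exact div_nonneg (lapSq_nonneg v) (Real.rpow_nonneg (powInt_nonneg _ v) _)
    rw [le_div_iff₀ (by positivity)] at h
    have h1 := Real.rpow_le_rpow (by positivity) h (by linarith : 0 ≤ critExp N / 2)
    rw [Real.mul_rpow hS.le (by positivity), ← Real.rpow_mul hp.le] at h1
    have e : 2 / critExp N * (critExp N / 2) = 1 := by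
      have : critExp N ≠ 0 := by linarith
      field_simp
    rwa [e, Real.rpow_one] at h1

/-! ### The action of the orthogonal group -/

/-- The Laplacian may be computed in any orthonormal basis; at `R x` the rotated basis is used. -/
lemma laplacian_comp_isometry {φ : Sp N → ℝ} (hφ : ContDiff ℝ ∞ φ) (R : Sp N ≃ₗᵢ[ℝ] Sp N) (x : Sp N) :
    Laplacian.laplacian (φ ∘ R) x = Laplacian.laplacian φ (R x) := by
  set b := EuclideanSpace.basisFun (Fin N) ℝ
  rw [InnerProductSpace.laplacian_eq_iteratedFDeriv_orthonormalBasis (φ ∘ R) b,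
    InnerProductSpace.laplacian_eq_iteratedFDeriv_orthonormalBasis φ (b.map R)]
  refine Finset.sum_congr rfl fun i _ => ?_
  have h := R.toContinuousLinearEquiv.toContinuousLinearMap.iteratedFDeriv_comp_right hφ x
    (i := 2) (WithTop.coe_le_coe.2 le_top)
  have h' := congrArg (fun T : ContinuousMultilinearMap ℝ (fun _ : Fin 2 => Sp N) ℝ =>
    T ![b i, b i]) h
  refine h'.trans ?_
  simp only [ContinuousMultilinearMap.compContinuousLinearMap_apply]
  refine congrArg (iteratedFDeriv ℝ 2 φ (R x)) (funext fun j => ?_)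
  fin_cases j <;> simp

lemma dirDeriv_comp_isometry {φ : Sp N → ℝ} (hφ : ContDiff ℝ ∞ φ) (R : Sp N ≃ₗᵢ[ℝ] Sp N)
    (e x : Sp N) : dirDeriv e (φ ∘ R) x = dirDeriv (R e) φ (R x) := by
  have h := ((hφ.differentiable (by simp) (R x)).hasFDerivAt.comp x
    R.toContinuousLinearEquiv.hasFDerivAt).fderiv
  exact congrArg (fun A : Sp N →L[ℝ] ℝ => A e) h

lemma IsTest.comp_isometry {φ : Sp N → ℝ} (hφ : IsTest φ) (R : Sp N ≃ₗᵢ[ℝ] Sp N) :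
    IsTest (φ ∘ R) :=
  ⟨hφ.1.comp R.contDiff, hφ.2.comp_homeomorph R.toHomeomorph⟩

lemma integral_comp_isometry {F : Type*} [NormedAddCommGroup F] [NormedSpace ℝ F]
    (R : Sp N ≃ₗᵢ[ℝ] Sp N) (f : Sp N → F) : ∫ x, f (R x) = ∫ x, f x :=
  R.measurePreserving.integral_comp R.toHomeomorph.measurableEmbedding f

/-- The element `u ∘ R` of `H²`. -/
def rotate (R : Sp N ≃ₗᵢ[ℝ] Sp N) (u : H2 N) : H2 N :=
  mkH2 (fun x => fn u (R x)) (fun x => R.symm (grad u (R x))) (fun x => lap u (R x))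
    ((memLp_fn u).comp_measurePreserving R.measurePreserving)
    (R.symm.toContinuousLinearEquiv.toContinuousLinearMap.comp_memLp'
      ((memLp_grad u).comp_measurePreserving R.measurePreserving))
    ((memLp_lap u).comp_measurePreserving R.measurePreserving)
    (fun φ hφ e => by
      -- Testing `u` with `φ ∘ R⁻¹` in the direction `R e` and changing variables puts the rotation
      -- on `u`.
      have h := isWeakGradient u _ (hφ.comp_isometry R.symm) (R e)
      rw [← integral_comp_isometry R, ← integral_comp_isometry R (fun x => ⟪grad u x, R e⟫ * _)] at h
      have e1 : ∀ x, fderiv ℝ (φ ∘ R.symm) (R x) (R e) = fderiv ℝ φ x e := fun x => by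
        have := dirDeriv_comp_isometry hφ.1 R.symm (R e) (R x)
        rw [R.symm_apply_apply, R.symm_apply_apply] at this
        exact this
      simp only [e1, Function.comp_apply, LinearIsometryEquiv.symm_apply_apply] at h
      rw [h]
      congr 1
      refine integral_congr_ae (Eventually.of_forall fun x => ?_)
      simp only
      rw [← R.inner_map_map (R.symm _) e, R.apply_symm_apply])
    (fun φ hφ => by
      have h := isWeakLaplacian u _ (hφ.comp_isometry R.symm)
      rw [← integral_comp_isometry R, ← integral_comp_isometry R (fun x => lap u x * _)] at h
      simp only [laplacian_comp_isometry hφ.1, Function.comp_apply,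
        LinearIsometryEquiv.symm_apply_apply] at h
      exact h)

lemma fn_rotate (R : Sp N ≃ₗᵢ[ℝ] Sp N) (u : H2 N) :
    fn (rotate R u) =ᵐ[volume] fun x => fn u (R x) := fn_mkH2 ..
lemma grad_rotate (R : Sp N ≃ₗᵢ[ℝ] Sp N) (u : H2 N) :
    grad (rotate R u) =ᵐ[volume] fun x => R.symm (grad u (R x)) := grad_mkH2 ..
lemma lap_rotate (R : Sp N ≃ₗᵢ[ℝ] Sp N) (u : H2 N) :
    lap (rotate R u) =ᵐ[volume] fun x => lap u (R x) := lap_mkH2 ..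

lemma ae_comp_isometry {P : Sp N → Prop} (R : Sp N ≃ₗᵢ[ℝ] Sp N) (h : ∀ᵐ x, P x) :
    ∀ᵐ x, P (R x) :=
  R.measurePreserving.quasiMeasurePreserving.ae h

lemma powInt_rotate (t : ℝ) (R : Sp N ≃ₗᵢ[ℝ] Sp N) (u : H2 N) :
    powInt t (rotate R u) = powInt t u := by
  unfold powInt
  rw [← integral_comp_isometry R (fun x => |fn u x| ^ t)]
  refine integral_congr_ae ?_
  filter_upwards [fn_rotate R u] with x hx
  rw [hx]

lemma mass_rotate (R : Sp N ≃ₗᵢ[ℝ] Sp N) (u : H2 N) : mass (rotate R u) = mass u := by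
  unfold mass
  rw [← integral_comp_isometry R (fun x => fn u x ^ 2)]
  refine integral_congr_ae ?_
  filter_upwards [fn_rotate R u] with x hx
  rw [hx]

lemma lapSq_rotate (R : Sp N ≃ₗᵢ[ℝ] Sp N) (u : H2 N) : lapSq (rotate R u) = lapSq u := by
  unfold lapSq
  rw [← integral_comp_isometry R (fun x => lap u x ^ 2)]
  refine integral_congr_ae ?_
  filter_upwards [lap_rotate R u] with x hx
  rw [hx]

lemma gradSq_rotate (R : Sp N ≃ₗᵢ[ℝ] Sp N) (u : H2 N) : gradSq (rotate R u) = gradSq u := by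
  unfold gradSq
  rw [← integral_comp_isometry R (fun x => ‖grad u x‖ ^ 2)]
  refine integral_congr_ae ?_
  filter_upwards [grad_rotate R u] with x hx
  rw [hx, R.symm.norm_map]

lemma energy_rotate (μ p : ℝ) (R : Sp N ≃ₗᵢ[ℝ] Sp N) (u : H2 N) :
    energy μ p (rotate R u) = energy μ p u := by
  simp only [energy, powInt_rotate, lapSq_rotate, gradSq_rotate]

lemma rotate_add (R : Sp N ≃ₗᵢ[ℝ] Sp N) (u v : H2 N) :
    rotate R (u + v) = rotate R u + rotate R v := H2_ext <| by
  filter_upwards [fn_rotate R (u + v), fn_add (rotate R u) (rotate R v), fn_rotate R u,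
    fn_rotate R v, ae_comp_isometry R (fn_add u v)] with x h1 h2 h3 h4 h5
  rw [h1, h2, h5, Pi.add_apply, Pi.add_apply, h3, h4]

lemma rotate_smul (R : Sp N ≃ₗᵢ[ℝ] Sp N) (a : ℝ) (u : H2 N) :
    rotate R (a • u) = a • rotate R u := H2_ext <| by
  filter_upwards [fn_rotate R (a • u), fn_smul a (rotate R u), fn_rotate R u,
    ae_comp_isometry R (fn_smul a u)] with x h1 h2 h3 h4
  rw [h1, h2, h4, Pi.smul_apply, Pi.smul_apply, h3]

lemma norm_rotate (R : Sp N ≃ₗᵢ[ℝ] Sp N) (u : H2 N) : ‖rotate R u‖ = ‖u‖ := by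
  have h : ‖rotate R u‖ ^ 2 = ‖u‖ ^ 2 := by
    rw [norm_sq_eq, norm_sq_eq, mass_rotate, gradSq_rotate, lapSq_rotate]
  exact (sq_eq_sq₀ (norm_nonneg _) (norm_nonneg _)).1 h

lemma inner_rotate (R : Sp N ≃ₗᵢ[ℝ] Sp N) (u v : H2 N) : ⟪rotate R u, rotate R v⟫ = ⟪u, v⟫ := by
  rw [real_inner_eq_norm_add_mul_self_sub_norm_mul_self_sub_norm_mul_self_div_two,
    real_inner_eq_norm_add_mul_self_sub_norm_mul_self_sub_norm_mul_self_div_two,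
    ← rotate_add, norm_rotate, norm_rotate, norm_rotate]

/-- `u ↦ u ∘ R` as a linear isometry of `H²`. -/
def rotateL (R : Sp N ≃ₗᵢ[ℝ] Sp N) : H2 N →ₗᵢ[ℝ] H2 N where
  toFun := rotate R
  map_add' := rotate_add R
  map_smul' := rotate_smul R
  norm_map' := norm_rotate R

lemma rotateL_apply (R : Sp N ≃ₗᵢ[ℝ] Sp N) (u : H2 N) : rotateL R u = rotate R u := rfl

lemma rotate_symm_rotate (R : Sp N ≃ₗᵢ[ℝ] Sp N) (u : H2 N) : rotate R (rotate R.symm u) = u :=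
  H2_ext <| by
    filter_upwards [fn_rotate R (rotate R.symm u), ae_comp_isometry R (fn_rotate R.symm u)]
      with x h1 h2
    rw [h1, h2, R.symm_apply_apply]

lemma integral_fn_mul_rotate (R : Sp N ≃ₗᵢ[ℝ] Sp N) (u v : H2 N) :
    ∫ x, fn (rotate R u) x * fn (rotate R v) x = ∫ x, fn u x * fn v x := by
  rw [← integral_comp_isometry R (fun x => fn u x * fn v x)]
  refine integral_congr_ae ?_
  filter_upwards [fn_rotate R u, fn_rotate R v] with x h1 h2
  rw [h1, h2]

lemma exists_isometry_map_eq {x y : Sp N} (h : ‖x‖ = ‖y‖) : ∃ R : Sp N ≃ₗᵢ[ℝ] Sp N, R x = y :=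
  ⟨_, Submodule.reflection_sub h⟩

lemma IsRadial.rotate_eq {u : H2 N} (h : IsRadial u) (R : Sp N ≃ₗᵢ[ℝ] Sp N) : rotate R u = u := by
  obtain ⟨f, hf⟩ := h
  refine H2_ext ?_
  filter_upwards [fn_rotate R u, hf, ae_comp_isometry R hf] with x h1 h2 h3
  rw [h1, h3, h2, R.norm_map]

lemma preimage_closedBall_isometry (R : Sp N ≃ₗᵢ[ℝ] Sp N) (x : Sp N) (r : ℝ) :
    R ⁻¹' Metric.closedBall (R x) r = Metric.closedBall x r := by
  ext y
  simp [Metric.mem_closedBall]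

lemma setIntegral_closedBall_isometry {f : Sp N → ℝ} (R : Sp N ≃ₗᵢ[ℝ] Sp N)
    (hf : ∀ᵐ x, f (R x) = f x) (x : Sp N) (r : ℝ) :
    ∫ y in Metric.closedBall (R x) r, f y = ∫ y in Metric.closedBall x r, f y := by
  rw [← R.measurePreserving.setIntegral_preimage_emb R.toHomeomorph.measurableEmbedding,
    preimage_closedBall_isometry]
  exact integral_congr_ae (ae_restrict_of_ae hf)

/-- A function in `H²` which is invariant under all linear isometries is radial: its averages over
balls depend on the norm of the centre only, and they converge to the function. -/
lemma isRadial_of_rotate_eq (hN : 0 < N) {u : H2 N}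
    (h : ∀ R : Sp N ≃ₗᵢ[ℝ] Sp N, rotate R u = u) : IsRadial u := by
  have hinv : ∀ R : Sp N ≃ₗᵢ[ℝ] Sp N, ∀ᵐ x, fn u (R x) = fn u x := by
    intro R
    have h1 := fn_rotate R u
    rw [h R] at h1
    exact h1.mono fun x hx => hx.symm
  -- Invariance under `R` holds off a null set depending on `R`, and there are uncountably many `R`.
  -- Ball averages are invariant at every point, so the radial profile is read off from them by
  -- Lebesgue differentiation.
  set A : ℕ → Sp N → ℝ := fun n x => ⨍ y in Metric.closedBall x (1 / ((n : ℝ) + 1)), fn u y with hA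
  have hAinv : ∀ n (x y : Sp N), ‖x‖ = ‖y‖ → A n x = A n y := by
    intro n x y hxy
    obtain ⟨R, rfl⟩ := exists_isometry_map_eq hxy
    simp only [hA, setAverage_eq]
    rw [setIntegral_closedBall_isometry R (hinv R)]
    congr 2
    rw [measureReal_def, measureReal_def, Measure.addHaar_closedBall_center _ x,
      Measure.addHaar_closedBall_center _ (R x)]
  set e : Sp N := stdVec ⟨0, hN⟩ with he
  have hne : ‖e‖ = 1 := by simp [he, stdVec]
  refine ⟨fun r => limUnder atTop fun n => A n (r • e), ?_⟩
  have hδ : Tendsto (fun n : ℕ => 1 / ((n : ℝ) + 1)) atTop (𝓝[>] 0) :=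
    tendsto_nhdsWithin_iff.2 ⟨tendsto_one_div_add_atTop_nhds_zero_nat,
      Eventually.of_forall fun n => by simp only [Set.mem_Ioi]; positivity⟩
  filter_upwards [IsUnifLocDoublingMeasure.ae_tendsto_average (μ := (volume : Measure (Sp N)))
    (locallyIntegrable_of_memLp (memLp_fn u)) 1] with x hx
  have h1 := hx (fun _ => x) _ hδ (Eventually.of_forall fun n => by
    simp only [one_mul]
    exact Metric.mem_closedBall_self (by positivity))
  have h2 : (fun n => A n (‖x‖ • e)) = fun n => A n x := by
    funext n
    refine hAinv n _ _ ?_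
    simp [norm_smul, hne]
  rw [h2]
  exact h1.limUnder_eq.symm

/-- The closed subspace of radial functions. -/
def radialSubmodule (N : ℕ) : Submodule ℝ (H2 N) :=
  ⨅ R : Sp N ≃ₗᵢ[ℝ] Sp N, LinearMap.ker ((rotateL R).toLinearMap - LinearMap.id)

lemma mem_radialSubmodule {u : H2 N} : u ∈ radialSubmodule N ↔ ∀ R, rotate R u = u := by
  simp [radialSubmodule, Submodule.mem_iInf, sub_eq_zero, rotateL_apply]

lemma isRadial_iff (hN : 0 < N) {u : H2 N} : IsRadial u ↔ u ∈ radialSubmodule N :=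
  ⟨fun h => mem_radialSubmodule.2 h.rotate_eq,
    fun h => isRadial_of_rotate_eq hN (mem_radialSubmodule.1 h)⟩

lemma isClosed_radialSubmodule : IsClosed (radialSubmodule N : Set (H2 N)) := by
  have : (radialSubmodule N : Set (H2 N)) =
      ⋂ R : Sp N ≃ₗᵢ[ℝ] Sp N, {u | rotateL R u = u} := by
    ext u
    simp only [Set.mem_iInter]
    exact mem_radialSubmodule
  rw [this]
  exact isClosed_iInter fun R => isClosed_eq (rotateL R).continuous continuous_id

/-- Principle of symmetric criticality: an invariant functional vanishing on radial functions
vanishes. -/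
lemma eq_zero_of_invariant (ℓ : H2 N →L[ℝ] ℝ)
    (hinv : ∀ (R : Sp N ≃ₗᵢ[ℝ] Sp N) v, ℓ (rotate R v) = ℓ v)
    (hrad : ∀ v ∈ radialSubmodule N, ℓ v = 0) : ℓ = 0 := by
  -- The Riesz representative of an invariant functional is itself invariant, hence radial, so `‖G‖²
  -- = ℓ G = 0`.
  set G := (InnerProductSpace.toDual ℝ (H2 N)).symm ℓ with hG
  have hℓ : ∀ v, ⟪G, v⟫ = ℓ v := fun v => InnerProductSpace.toDual_symm_apply
  have hGr : G ∈ radialSubmodule N := by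
    refine mem_radialSubmodule.2 fun R => ?_
    refine ext_inner_right ℝ fun v => ?_
    have h1 : ⟪rotate R G, v⟫ = ⟪G, rotate R.symm v⟫ := by
      conv_lhs => rw [← rotate_symm_rotate R v]
      exact inner_rotate R _ _
    rw [h1, hℓ, hℓ, hinv]
  have h0 : ⟪G, G⟫ = 0 := (hℓ G).trans (hrad G hGr)
  have : G = 0 := inner_self_eq_zero.1 h0
  ext v
  rw [← hℓ, this, inner_zero_left]
  rfl

/-! ### Translations -/

/-- Translation by `-y` on `L²`. -/
def translate (y : Sp N) : L2 N ℝ → L2 N ℝ :=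
  Lp.compMeasurePreserving (fun x => x - y) (measurePreserving_sub_right volume y)

lemma coeFn_translate (y : Sp N) (f : L2 N ℝ) :
    (translate y f : Sp N → ℝ) =ᵐ[volume] fun x => f (x - y) :=
  Lp.coeFn_compMeasurePreserving f _

lemma continuous_translate (y : Sp N) : Continuous (translate (N := N) y) :=
  (Lp.isometry_compMeasurePreserving (measurePreserving_sub_right volume y)).continuous

/-- The fundamental theorem of calculus along the segment from `x` to `x - y`, then Minkowski's
inequality over the parameter `s`. -/
lemma lintegral_translate_sub_test_le {φ : Sp N → ℝ} (hφ : IsTest φ) (y : Sp N) :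
    ∫⁻ x, ‖φ (x - y) - φ x‖ₑ ^ (2 : ℝ) ≤
      ‖y‖ₑ ^ (2 : ℝ) * ∫⁻ x, ‖smoothGrad φ x‖ₑ ^ (2 : ℝ) := by
  have hcont : Continuous (smoothGrad φ) := continuous_smoothGrad hφ.1
  set ν : Measure ℝ := volume.restrict (Set.Ioc 0 1) with hν
  have hν1 : ν Set.univ = 1 := by simp [hν]
  have hF : Measurable (Function.uncurry fun (x : Sp N) (s : ℝ) =>
      ‖y‖ₑ * ‖smoothGrad φ (x - s • y)‖ₑ) := by
    refine Measurable.const_mul ?_ _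
    refine Continuous.measurable ?_
    refine continuous_enorm.comp (hcont.comp ?_)
    fun_prop
  have hpt : ∀ x, ‖φ (x - y) - φ x‖ₑ ≤ ∫⁻ s, ‖y‖ₑ * ‖smoothGrad φ (x - s • y)‖ₑ ∂ν := by
    intro x
    have hderiv : ∀ s : ℝ, HasDerivAt (fun s : ℝ => φ (x - s • y))
        (-⟪smoothGrad φ (x - s • y), y⟫) s := by
      intro s
      have h1 : HasDerivAt (fun s : ℝ => x - s • y) (-y) s := by
        simpa using ((hasDerivAt_id s).smul_const y).const_sub x
      have h2 := (hφ.1.differentiable (by simp) (x - s • y)).hasFDerivAt.comp_hasDerivAt s h1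
      rw [inner_smoothGrad]
      rw [map_neg] at h2
      exact h2
    have hc : Continuous fun s : ℝ => -⟪smoothGrad φ (x - s • y), y⟫ := by
      refine Continuous.neg (Continuous.inner (hcont.comp ?_) continuous_const)
      fun_prop
    have hftc := intervalIntegral.integral_eq_sub_of_hasDerivAt (a := 0) (b := 1)
      (fun s _ => hderiv s) (hc.intervalIntegrable 0 1)
    simp only [one_smul, zero_smul, sub_zero] at hftc
    rw [← hftc, intervalIntegral.integral_of_le zero_le_one]
    refine (enorm_integral_le_lintegral_enorm _).trans (lintegral_mono fun s => ?_)
    rw [enorm_neg, mul_comm]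
    rw [← ofReal_norm, ← ofReal_norm, ← ofReal_norm, ← ENNReal.ofReal_mul (norm_nonneg _)]
    exact ENNReal.ofReal_le_ofReal (norm_inner_le_norm _ _)
  have h := lintegral_rpow_lintegral_le ν (q := 2) (by norm_num) hF
  rw [hν1, ENNReal.one_rpow, one_mul] at h
  refine (lintegral_mono fun x => ENNReal.rpow_le_rpow (hpt x) (by norm_num)).trans (h.trans ?_)
  have hm : Measurable fun x => ‖smoothGrad φ x‖ₑ ^ (2 : ℝ) := hcont.measurable.enorm.pow_const _
  have hin : ∀ s : ℝ, ∫⁻ x, (‖y‖ₑ * ‖smoothGrad φ (x - s • y)‖ₑ) ^ (2 : ℝ) =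
      ‖y‖ₑ ^ (2 : ℝ) * ∫⁻ x, ‖smoothGrad φ x‖ₑ ^ (2 : ℝ) := by
    intro s
    simp only [ENNReal.mul_rpow_of_nonneg _ _ (zero_le_two : (0 : ℝ) ≤ 2)]
    have hms : Measurable fun x => ‖smoothGrad φ (x - s • y)‖ₑ ^ (2 : ℝ) :=
      hm.comp (measurable_id.sub_const _)
    rw [lintegral_const_mul _ hms]
    congr 1
    exact lintegral_sub_right_eq_self (fun x => ‖smoothGrad φ x‖ₑ ^ (2 : ℝ)) (s • y)
  simp only [hin, lintegral_const, hν1, mul_one, le_refl]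

lemma lintegral_enorm_rpow_two {F : Type} [NormedAddCommGroup F] (f : L2 N F) :
    ∫⁻ x, ‖f x‖ₑ ^ (2 : ℝ) = ‖f‖ₑ ^ (2 : ℝ) := by
  rw [Lp.enorm_def, eLpNorm_eq_lintegral_rpow_enorm_toReal (by simp) (by simp),
    ENNReal.toReal_ofNat, ← ENNReal.rpow_mul]
  norm_num

lemma norm_translate_sub_le (y : Sp N) (u : H2 N) :
    ‖translate y (fnL u) - fnL u‖ₑ ≤ ‖y‖ₑ * ‖gradL u‖ₑ := by
  obtain ⟨φ, hφ, hlim⟩ := exists_tests_tendsto u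
  have h1 := (fnL.continuous.tendsto u).comp hlim
  have h2 := (gradL.continuous.tendsto u).comp hlim
  refine le_of_tendsto_of_tendsto'
    ((((continuous_translate y).tendsto _).comp h1).sub h1).enorm
    (ENNReal.Tendsto.const_mul h2.enorm (Or.inr enorm_ne_top)) fun n => ?_
  simp only [Function.comp_apply]
  have h := lintegral_translate_sub_test_le (hφ n) y
  rw [← ENNReal.rpow_le_rpow_iff (zero_lt_two : (0 : ℝ) < 2), ENNReal.mul_rpow_of_nonneg _ _ zero_le_two,
    ← lintegral_enorm_rpow_two, ← lintegral_enorm_rpow_two]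
  convert h using 1
  · refine lintegral_congr_ae ?_
    have ht := (measurePreserving_sub_right (volume : Measure (Sp N)) y).quasiMeasurePreserving.ae
      (fn_ofTest (hφ n))
    filter_upwards [Lp.coeFn_sub (translate y (fnL (ofTest (φ n) (hφ n)))) (fnL (ofTest (φ n) (hφ n))),
      coeFn_translate y (fnL (ofTest (φ n) (hφ n))), ht, fn_ofTest (hφ n)] with x e1 e2 e3 e4
    rw [e1, Pi.sub_apply, e2, coe_fnL, e3, e4]
  · congr 1
    refine lintegral_congr_ae ?_
    filter_upwards [grad_ofTest (hφ n)] with x e1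
    rw [coe_gradL, e1]

lemma lintegral_fn_sub_le (y : Sp N) (u : H2 N) :
    ∫⁻ x, ‖fn u x - fn u (x - y)‖ₑ ^ (2 : ℝ) ≤ ‖y‖ₑ ^ (2 : ℝ) * ‖gradL u‖ₑ ^ (2 : ℝ) := by
  have h := norm_translate_sub_le y u
  rw [← ENNReal.rpow_le_rpow_iff (zero_lt_two : (0 : ℝ) < 2), ENNReal.mul_rpow_of_nonneg _ _ zero_le_two,
    ← lintegral_enorm_rpow_two] at h
  convert h using 1
  refine lintegral_congr_ae ?_
  filter_upwards [Lp.coeFn_sub (translate y (fnL u)) (fnL u), coeFn_translate y (fnL u)] with x e1 e2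
  rw [e1, Pi.sub_apply, e2, coe_fnL, ← enorm_neg, neg_sub]

/-! ### Averages over balls -/

/-- The uniform probability measure on the closed ball of radius `r` around the origin. -/
def ballMeasure (N : ℕ) (r : ℝ) : Measure (Sp N) :=
  (volume (Metric.closedBall (0 : Sp N) r))⁻¹ • volume.restrict (Metric.closedBall 0 r)

lemma volume_closedBall_pos {r : ℝ} (hr : 0 < r) (x : Sp N) : 0 < volume (Metric.closedBall x r) :=
  Metric.measure_closedBall_pos volume x hr

lemma volume_closedBall_ne_top (r : ℝ) (x : Sp N) : volume (Metric.closedBall x r) ≠ ⊤ :=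
  measure_closedBall_lt_top.ne

lemma ballMeasure_univ {r : ℝ} (hr : 0 < r) : ballMeasure N r Set.univ = 1 := by
  simp only [ballMeasure, Measure.smul_apply, Measure.restrict_apply_univ, smul_eq_mul]
  exact ENNReal.inv_mul_cancel (volume_closedBall_pos hr 0).ne' (volume_closedBall_ne_top r 0)

lemma isProbabilityMeasure_ballMeasure {r : ℝ} (hr : 0 < r) :
    IsProbabilityMeasure (ballMeasure N r) := ⟨ballMeasure_univ hr⟩

lemma ae_ballMeasure (r : ℝ) : ∀ᵐ y ∂ballMeasure N r, ‖y‖ ≤ r := by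
  refine Measure.ae_smul_measure ?_ _
  filter_upwards [ae_restrict_mem Metric.isClosed_closedBall.measurableSet] with y hy
  simpa using hy

/-- The average of `f` over the closed ball of radius `r`. -/
def ballAvg (r : ℝ) (f : Sp N → ℝ) : Sp N → ℝ := fun x => ∫ y, f (x - y) ∂ballMeasure N r

section BallAvg
variable {r : ℝ} {f : Sp N → ℝ}

lemma integrable_comp_sub_ballMeasure (hr : 0 < r) (hf : MemLp f 2 (volume : Measure (Sp N)))
    (x : Sp N) : Integrable (fun y => f (x - y)) (ballMeasure N r) := by
  have h1 : MemLp (fun y => f (x - y)) 2 (volume : Measure (Sp N)) :=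
    hf.comp_measurePreserving (Measure.measurePreserving_sub_left volume x)
  have h2 := (locallyIntegrable_of_memLp h1).integrableOn_isCompact
    (isCompact_closedBall (0 : Sp N) r)
  exact h2.integrable.smul_measure (ENNReal.inv_ne_top.2 (volume_closedBall_pos hr 0).ne')

lemma measurable_ballAvg (hr : 0 < r) (hm : Measurable f) : Measurable (ballAvg r f) := by
  have := isProbabilityMeasure_ballMeasure (N := N) hr
  have h : StronglyMeasurable (Function.uncurry fun x y : Sp N => f (x - y)) :=
    (hm.comp measurable_sub).stronglyMeasurable
  exact h.integral_prod_right.measurable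

lemma lintegral_ballAvg_le (hr : 0 < r) (hm : Measurable f) {q : ℝ} (hq : 1 < q) :
    ∫⁻ x, ‖ballAvg r f x‖ₑ ^ q ≤ ∫⁻ x, ‖f x‖ₑ ^ q := by
  have := isProbabilityMeasure_ballMeasure (N := N) hr
  have hF : Measurable (Function.uncurry fun x y : Sp N => ‖f (x - y)‖ₑ) :=
    (hm.comp measurable_sub).enorm
  have h := lintegral_rpow_lintegral_le (ballMeasure N r) hq hF
  have hc : ∀ y : Sp N, ∫⁻ x, ‖f (x - y)‖ₑ ^ q = ∫⁻ x, ‖f x‖ₑ ^ q := fun y =>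
    lintegral_sub_right_eq_self (fun x => ‖f x‖ₑ ^ q) y
  simp only [hc, lintegral_const, ballMeasure_univ hr, ENNReal.one_rpow, one_mul, mul_one] at h
  exact (lintegral_mono fun x => ENNReal.rpow_le_rpow (enorm_integral_le_lintegral_enorm _)
    (by linarith)).trans h

/-- The difference is the average of `u(x) - u(x - y)` over `‖y‖ ≤ r`, and each translation costs at
most `r ‖∇u‖₂`. Smoothing at scale `r` is thus uniformly accurate on bounded sets. -/
lemma lintegral_sub_ballAvg_le (hr : 0 < r) (u : H2 N) :
    ∫⁻ x, ‖fn u x - ballAvg r (fn u) x‖ₑ ^ (2 : ℝ) ≤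
      ENNReal.ofReal r ^ (2 : ℝ) * ‖gradL u‖ₑ ^ (2 : ℝ) := by
  have := isProbabilityMeasure_ballMeasure (N := N) hr
  have hm := measurable_fn u
  have hF : Measurable (Function.uncurry fun x y : Sp N => ‖fn u x - fn u (x - y)‖ₑ) :=
    ((hm.comp measurable_fst).sub (hm.comp measurable_sub)).enorm
  have h := lintegral_rpow_lintegral_le (ballMeasure N r) (q := 2) (by norm_num) hF
  have hpt : ∀ x, ‖fn u x - ballAvg r (fn u) x‖ₑ ≤
      ∫⁻ y, ‖fn u x - fn u (x - y)‖ₑ ∂ballMeasure N r := by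
    intro x
    have e : fn u x - ballAvg r (fn u) x = ∫ y, (fn u x - fn u (x - y)) ∂ballMeasure N r := by
      rw [integral_sub (integrable_const _) (integrable_comp_sub_ballMeasure hr (memLp_fn u) x)]
      simp [ballAvg]
    rw [e]
    exact enorm_integral_le_lintegral_enorm _
  refine (lintegral_mono fun x => ENNReal.rpow_le_rpow (hpt x) zero_le_two).trans (h.trans ?_)
  rw [ballMeasure_univ hr, ENNReal.one_rpow, one_mul]
  calc ∫⁻ y, ∫⁻ x, ‖fn u x - fn u (x - y)‖ₑ ^ (2 : ℝ) ∂volume ∂ballMeasure N r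
      ≤ ∫⁻ _, ENNReal.ofReal r ^ (2 : ℝ) * ‖gradL u‖ₑ ^ (2 : ℝ) ∂ballMeasure N r := by
        refine lintegral_mono_ae ?_
        filter_upwards [ae_ballMeasure (N := N) r] with y hy
        refine (lintegral_fn_sub_le y u).trans ?_
        gcongr
        rw [← ofReal_norm]
        exact ENNReal.ofReal_le_ofReal hy
    _ = _ := by rw [lintegral_const, ballMeasure_univ hr, mul_one]

/-- As a pairing with an `L²` function, the average at a point passes to weak limits. -/
lemma ballAvg_eq_integral (x : Sp N) : ballAvg r f x =
    (volume (Metric.closedBall (0 : Sp N) r)).toReal⁻¹ *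
      ∫ z, f z * (Metric.closedBall x r).indicator (fun _ => 1) z := by
  have h1 : ballAvg r f x = (volume (Metric.closedBall (0 : Sp N) r)).toReal⁻¹ *
      ∫ y in Metric.closedBall 0 r, f (x - y) := by
    simp [ballAvg, ballMeasure]
  rw [h1, ← integral_indicator Metric.isClosed_closedBall.measurableSet,
    ← integral_sub_left_eq_self _ volume x]
  congr 1
  refine integral_congr_ae (Eventually.of_forall fun z => ?_)
  by_cases hz : z ∈ Metric.closedBall x r
  · have : x - z ∈ Metric.closedBall (0 : Sp N) r := by
      simpa [dist_eq_norm, norm_sub_rev] using hz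
    simp [Set.indicator, hz, this]
  · have : x - z ∉ Metric.closedBall (0 : Sp N) r := by
      simpa [dist_eq_norm, norm_sub_rev] using hz
    simp only [Set.indicator, hz, this, if_false, mul_zero]

lemma enorm_ballAvg_rpow_le (hr : 0 < r) (hm : Measurable f) (x : Sp N) :
    ‖ballAvg r f x‖ₑ ^ (2 : ℝ) ≤ (volume (Metric.closedBall (0 : Sp N) r))⁻¹ *
      ∫⁻ z in Metric.closedBall x r, ‖f z‖ₑ ^ (2 : ℝ) := by
  have hmx : Measurable fun y => ‖f (x - y)‖ₑ := (hm.comp (measurable_const.sub measurable_id)).enorm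
  have h := rpow_lintegral_le (ballMeasure N r) (q := 2) (by norm_num) hmx.aemeasurable
  rw [ballMeasure_univ hr, ENNReal.one_rpow, one_mul] at h
  refine (ENNReal.rpow_le_rpow (enorm_integral_le_lintegral_enorm _) zero_le_two).trans
    (h.trans_eq ?_)
  rw [ballMeasure, lintegral_smul_measure, smul_eq_mul]
  congr 1
  have hpre : (fun z : Sp N => x - z) ⁻¹' Metric.closedBall x r = Metric.closedBall 0 r := by
    ext z
    simp [dist_eq_norm]
  rw [← hpre]
  exact (Measure.measurePreserving_sub_left volume x).setLIntegral_comp_preimage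
    Metric.isClosed_closedBall.measurableSet (hm.enorm.pow_const 2)

end BallAvg

/-! ### Smallness of radial functions at infinity -/

lemma setLIntegral_closedBall_radial {u : H2 N} (hu : u ∈ radialSubmodule N) {x y : Sp N}
    (hxy : ‖x‖ = ‖y‖) (r : ℝ) : ∫⁻ z in Metric.closedBall y r, ‖fn u z‖ₑ ^ (2 : ℝ) =
      ∫⁻ z in Metric.closedBall x r, ‖fn u z‖ₑ ^ (2 : ℝ) := by
  obtain ⟨R, rfl⟩ := exists_isometry_map_eq hxy
  rw [← R.measurePreserving.setLIntegral_comp_preimage_emb R.toHomeomorph.measurableEmbedding,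
    preimage_closedBall_isometry]
  have h := fn_rotate R u
  rw [mem_radialSubmodule.1 hu R] at h
  refine lintegral_congr_ae (ae_restrict_of_ae ?_)
  filter_upwards [h] with z hz
  rw [hz]

/-- For `N ≥ 2` the unit sphere is connected with more than one point, hence infinite. -/
lemma exists_unit_vectors (hN : 2 ≤ N) (k : ℕ) :
    ∃ e : Fin k → Sp N, Function.Injective e ∧ ∀ i, ‖e i‖ = 1 := by
  have hinf : (Metric.sphere (0 : Sp N) 1).Infinite := by
    have hrank : 1 < Module.rank ℝ (Sp N) := by
      rw [← Module.finrank_eq_rank, finrank_euclideanSpace_fin]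
      exact_mod_cast hN
    refine (isPreconnected_sphere hrank (0 : Sp N) 1).infinite_of_nontrivial ?_
    set v : Sp N := stdVec ⟨0, by omega⟩ with hv
    have e0 : ‖v‖ = 1 := by simp [hv, stdVec]
    refine ⟨v, by rwa [mem_sphere_zero_iff_norm], -v, by rwa [mem_sphere_zero_iff_norm, norm_neg],
      fun h => ?_⟩
    have h2 : (2 : ℝ) • v = 0 := by
      rw [two_smul]
      nth_rewrite 2 [h]
      exact add_neg_cancel v
    have h3 := norm_smul (2 : ℝ) v
    rw [h2, e0] at h3
    norm_num at h3
  set g := hinf.natEmbedding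
  refine ⟨fun i => (g i : Sp N), fun i j h => ?_, fun i => ?_⟩
  · exact Fin.ext (g.injective (Subtype.ext h))
  · exact mem_sphere_zero_iff_norm.1 (g i).2

/-- Far from the origin the `k` balls around the points `‖x‖ e_i` are disjoint, and by symmetry each
carries as much mass as the ball around `x`. The radius `ρ` does not depend on `u`, which gives
uniform smallness at infinity. -/
lemma exists_radius_radial (hN : 2 ≤ N) (k : ℕ) (r : ℝ) : ∃ ρ : ℝ, ∀ x : Sp N, ρ ≤ ‖x‖ →
    ∀ u ∈ radialSubmodule N, (k : ℝ≥0∞) * ∫⁻ z in Metric.closedBall x r, ‖fn u z‖ₑ ^ (2 : ℝ) ≤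
      ∫⁻ z, ‖fn u z‖ₑ ^ (2 : ℝ) := by
  obtain ⟨e, hinj, he⟩ := exists_unit_vectors hN k
  have hev : ∀ᶠ ρ : ℝ in atTop, ∀ i j : Fin k, i ≠ j → r + r < ρ * dist (e i) (e j) := by
    refine eventually_all.2 fun i => eventually_all.2 fun j => ?_
    by_cases hij : i = j
    · exact Eventually.of_forall fun ρ h => absurd hij h
    · have hd : 0 < dist (e i) (e j) := dist_pos.2 fun h => hij (hinj h)
      filter_upwards [(tendsto_id.atTop_mul_const hd).eventually_gt_atTop (r + r)] with ρ hρ _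
      exact hρ
  obtain ⟨ρ, hρ⟩ := eventually_atTop.1 hev
  refine ⟨ρ, fun x hx u hu => ?_⟩
  have hdis : Pairwise (Function.onFun Disjoint fun i => Metric.closedBall (‖x‖ • e i) r) := by
    intro i j hij
    refine Metric.closedBall_disjoint_closedBall ?_
    rw [dist_smul₀, Real.norm_of_nonneg (norm_nonneg x)]
    exact hρ _ hx i j hij
  have h := lintegral_iUnion (μ := (volume : Measure (Sp N)))
    (fun i => (Metric.isClosed_closedBall (x := ‖x‖ • e i) (ε := r)).measurableSet) hdis
    (fun z => ‖fn u z‖ₑ ^ (2 : ℝ))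
  have hi : ∀ i, ∫⁻ z in Metric.closedBall (‖x‖ • e i) r, ‖fn u z‖ₑ ^ (2 : ℝ) =
      ∫⁻ z in Metric.closedBall x r, ‖fn u z‖ₑ ^ (2 : ℝ) := fun i =>
    setLIntegral_closedBall_radial hu (by simp [norm_smul, he i]) r
  simp only [hi, tsum_fintype, Finset.sum_const, Finset.card_univ, Fintype.card_fin,
    nsmul_eq_mul] at h
  rw [← h]
  exact setLIntegral_le_lintegral _ _

/-! ### Compactness of radial functions in `L^p` -/

lemma lintegral_enorm_fn_rpow (hN : 5 ≤ N) {t : ℝ} (ht : 2 ≤ t) (ht' : t ≤ critExp N) (u : H2 N) :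
    ∫⁻ x, ‖fn u x‖ₑ ^ t = ENNReal.ofReal (powInt t u) := by
  unfold powInt
  rw [ofReal_integral_eq_lintegral_ofReal (integrable_abs_rpow hN ht ht' u)
    (Eventually.of_forall fun x => by positivity)]
  refine lintegral_congr fun x => ?_
  rw [← Real.norm_eq_abs, ← ENNReal.ofReal_rpow_of_nonneg (norm_nonneg _) (by linarith), ofReal_norm]

lemma lintegral_enorm_interpolation {f : Sp N → ℝ} (hf : Measurable f) {q t : ℝ} (hq : 2 < q)
    (ht : 2 ≤ t) (htq : t ≤ q) : ∫⁻ x, ‖f x‖ₑ ^ t ≤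
      (∫⁻ x, ‖f x‖ₑ ^ (2 : ℝ)) ^ ((q - t) / (q - 2)) *
        (∫⁻ x, ‖f x‖ₑ ^ q) ^ ((t - 2) / (q - 2)) := by
  have hq2 : q - 2 ≠ 0 := by linarith
  have e : (2 : ℝ) * ((q - t) / (q - 2)) + q * ((t - 2) / (q - 2)) = t := by
    field_simp
    ring
  have ha : 0 ≤ (q - t) / (q - 2) := div_nonneg (by linarith) (by linarith)
  have hb : 0 ≤ (t - 2) / (q - 2) := div_nonneg (by linarith) (by linarith)
  refine le_trans (le_of_eq (lintegral_congr fun x => ?_)) (ENNReal.lintegral_mul_norm_pow_le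
    (hf.enorm.pow_const 2).aemeasurable (hf.enorm.pow_const q).aemeasurable ha hb
    (by field_simp; ring))
  rw [← ENNReal.rpow_mul, ← ENNReal.rpow_mul,
    ← ENNReal.rpow_add_of_nonneg _ _ (by positivity) (mul_nonneg (by linarith) hb), e]

lemma lintegral_enorm_add_le {f g : Sp N → ℝ} (hf : Measurable f) {t : ℝ} (ht : 1 ≤ t) :
    ∫⁻ x, ‖f x + g x‖ₑ ^ t ≤
      2 ^ (t - 1) * ((∫⁻ x, ‖f x‖ₑ ^ t) + ∫⁻ x, ‖g x‖ₑ ^ t) := by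
  rw [← lintegral_add_left (hf.enorm.pow_const t),
    ← lintegral_const_mul' _ _ (ENNReal.rpow_ne_top_of_nonneg (by linarith) (by simp))]
  refine lintegral_mono fun x => ?_
  exact (ENNReal.rpow_le_rpow (enorm_add_le _ _) (by linarith)).trans
    (ENNReal.rpow_add_le_mul_rpow_add_rpow _ _ ht)

lemma lintegral_sub_ballAvg_rpow_le {r q t : ℝ} (hr : 0 < r) (hq : 2 < q) (ht : 2 ≤ t)
    (htq : t ≤ q) {B C : ℝ≥0∞} {u : H2 N} (hB : ‖gradL u‖ₑ ^ (2 : ℝ) ≤ B)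
    (hC : ∫⁻ x, ‖fn u x‖ₑ ^ q ≤ C) :
    ∫⁻ x, ‖fn u x - ballAvg r (fn u) x‖ₑ ^ t ≤
      (ENNReal.ofReal r ^ (2 : ℝ) * B) ^ ((q - t) / (q - 2)) *
        (2 ^ (q - 1) * (C + C)) ^ ((t - 2) / (q - 2)) := by
  have hm := measurable_fn u
  have hA := measurable_ballAvg hr hm
  have ha : 0 ≤ (q - t) / (q - 2) := div_nonneg (by linarith) (by linarith)
  have hb : 0 ≤ (t - 2) / (q - 2) := div_nonneg (by linarith) (by linarith)
  refine (lintegral_enorm_interpolation (hm.sub hA) hq ht htq).trans ?_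
  gcongr
  · exact (lintegral_sub_ballAvg_le hr u).trans (by gcongr)
  · have h := lintegral_enorm_add_le (g := fun x => -ballAvg r (fn u) x) hm (t := q) (by linarith)
    simp only [enorm_neg, ← sub_eq_add_neg] at h
    refine h.trans ?_
    gcongr
    exact (lintegral_ballAvg_le hr hm (by linarith)).trans hC

/-- Outside a large ball the squared average is at most `D`, a multiple of the local mass bound
`B/(k+1)`; then `|A|^t ≤ D^((t-2)/2) |A|²`, and averaging does not increase the `L²` norm. -/
lemma lintegral_ballAvg_outside_le (hN : 2 ≤ N) {r t : ℝ} (hr : 0 < r) (ht : 2 ≤ t) (k : ℕ)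
    (B : ℝ≥0∞) : ∃ ρ : ℝ, ∀ u ∈ radialSubmodule N, ∫⁻ x, ‖fn u x‖ₑ ^ (2 : ℝ) ≤ B →
      ∫⁻ x in (Metric.closedBall (0 : Sp N) ρ)ᶜ, ‖ballAvg r (fn u) x‖ₑ ^ t ≤
        ((volume (Metric.closedBall (0 : Sp N) r))⁻¹ * (B / (k + 1 : ℕ))) ^ ((t - 2) / 2) * B := by
  obtain ⟨ρ, hρ⟩ := exists_radius_radial hN (k + 1) r
  refine ⟨ρ, fun u hu hB => ?_⟩
  set D := (volume (Metric.closedBall (0 : Sp N) r))⁻¹ * (B / (k + 1 : ℕ)) with hD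
  have hm := measurable_fn u
  have hs : 0 ≤ (t - 2) / 2 := by linarith
  have hpt : ∀ x ∈ (Metric.closedBall (0 : Sp N) ρ)ᶜ, ‖ballAvg r (fn u) x‖ₑ ^ t ≤
      D ^ ((t - 2) / 2) * ‖ballAvg r (fn u) x‖ₑ ^ (2 : ℝ) := by
    intro x hx
    have hx' : ρ ≤ ‖x‖ := by
      have : ρ < ‖x‖ := by simpa using hx
      exact this.le
    have h1 := enorm_ballAvg_rpow_le hr hm x
    have h2 : ‖ballAvg r (fn u) x‖ₑ ^ (2 : ℝ) ≤ D := by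
      refine h1.trans ?_
      rw [hD]
      gcongr
      rw [ENNReal.le_div_iff_mul_le (Or.inl (by simp)) (Or.inl (by simp)), mul_comm]
      exact (hρ x hx' u hu).trans hB
    have e : ‖ballAvg r (fn u) x‖ₑ ^ t =
        (‖ballAvg r (fn u) x‖ₑ ^ (2 : ℝ)) ^ ((t - 2) / 2) * ‖ballAvg r (fn u) x‖ₑ ^ (2 : ℝ) := by
      rw [← ENNReal.rpow_mul, ← ENNReal.rpow_add_of_nonneg _ _ (by linarith) zero_le_two]
      congr 1
      ring
    rw [e]
    gcongr
  calc ∫⁻ x in (Metric.closedBall (0 : Sp N) ρ)ᶜ, ‖ballAvg r (fn u) x‖ₑ ^ t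
      ≤ ∫⁻ x in (Metric.closedBall (0 : Sp N) ρ)ᶜ,
          D ^ ((t - 2) / 2) * ‖ballAvg r (fn u) x‖ₑ ^ (2 : ℝ) :=
        setLIntegral_mono' Metric.isClosed_closedBall.measurableSet.compl hpt
    _ ≤ ∫⁻ x, D ^ ((t - 2) / 2) * ‖ballAvg r (fn u) x‖ₑ ^ (2 : ℝ) := setLIntegral_le_lintegral _ _
    _ = D ^ ((t - 2) / 2) * ∫⁻ x, ‖ballAvg r (fn u) x‖ₑ ^ (2 : ℝ) :=
        lintegral_const_mul _ ((measurable_ballAvg hr hm).enorm.pow_const 2)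
    _ ≤ _ := by
        gcongr
        exact (lintegral_ballAvg_le hr hm (by norm_num)).trans hB

lemma tendsto_inner_fnL {v : ℕ → H2 N} (hw : ∀ w, Tendsto (fun n => ⟪v n, w⟫) atTop (𝓝 0))
    (f : L2 N ℝ) : Tendsto (fun n => ⟪fnL (v n), f⟫) atTop (𝓝 0) := by
  set ℓ : H2 N →L[ℝ] ℝ := (innerSL ℝ f).comp fnL with hℓ
  refine (hw ((InnerProductSpace.toDual ℝ (H2 N)).symm ℓ)).congr fun n => ?_
  rw [real_inner_comm, InnerProductSpace.toDual_symm_apply, real_inner_comm]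
  rfl

lemma tendsto_ballAvg {v : ℕ → H2 N} (hw : ∀ w, Tendsto (fun n => ⟪v n, w⟫) atTop (𝓝 0))
    (r : ℝ) (x : Sp N) : Tendsto (fun n => ballAvg r (fn (v n)) x) atTop (𝓝 0) := by
  have hψ : MemLp ((Metric.closedBall x r).indicator fun _ => (1 : ℝ)) 2
      (volume : Measure (Sp N)) :=
    memLp_indicator_const 2 Metric.isClosed_closedBall.measurableSet _
      (Or.inr (volume_closedBall_ne_top r x))
  have h := (tendsto_inner_fnL hw (hψ.toLp _)).const_mul
    (volume (Metric.closedBall (0 : Sp N) r)).toReal⁻¹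
  rw [mul_zero] at h
  refine h.congr fun n => ?_
  rw [ballAvg_eq_integral, L2.inner_def]
  congr 1
  refine integral_congr_ae ?_
  filter_upwards [hψ.coeFn_toLp] with z hz
  rw [hz]
  simp [coe_fnL, mul_comm]

lemma tendsto_lintegral_ballAvg_inside {v : ℕ → H2 N} {r t : ℝ} (hr : 0 < r) (ht : 2 ≤ t)
    (hw : ∀ w, Tendsto (fun n => ⟪v n, w⟫) atTop (𝓝 0)) {B : ℝ≥0∞} (hBt : B ≠ ⊤)
    (hB : ∀ n, ∫⁻ x, ‖fn (v n) x‖ₑ ^ (2 : ℝ) ≤ B) (ρ : ℝ) :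
    Tendsto (fun n => ∫⁻ x in Metric.closedBall (0 : Sp N) ρ, ‖ballAvg r (fn (v n)) x‖ₑ ^ t)
      atTop (𝓝 0) := by
  have hV : (volume (Metric.closedBall (0 : Sp N) r))⁻¹ ≠ ⊤ :=
    ENNReal.inv_ne_top.2 (volume_closedBall_pos hr 0).ne'
  have h := tendsto_lintegral_of_dominated_convergence
    (μ := volume.restrict (Metric.closedBall (0 : Sp N) ρ))
    (F := fun n x => ‖ballAvg r (fn (v n)) x‖ₑ ^ t) (f := fun _ => 0)
    (fun _ => ((volume (Metric.closedBall (0 : Sp N) r))⁻¹ * B) ^ (t / 2))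
    (fun n => (measurable_ballAvg hr (measurable_fn _)).enorm.pow_const t)
    (fun n => Eventually.of_forall fun x => ?_) ?_ (Eventually.of_forall fun x => ?_)
  · simpa using h
  · have h1 : ‖ballAvg r (fn (v n)) x‖ₑ ^ (2 : ℝ) ≤
        (volume (Metric.closedBall (0 : Sp N) r))⁻¹ * B := by
      refine (enorm_ballAvg_rpow_le hr (measurable_fn _) x).trans ?_
      gcongr
      exact (setLIntegral_le_lintegral _ _).trans (hB n)
    have h2 := ENNReal.rpow_le_rpow h1 (by linarith : 0 ≤ t / 2)
    rw [← ENNReal.rpow_mul] at h2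
    convert h2 using 2
    ring
  · rw [lintegral_const, Measure.restrict_apply_univ]
    exact ENNReal.mul_ne_top (ENNReal.rpow_ne_top_of_nonneg (by linarith)
      (ENNReal.mul_ne_top hV hBt)) (volume_closedBall_ne_top ρ 0)
  · have h1 := (tendsto_ballAvg hw r x).enorm
    rw [enorm_zero] at h1
    have h2 := h1.ennrpow_const t
    rwa [ENNReal.zero_rpow_of_pos (by linarith)] at h2

/-- Weakly null bounded sequences of radial functions converge to zero in `L^p`, `2 < p < 4^*`. -/
lemma tendsto_powInt_of_radial (hN : 5 ≤ N) {p : ℝ} (hp : 2 < p) (hp' : p < critExp N)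
    {v : ℕ → H2 N} (hv : ∀ n, v n ∈ radialSubmodule N) {M : ℝ} (hM : ∀ n, ‖v n‖ ≤ M)
    (hw : ∀ w, Tendsto (fun n => ⟪v n, w⟫) atTop (𝓝 0)) :
    Tendsto (fun n => powInt p (v n)) atTop (𝓝 0) := by
  have hq := two_lt_critExp hN
  set q := critExp N with hqdef
  have hM0 : 0 ≤ M := (norm_nonneg _).trans (hM 0)
  obtain ⟨K, hK0, hK⟩ := exists_powInt_le_norm hN hq.le (le_refl (critExp N))
  set B : ℝ≥0∞ := ENNReal.ofReal (M ^ 2) with hBdef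
  set C : ℝ≥0∞ := ENNReal.ofReal ((K * M) ^ q) with hCdef
  have hBtop : B ≠ ⊤ := ENNReal.ofReal_ne_top
  have hCtop : C ≠ ⊤ := ENNReal.ofReal_ne_top
  have hnsq : ∀ n, ‖v n‖ ^ 2 ≤ M ^ 2 := fun n => pow_le_pow_left₀ (norm_nonneg _) (hM n) 2
  have hBg : ∀ n, ‖gradL (v n)‖ₑ ^ (2 : ℝ) ≤ B := by
    intro n
    rw [← ofReal_norm, ENNReal.ofReal_rpow_of_nonneg (norm_nonneg _) zero_le_two, hBdef]
    refine ENNReal.ofReal_le_ofReal ?_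
    rw [Real.rpow_two, ← gradSq_eq]
    have := norm_sq_eq (v n)
    linarith [hnsq n, mass_nonneg (v n), lapSq_nonneg (v n)]
  have hBf : ∀ n, ∫⁻ x, ‖fn (v n) x‖ₑ ^ (2 : ℝ) ≤ B := by
    intro n
    rw [← coe_fnL, lintegral_enorm_rpow_two, ← ofReal_norm,
      ENNReal.ofReal_rpow_of_nonneg (norm_nonneg _) zero_le_two, hBdef]
    refine ENNReal.ofReal_le_ofReal ?_
    rw [Real.rpow_two, ← mass_eq]
    have := norm_sq_eq (v n)
    linarith [hnsq n, gradSq_nonneg (v n), lapSq_nonneg (v n)]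
  have hCf : ∀ n, ∫⁻ x, ‖fn (v n) x‖ₑ ^ q ≤ C := by
    intro n
    rw [lintegral_enorm_fn_rpow hN hq.le le_rfl, hCdef]
    refine ENNReal.ofReal_le_ofReal ?_
    have h1 : powInt q (v n) ^ (1 / q) ≤ K * M := (hK (v n)).trans (by gcongr; exact hM n)
    have h2 := Real.rpow_le_rpow (Real.rpow_nonneg (powInt_nonneg _ _) _) h1
      (by linarith : 0 ≤ q)
    rwa [← Real.rpow_mul (powInt_nonneg _ _), one_div_mul_cancel (by linarith), Real.rpow_one] at h2
  set a := (q - p) / (q - 2) with ha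
  set b := (p - 2) / (q - 2) with hb
  have ha0 : 0 < a := div_pos (by linarith) (by linarith)
  have hb0 : 0 ≤ b := div_nonneg (by linarith) (by linarith)
  -- `T₁ r` bounds the error of averaging at scale `r`, and `T₂ r k` the averages outside a large
  -- ball; inside it they tend to zero. The limits are taken in the order `n → ∞`, `k → ∞`, `r → 0`.
  set T₁ : ℝ → ℝ≥0∞ := fun r => (ENNReal.ofReal r ^ (2 : ℝ) * B) ^ a * (2 ^ (q - 1) * (C + C)) ^ b
  set T₂ : ℝ → ℕ → ℝ≥0∞ := fun r k =>
    ((volume (Metric.closedBall (0 : Sp N) r))⁻¹ * (B / (k + 1 : ℕ))) ^ ((p - 2) / 2) * B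
  set J : ℕ → ℝ≥0∞ := fun n => ∫⁻ x, ‖fn (v n) x‖ₑ ^ p with hJ
  have h2top : (2 : ℝ≥0∞) ^ (p - 1) ≠ ⊤ := ENNReal.rpow_ne_top_of_nonneg (by linarith) (by simp)
  have hsup : ∀ r, 0 < r → ∀ k, limsup J atTop ≤ 2 ^ (p - 1) * (T₁ r + (0 + T₂ r k)) := by
    intro r hr k
    obtain ⟨ρ, hρ⟩ := lintegral_ballAvg_outside_le (by omega : 2 ≤ N) hr hp.le k B
    have hin := tendsto_lintegral_ballAvg_inside hr hp.le hw hBtop hBf ρ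
    have hle : ∀ n, J n ≤ 2 ^ (p - 1) * (T₁ r +
        ((∫⁻ x in Metric.closedBall (0 : Sp N) ρ, ‖ballAvg r (fn (v n)) x‖ₑ ^ p) + T₂ r k)) := by
      intro n
      have hm := measurable_fn (v n)
      have h := lintegral_enorm_add_le (g := ballAvg r (fn (v n)))
        (hm.sub (measurable_ballAvg hr hm)) (t := p) (by linarith)
      simp only [Pi.sub_apply, sub_add_cancel] at h
      refine h.trans ?_
      gcongr
      · exact lintegral_sub_ballAvg_rpow_le hr hq hp.le hp'.le (hBg n) (hCf n)
      · rw [← lintegral_add_compl _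
          (Metric.isClosed_closedBall (x := (0 : Sp N)) (ε := ρ)).measurableSet]
        gcongr
        exact hρ _ (hv n) (hBf n)
    refine (limsup_le_limsup (Eventually.of_forall hle)).trans_eq ?_
    refine Tendsto.limsup_eq (ENNReal.Tendsto.const_mul ?_ (Or.inr h2top))
    exact tendsto_const_nhds.add (hin.add tendsto_const_nhds)
  have hsup1 : ∀ r, 0 < r → limsup J atTop ≤ 2 ^ (p - 1) * T₁ r := by
    intro r hr
    have hV : (volume (Metric.closedBall (0 : Sp N) r))⁻¹ ≠ ⊤ :=
      ENNReal.inv_ne_top.2 (volume_closedBall_pos hr 0).ne'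
    have ht : Tendsto (fun k => T₂ r k) atTop (𝓝 0) := by
      have h1 : Tendsto (fun k : ℕ => B / ((k + 1 : ℕ) : ℝ≥0∞)) atTop (𝓝 0) := by
        have := (ENNReal.Tendsto.const_div ENNReal.tendsto_nat_nhds_top (Or.inr hBtop) :
          Tendsto (fun k : ℕ => B / (k : ℝ≥0∞)) atTop (𝓝 (B / ⊤)))
        rw [ENNReal.div_top] at this
        exact this.comp (tendsto_add_atTop_nat 1)
      have h2 := (ENNReal.Tendsto.const_mul h1 (Or.inr hV)).ennrpow_const ((p - 2) / 2)
      rw [mul_zero, ENNReal.zero_rpow_of_pos (by linarith)] at h2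
      have h3 := ENNReal.Tendsto.mul_const h2 (Or.inr hBtop)
      rwa [zero_mul] at h3
    have h4 : Tendsto (fun k => 2 ^ (p - 1) * (T₁ r + (0 + T₂ r k))) atTop
        (𝓝 (2 ^ (p - 1) * (T₁ r + (0 + 0)))) :=
      ENNReal.Tendsto.const_mul (tendsto_const_nhds.add (tendsto_const_nhds.add ht)) (Or.inr h2top)
    rw [add_zero, add_zero] at h4
    exact ge_of_tendsto' h4 (hsup r hr)
  have hsup0 : limsup J atTop ≤ 0 := by
    have hCt : (2 ^ (q - 1) * (C + C)) ^ b ≠ ⊤ := by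
      refine ENNReal.rpow_ne_top_of_nonneg hb0 (ENNReal.mul_ne_top ?_ ?_)
      · exact ENNReal.rpow_ne_top_of_nonneg (by linarith) (by simp)
      · exact ENNReal.add_ne_top.2 ⟨hCtop, hCtop⟩
    have hr : Tendsto (fun n : ℕ => ENNReal.ofReal (1 / ((n : ℝ) + 1))) atTop (𝓝 0) := by
      have := ENNReal.tendsto_ofReal (tendsto_one_div_add_atTop_nhds_zero_nat (𝕜 := ℝ))
      rwa [ENNReal.ofReal_zero] at this
    have h1 := hr.ennrpow_const 2
    rw [ENNReal.zero_rpow_of_pos (by norm_num)] at h1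
    have h2 := (ENNReal.Tendsto.mul_const h1 (Or.inr hBtop)).ennrpow_const a
    rw [zero_mul, ENNReal.zero_rpow_of_pos ha0] at h2
    have h3 := ENNReal.Tendsto.const_mul (ENNReal.Tendsto.mul_const h2 (Or.inr hCt)) (Or.inr h2top)
    rw [zero_mul, mul_zero] at h3
    exact ge_of_tendsto' h3 fun n => hsup1 _ (by positivity)
  have hJ0 : Tendsto J atTop (𝓝 0) :=
    tendsto_of_le_liminf_of_limsup_le zero_le hsup0
  have hfin := (ENNReal.tendsto_toReal (by simp)).comp hJ0
  rw [ENNReal.toReal_zero] at hfin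
  refine hfin.congr fun n => ?_
  simp only [Function.comp_apply, hJ]
  rw [lintegral_enorm_fn_rpow hN hp.le hp'.le, ENNReal.toReal_ofReal (powInt_nonneg _ _)]

/-! ### The Brezis–Lieb lemma -/

lemma exists_abs_add_rpow_le {q η : ℝ} (hq : 1 < q) (hη : 0 < η) : ∃ C : ℝ, 0 ≤ C ∧ ∀ a b : ℝ,
    |a + b| ^ q ≤ (1 + η) * |a| ^ q + C * |b| ^ q := by
  -- Convexity of `x ↦ x^q` with weights `1/d` and `(d-1)/d` produces the coefficient `d^(q-1)` of
  -- `|a|^q`; this `d` makes it `1 + η`.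
  set d : ℝ := (1 + η) ^ (1 / (q - 1)) with hd
  have hq1 : 0 < q - 1 := by linarith
  have hd1 : 1 < d := Real.one_lt_rpow (by linarith) (by positivity)
  have hd0 : 0 < d := by linarith
  have hdq : d ^ (q - 1) = 1 + η := by
    rw [hd, ← Real.rpow_mul (by linarith), one_div_mul_cancel hq1.ne', Real.rpow_one]
  have hdd : 0 < d / (d - 1) := div_pos hd0 (by linarith)
  refine ⟨(d / (d - 1)) ^ (q - 1), by positivity, fun a b => ?_⟩
  have hx : d * |a| ∈ Set.Ici (0 : ℝ) := Set.mem_Ici.2 (by positivity)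
  have hy : d / (d - 1) * |b| ∈ Set.Ici (0 : ℝ) := Set.mem_Ici.2 (by positivity)
  have hw1 : 0 ≤ 1 / d := by positivity
  have hw2 : 0 ≤ (d - 1) / d := div_nonneg (by linarith) hd0.le
  have hw : 1 / d + (d - 1) / d = 1 := by field_simp; ring
  have hconv := (convexOn_rpow hq.le).2 hx hy hw1 hw2 hw
  simp only [smul_eq_mul] at hconv
  have hd1' : d - 1 ≠ 0 := by linarith
  have e1 : 1 / d * (d * |a|) + (d - 1) / d * (d / (d - 1) * |b|) = |a| + |b| := by
    field_simp
  have e2 : 1 / d * (d * |a|) ^ q = (1 + η) * |a| ^ q := by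
    rw [Real.mul_rpow hd0.le (abs_nonneg a), ← hdq, Real.rpow_sub_one hd0.ne']
    ring
  have e3 : (d - 1) / d * (d / (d - 1) * |b|) ^ q = (d / (d - 1)) ^ (q - 1) * |b| ^ q := by
    rw [Real.mul_rpow hdd.le (abs_nonneg b), Real.rpow_sub_one hdd.ne']
    field_simp
  rw [e1, e2, e3] at hconv
  exact (Real.rpow_le_rpow (abs_nonneg _) (abs_add_le a b) (by linarith)).trans hconv

lemma exists_abs_rpow_sub_le {q η : ℝ} (hq : 1 < q) (hη : 0 < η) : ∃ C : ℝ, 0 ≤ C ∧ ∀ a b : ℝ,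
    |(|a + b| ^ q - |a| ^ q - |b| ^ q)| ≤ η * |a| ^ q + C * |b| ^ q := by
  obtain ⟨C, hC0, hC⟩ := exists_abs_add_rpow_le hq hη
  refine ⟨C + 1, by linarith, fun a b => ?_⟩
  have h1 := hC a b
  -- Writing `a = (a + b) - b` in the upper bound gives the lower one.
  have h2 := hC (a + b) (-b)
  rw [add_neg_cancel_right, abs_neg] at h2
  have ha : 0 ≤ |a| ^ q := by positivity
  have hb : 0 ≤ |b| ^ q := by positivity
  have hab : 0 ≤ |a + b| ^ q := by positivity
  have hCb : 0 ≤ C * |b| ^ q := by positivity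
  have hηa : 0 ≤ η * |a| ^ q := by positivity
  rw [abs_le]
  constructor
  · rcases le_total (|a + b| ^ q) (|a| ^ q) with h | h
    · have : η * |a + b| ^ q ≤ η * |a| ^ q := by gcongr
      linarith
    · linarith
  · linarith

/-- The **Brezis–Lieb lemma**. -/
lemma tendsto_integral_brezisLieb {α : Type*} [MeasurableSpace α] {m : Measure α} {q : ℝ}
    (hq : 1 < q) {v : ℕ → α → ℝ} {f : α → ℝ} (hv : ∀ n, AEStronglyMeasurable (v n) m)
    (hf : AEStronglyMeasurable f m) (hvi : ∀ n, Integrable (fun x => |v n x| ^ q) m)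
    (hfi : Integrable (fun x => |f x| ^ q) m) {M : ℝ} (hM : ∀ n, ∫ x, |v n x| ^ q ∂m ≤ M)
    (hlim : ∀ᵐ x ∂m, Tendsto (fun n => v n x) atTop (𝓝 0)) :
    Tendsto (fun n => ∫ x, (|v n x + f x| ^ q - |v n x| ^ q - |f x| ^ q) ∂m) atTop (𝓝 0) := by
  have hq0 : 0 < q := by linarith
  have hM0 : 0 ≤ M := (integral_nonneg fun x => by positivity).trans (hM 0)
  set D : ℕ → α → ℝ := fun n x => |v n x + f x| ^ q - |v n x| ^ q - |f x| ^ q with hD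
  have hDm : ∀ n, AEStronglyMeasurable (D n) m := fun n =>
    (((((hv n).add hf).norm.aemeasurable.pow_const q).sub
      ((hv n).norm.aemeasurable.pow_const q)).sub
      (hf.norm.aemeasurable.pow_const q)).aestronglyMeasurable
  rw [Metric.tendsto_atTop']
  intro ε hε
  set η := ε / (2 * (M + 1)) with hη
  have hη0 : 0 < η := by positivity
  obtain ⟨C, hC0, hC⟩ := exists_abs_rpow_sub_le hq hη0
  -- The excess of the defect over `η |v_n|^q` is dominated by the fixed integrable function `C
  -- |f|^q`, so its integral tends to zero. The subtracted part integrates to at most `η M < ε/2`.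
  set W : ℕ → α → ℝ := fun n x => max (|D n x| - η * |v n x| ^ q) 0 with hW
  have hWm : ∀ n, AEStronglyMeasurable (W n) m := fun n =>
    (((hDm n).norm.aemeasurable.sub
      (((hv n).norm.aemeasurable.pow_const q).const_mul η)).max aemeasurable_const).aestronglyMeasurable
  have hWle : ∀ n x, W n x ≤ C * |f x| ^ q := fun n x =>
    max_le (by linarith [hC (v n x) (f x)]) (by positivity)
  have hW0 : ∀ n x, 0 ≤ W n x := fun n x => le_max_right _ _
  have hCi : Integrable (fun x => C * |f x| ^ q) m := hfi.const_mul C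
  have hWi : ∀ n, Integrable (W n) m := fun n =>
    hCi.mono' (hWm n) (Eventually.of_forall fun x => by
      rw [Real.norm_of_nonneg (hW0 n x)]
      exact hWle n x)
  have hWlim : Tendsto (fun n => ∫ x, W n x ∂m) atTop (𝓝 0) := by
    have h := tendsto_integral_of_dominated_convergence (F := W) (f := fun _ => 0)
      (fun x => C * |f x| ^ q) hWm hCi
      (fun n => Eventually.of_forall fun x => by
        rw [Real.norm_of_nonneg (hW0 n x)]
        exact hWle n x) ?_
    · simpa using h
    filter_upwards [hlim] with x hx
    have c1 : Tendsto (fun n => |v n x| ^ q) atTop (𝓝 0) := by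
      have := (hx.abs).rpow_const (p := q) (Or.inr hq0.le)
      rwa [abs_zero, Real.zero_rpow hq0.ne'] at this
    have c2 : Tendsto (fun n => |v n x + f x| ^ q) atTop (𝓝 (|f x| ^ q)) := by
      have := ((hx.add_const (f x)).abs).rpow_const (p := q) (Or.inr hq0.le)
      rwa [zero_add] at this
    have c3 : Tendsto (fun n => D n x) atTop (𝓝 0) := by
      have := (c2.sub c1).sub_const (|f x| ^ q)
      rwa [sub_zero, sub_self] at this
    have c4 := (c3.abs.sub (c1.const_mul η)).max (tendsto_const_nhds (x := (0 : ℝ)))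
    rw [abs_zero, mul_zero, sub_zero, max_self] at c4
    exact c4
  have hev := hWlim.eventually (gt_mem_nhds (by positivity : (0 : ℝ) < ε / 2))
  obtain ⟨n₀, hn₀⟩ := eventually_atTop.1 hev
  refine ⟨n₀, fun n hn => ?_⟩
  rw [dist_zero_right]
  have hb : ∀ x, ‖D n x‖ ≤ W n x + η * |v n x| ^ q := fun x => by
    have := le_max_left (|D n x| - η * |v n x| ^ q) 0
    rw [Real.norm_eq_abs]
    linarith
  calc ‖∫ x, D n x ∂m‖ ≤ ∫ x, (W n x + η * |v n x| ^ q) ∂m :=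
        norm_integral_le_of_norm_le ((hWi n).add ((hvi n).const_mul η)) (Eventually.of_forall hb)
    _ = (∫ x, W n x ∂m) + η * ∫ x, |v n x| ^ q ∂m := by
        rw [integral_add (hWi n) ((hvi n).const_mul η), integral_const_mul]
    _ < ε / 2 + η * (M + 1) := by
        have h1 := hn₀ n hn.le
        have h2 : η * ∫ x, |v n x| ^ q ∂m ≤ η * (M + 1) := by
          gcongr
          linarith [hM n]
        linarith
    _ = ε := by
        rw [hη]
        field_simp
        ring

/-! ### Differentiability of `u ↦ ∫ |u|^t` -/

lemma hasDerivAt_abs_rpow_mul_self {s : ℝ} (hs : 0 < s) (x : ℝ) :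
    HasDerivAt (fun x : ℝ => |x| ^ s * x) ((s + 1) * |x| ^ s) x := by
  have hpos : ∀ y : ℝ, 0 < y → HasDerivAt (fun x : ℝ => |x| ^ s * x) ((s + 1) * |y| ^ s) y := by
    intro y hy
    have h := Real.hasDerivAt_rpow_const (x := y) (p := s + 1) (Or.inl hy.ne')
    rw [add_sub_cancel_right] at h
    rw [abs_of_pos hy]
    refine h.congr_of_eventuallyEq ?_
    filter_upwards [lt_mem_nhds hy] with z hz
    rw [abs_of_pos hz, Real.rpow_add_one hz.ne']
  rcases lt_trichotomy x 0 with hx | rfl | hx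
  · have h := (hpos (-x) (by linarith)).scomp x (hasDerivAt_neg x)
    have h2 := h.neg
    rw [abs_neg] at h2
    refine (h2.congr_deriv (by simp)).congr_of_eventuallyEq (Eventually.of_forall fun z => ?_)
    simp
  · rw [hasDerivAt_iff_tendsto_slope_zero]
    have h : Tendsto (fun t : ℝ => |t| ^ s) (𝓝[≠] 0) (𝓝 0) := by
      have h1 : Tendsto (fun t : ℝ => |t| ^ s) (𝓝 0) (𝓝 (|(0 : ℝ)| ^ s)) :=
        ((continuous_abs.rpow_const fun _ => Or.inr hs.le).tendsto 0)
      rw [abs_zero, Real.zero_rpow hs.ne'] at h1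
      exact h1.mono_left nhdsWithin_le_nhds
    rw [show (s + 1) * |(0 : ℝ)| ^ s = 0 by simp [hs.ne']]
    refine h.congr' ?_
    filter_upwards [self_mem_nhdsWithin] with t ht
    have ht' : t ≠ 0 := ht
    simp only [zero_add, mul_zero, sub_zero, smul_eq_mul]
    field_simp
  · exact hpos x hx

/-- Two applications of the mean value inequality, with the second derivative `t(t-1)|x|^(t-2)`
bounded on the segment through `|x| ≤ |a| + |b|`. Splitting `(|a|+|b|)^(t-2)` leaves terms that are
integrable by Hölder's inequality. -/
lemma abs_taylor_remainder_le {t : ℝ} (ht : 2 < t) (a b : ℝ) :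
    |(|a + b| ^ t - |a| ^ t - t * (|a| ^ (t - 2) * a) * b)| ≤
      t * (t - 1) * 2 ^ (t - 2) * (|a| ^ (t - 2) * b ^ 2 + |b| ^ t) := by
  set s := t - 2 with hs
  have hs0 : 0 < s := by linarith
  set I := Set.uIcc a (a + b) with hI
  have hmem : ∀ x ∈ I, |x - a| ≤ |b| ∧ |x| ≤ |a| + |b| := by
    intro x hx
    have h1 : |x - a| ≤ |b| := by
      have := Set.abs_sub_left_of_mem_uIcc hx
      rwa [add_sub_cancel_left] at this
    refine ⟨h1, ?_⟩
    have := abs_add_le a (x - a)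
    rw [add_sub_cancel] at this
    linarith
  have hconv : Convex ℝ I := convex_uIcc a (a + b)
  have ha : a ∈ I := Set.left_mem_uIcc
  have hab : a + b ∈ I := Set.right_mem_uIcc
  have hstep : ∀ x ∈ I, |(|x| ^ s * x - |a| ^ s * a)| ≤ (s + 1) * (|a| + |b|) ^ s * |b| := by
    intro x hx
    have h := hconv.norm_image_sub_le_of_norm_hasDerivWithin_le (f := fun x : ℝ => |x| ^ s * x)
      (f' := fun x => (s + 1) * |x| ^ s) (C := (s + 1) * (|a| + |b|) ^ s)
      (fun y _ => (hasDerivAt_abs_rpow_mul_self hs0 y).hasDerivWithinAt) (fun y hy => ?_) ha hx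
    · simp only [Real.norm_eq_abs] at h
      refine h.trans ?_
      exact mul_le_mul_of_nonneg_left (hmem x hx).1 (by positivity)
    · rw [Real.norm_of_nonneg (by positivity)]
      gcongr
      exact (hmem y hy).2
  have hfin := hconv.norm_image_sub_le_of_norm_hasDerivWithin_le
    (f := fun x : ℝ => |x| ^ t - t * (|a| ^ s * a) * x)
    (f' := fun x => t * |x| ^ (t - 2) * x - t * (|a| ^ s * a) * 1)
    (C := t * ((s + 1) * (|a| + |b|) ^ s * |b|))
    (fun y _ => ((hasDerivAt_abs_rpow y (by linarith)).sub
      ((hasDerivAt_id y).const_mul _)).hasDerivWithinAt) (fun y hy => ?_) ha hab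
  · simp only [Real.norm_eq_abs, add_sub_cancel_left] at hfin
    have e : |a + b| ^ t - t * (|a| ^ s * a) * (a + b) - (|a| ^ t - t * (|a| ^ s * a) * a) =
        |a + b| ^ t - |a| ^ t - t * (|a| ^ s * a) * b := by ring
    rw [e] at hfin
    refine hfin.trans ?_
    have hsum : (|a| + |b|) ^ s * b ^ 2 ≤ 2 ^ s * (|a| ^ s * b ^ 2 + |b| ^ t) := by
      have e2 : |b| ^ t = |b| ^ s * b ^ 2 := by
        rw [← sq_abs b, ← Real.rpow_natCast, ← Real.rpow_add' (abs_nonneg b)]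
        · congr 1
          push_cast
          linarith
        · push_cast
          linarith
      rw [e2, ← add_mul, ← mul_assoc]
      gcongr
      rcases le_total |a| |b| with h | h
      · calc (|a| + |b|) ^ s ≤ (2 * |b|) ^ s := by gcongr; linarith
          _ = 2 ^ s * |b| ^ s := Real.mul_rpow (by norm_num) (abs_nonneg _)
          _ ≤ _ := by gcongr; linarith [Real.rpow_nonneg (abs_nonneg a) s]
      · calc (|a| + |b|) ^ s ≤ (2 * |a|) ^ s := by gcongr; linarith
          _ = 2 ^ s * |a| ^ s := Real.mul_rpow (by norm_num) (abs_nonneg _)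
          _ ≤ _ := by gcongr; linarith [Real.rpow_nonneg (abs_nonneg b) s]
    have e3 : t * ((s + 1) * (|a| + |b|) ^ s * |b|) * |b| =
        t * (t - 1) * ((|a| + |b|) ^ s * b ^ 2) := by
      rw [← sq_abs b, hs]
      ring
    rw [e3, mul_assoc (t * (t - 1))]
    exact mul_le_mul_of_nonneg_left hsum (mul_nonneg (by linarith) (by linarith))
  · have e : t * |y| ^ (t - 2) * y - t * (|a| ^ s * a) * 1 =
        t * (|y| ^ s * y - |a| ^ s * a) := by
      rw [hs]
      ring
    rw [e, Real.norm_eq_abs, abs_mul, abs_of_pos (by linarith : 0 < t)]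
    exact mul_le_mul_of_nonneg_left (hstep y hy) (by linarith)

section PowInt
variable {t : ℝ}

lemma integrable_powInt_deriv (hN : 5 ≤ N) (ht : 2 < t) (ht' : t ≤ critExp N) (u v : H2 N) :
    Integrable fun x => |fn u x| ^ (t - 2) * fn u x * fn v x := by
  have hF := integrable_abs_rpow hN ht.le ht' u
  have hG := integrable_abs_rpow hN ht.le ht' v
  have ht0 : t ≠ 0 := by linarith
  have h := integrable_rpow_mul_rpow hF hG (fun x => by positivity) (fun x => by positivity)
    (a := (t - 1) / t) (b := 1 / t) (div_nonneg (by linarith) (by linarith))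
    (div_nonneg (by linarith) (by linarith)) (by field_simp; ring)
  refine h.mono' ?_ (Eventually.of_forall fun x => ?_)
  · exact ((((measurable_fn u).abs.pow_const _).mul (measurable_fn u)).mul
      (measurable_fn v)).aestronglyMeasurable
  · rw [← Real.rpow_mul (abs_nonneg _), ← Real.rpow_mul (abs_nonneg _), mul_one_div_cancel ht0,
      Real.rpow_one, mul_div_cancel₀ _ ht0, norm_mul, norm_mul, Real.norm_eq_abs (fn u x),
      Real.norm_eq_abs (fn v x), Real.norm_of_nonneg (by positivity)]
    gcongr
    rw [← Real.rpow_add_one' (abs_nonneg _) (by linarith)]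
    exact le_of_eq (by ring_nf)

lemma integral_powInt_deriv_le (hN : 5 ≤ N) (ht : 2 < t) (ht' : t ≤ critExp N) (u v : H2 N) :
    |∫ x, |fn u x| ^ (t - 2) * fn u x * fn v x| ≤
      powInt t u ^ ((t - 1) / t) * powInt t v ^ (1 / t) := by
  have hF := integrable_abs_rpow hN ht.le ht' u
  have hG := integrable_abs_rpow hN ht.le ht' v
  have ht0 : t ≠ 0 := by linarith
  refine le_trans ?_ (integral_rpow_mul_rpow_le hF hG (fun x => by positivity)
    (fun x => by positivity)
    (a := (t - 1) / t) (b := 1 / t) (div_nonneg (by linarith) (by linarith))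
    (div_nonneg (by linarith) (by linarith)) (by field_simp; ring))
  rw [← Real.norm_eq_abs]
  refine norm_integral_le_of_norm_le (integrable_rpow_mul_rpow hF hG (fun x => by positivity)
    (fun x => by positivity)
    (a := (t - 1) / t) (b := 1 / t) (div_nonneg (by linarith) (by linarith))
    (div_nonneg (by linarith) (by linarith)) (by field_simp; ring)) (Eventually.of_forall fun x => ?_)
  rw [← Real.rpow_mul (abs_nonneg _), ← Real.rpow_mul (abs_nonneg _), mul_one_div_cancel ht0,
    Real.rpow_one, mul_div_cancel₀ _ ht0, norm_mul, norm_mul, Real.norm_eq_abs (fn u x),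
    Real.norm_eq_abs (fn v x), Real.norm_of_nonneg (by positivity)]
  gcongr
  rw [← Real.rpow_add_one' (abs_nonneg _) (by linarith)]
  exact le_of_eq (by ring_nf)

/-- The differential of `u ↦ ∫ |u|^t`. -/
lemma exists_powInt_differential (hN : 5 ≤ N) (ht : 2 < t) (ht' : t ≤ critExp N) (u : H2 N) :
    ∃ L : H2 N →L[ℝ] ℝ, ∀ v, L v = t * ∫ x, |fn u x| ^ (t - 2) * fn u x * fn v x := by
  obtain ⟨K, hK0, hK⟩ := exists_powInt_le_norm hN ht.le ht'
  have hint := integrable_powInt_deriv hN ht ht' u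
  let L₀ : H2 N →ₗ[ℝ] ℝ :=
    { toFun := fun v => t * ∫ x, |fn u x| ^ (t - 2) * fn u x * fn v x
      map_add' := fun v w => by
        rw [← mul_add, ← integral_add (hint v) (hint w)]
        congr 1
        refine integral_congr_ae ?_
        filter_upwards [fn_add v w] with x hx
        rw [hx, Pi.add_apply]
        ring
      map_smul' := fun a v => by
        have : ∫ x, |fn u x| ^ (t - 2) * fn u x * fn (a • v) x =
            a * ∫ x, |fn u x| ^ (t - 2) * fn u x * fn v x := by
          rw [← integral_const_mul]
          refine integral_congr_ae ?_
          filter_upwards [fn_smul a v] with x hx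
          rw [hx, Pi.smul_apply, smul_eq_mul]
          ring
        rw [this]
        simp only [RingHom.id_apply, smul_eq_mul]
        ring }
  refine ⟨L₀.mkContinuous (t * (powInt t u ^ ((t - 1) / t) * K)) fun v => ?_, fun v => rfl⟩
  have hv := integral_powInt_deriv_le hN ht ht' u v
  change ‖t * ∫ x, |fn u x| ^ (t - 2) * fn u x * fn v x‖ ≤ _
  rw [norm_mul, Real.norm_of_nonneg (by linarith : 0 ≤ t), Real.norm_eq_abs, mul_assoc, mul_assoc]
  have hpn := Real.rpow_nonneg (powInt_nonneg t u) ((t - 1) / t)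
  refine mul_le_mul_of_nonneg_left (hv.trans ?_) (by linarith)
  exact mul_le_mul_of_nonneg_left (hK v) hpn

/-- The pointwise Taylor bound is integrated, using Hölder with exponents `(t-2)/t` and `2/t` for
the mixed term. The restriction `‖v‖ ≤ 1` absorbs `‖v‖^t` into `‖v‖²`. -/
lemma exists_powInt_remainder_le (hN : 5 ≤ N) (ht : 2 < t) (ht' : t ≤ critExp N) (u : H2 N) :
    ∃ C : ℝ, ∀ v : H2 N, ‖v‖ ≤ 1 →
      |powInt t (u + v) - powInt t u - t * ∫ x, |fn u x| ^ (t - 2) * fn u x * fn v x| ≤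
        C * ‖v‖ ^ 2 := by
  obtain ⟨K, hK0, hK⟩ := exists_powInt_le_norm hN ht.le ht'
  have ht0 : 0 < t := by linarith
  set c := t * (t - 1) * 2 ^ (t - 2) with hc
  have hc0 : 0 ≤ c := mul_nonneg (mul_nonneg ht0.le (by linarith)) (by positivity)
  refine ⟨c * (powInt t u ^ ((t - 2) / t) * K ^ 2 + K ^ t), fun v hv => ?_⟩
  have hu := integrable_abs_rpow hN ht.le ht' u
  have hvi := integrable_abs_rpow hN ht.le ht' v
  have huv := integrable_abs_rpow hN ht.le ht' (u + v)
  have hd := integrable_powInt_deriv hN ht ht' u v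
  have ea : ∀ x, (|fn u x| ^ t) ^ ((t - 2) / t) * (|fn v x| ^ t) ^ (2 / t) =
      |fn u x| ^ (t - 2) * fn v x ^ 2 := by
    intro x
    rw [← Real.rpow_mul (abs_nonneg _), ← Real.rpow_mul (abs_nonneg _), mul_div_cancel₀ _ ht0.ne',
      mul_div_cancel₀ _ ht0.ne', Real.rpow_two, sq_abs]
  have hsum1 : (t - 2) / t + 2 / t = 1 := by field_simp; ring
  have h0a : 0 ≤ (t - 2) / t := div_nonneg (by linarith) ht0.le
  have h0b : 0 ≤ 2 / t := by positivity
  have hi := integrable_rpow_mul_rpow hu hvi (fun x => by positivity) (fun x => by positivity)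
    h0a h0b hsum1
  have hle := integral_rpow_mul_rpow_le hu hvi (fun x => by positivity) (fun x => by positivity)
    h0a h0b hsum1
  simp only [ea] at hi hle
  have e1 : powInt t (u + v) - powInt t u - t * ∫ x, |fn u x| ^ (t - 2) * fn u x * fn v x =
      ∫ x, (|fn u x + fn v x| ^ t - |fn u x| ^ t -
        t * (|fn u x| ^ (t - 2) * fn u x) * fn v x) := by
    have e2 : powInt t (u + v) = ∫ x, |fn u x + fn v x| ^ t := by
      refine integral_congr_ae ?_
      filter_upwards [fn_add u v] with x hx
      rw [hx, Pi.add_apply]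
    have huv' : Integrable fun x => |fn u x + fn v x| ^ t := by
      refine huv.congr ?_
      filter_upwards [fn_add u v] with x hx
      rw [hx, Pi.add_apply]
    have hsub : Integrable fun x => |fn u x + fn v x| ^ t - |fn u x| ^ t := huv'.sub hu
    rw [e2, powInt, ← integral_const_mul, ← integral_sub huv' hu,
      ← integral_sub hsub (hd.const_mul t)]
    refine integral_congr_ae (Eventually.of_forall fun x => ?_)
    dsimp only
    ring
  have hpv : powInt t v ^ (1 / t) ≤ K * ‖v‖ := hK v
  have hpv0 := powInt_nonneg t v
  have hpu0 := powInt_nonneg t u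
  have k1 : powInt t v ^ (2 / t) ≤ K ^ 2 * ‖v‖ ^ 2 := by
    have := pow_le_pow_left₀ (Real.rpow_nonneg hpv0 _) hpv 2
    rw [← Real.rpow_natCast, ← Real.rpow_mul hpv0, mul_pow] at this
    rwa [show (2 : ℝ) / t = 1 / t * ((2 : ℕ) : ℝ) by push_cast; ring]
  have k2 : powInt t v ≤ K ^ t * ‖v‖ ^ 2 := by
    have := Real.rpow_le_rpow (Real.rpow_nonneg hpv0 _) hpv ht0.le
    rw [← Real.rpow_mul hpv0, one_div_mul_cancel ht0.ne', Real.rpow_one,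
      Real.mul_rpow hK0 (norm_nonneg _)] at this
    refine this.trans ?_
    gcongr
    rw [← Real.rpow_two]
    exact Real.rpow_le_rpow_of_exponent_ge_of_imp (norm_nonneg v) hv ht.le
      (fun _ h => absurd h ht0.ne')
  rw [e1, ← Real.norm_eq_abs]
  calc _ ≤ ∫ x, c * (|fn u x| ^ (t - 2) * fn v x ^ 2 + |fn v x| ^ t) :=
        norm_integral_le_of_norm_le ((hi.add hvi).const_mul c)
          (Eventually.of_forall fun x => abs_taylor_remainder_le ht _ _)
    _ = c * ((∫ x, |fn u x| ^ (t - 2) * fn v x ^ 2) + powInt t v) := by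
        rw [integral_const_mul, integral_add hi hvi, powInt]
    _ ≤ c * (powInt t u ^ ((t - 2) / t) * (K ^ 2 * ‖v‖ ^ 2) + K ^ t * ‖v‖ ^ 2) := by
        refine mul_le_mul_of_nonneg_left (add_le_add (hle.trans ?_) k2) hc0
        exact mul_le_mul_of_nonneg_left k1 (Real.rpow_nonneg hpu0 _)
    _ = _ := by ring

lemma differentiableAt_powInt (hN : 5 ≤ N) (ht : 2 < t) (ht' : t ≤ critExp N) (u : H2 N) :
    DifferentiableAt ℝ (powInt t : H2 N → ℝ) u := by
  obtain ⟨L, hL⟩ := exists_powInt_differential hN ht ht' u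
  obtain ⟨C, hC⟩ := exists_powInt_remainder_le hN ht ht' u
  refine HasFDerivAt.differentiableAt (f' := L) ?_
  rw [hasFDerivAt_iff_isLittleO_nhds_zero]
  refine Asymptotics.IsBigO.trans_isLittleO (g := fun v : H2 N => ‖v‖ ^ 2) ?_
    (Asymptotics.isLittleO_norm_pow_id one_lt_two)
  refine Asymptotics.IsBigO.of_bound C ?_
  filter_upwards [Metric.closedBall_mem_nhds (0 : H2 N) one_pos] with v hv
  have hn : ‖(‖v‖ ^ 2 : ℝ)‖ = ‖v‖ ^ 2 := Real.norm_of_nonneg (by positivity)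
  rw [hL, hn, Real.norm_eq_abs]
  exact hC v (by simpa using hv)

end PowInt

lemma differentiableAt_energy (hN : 5 ≤ N) (μ : ℝ) {p : ℝ} (hp : 2 < p) (hp' : p ≤ critExp N)
    (u : H2 N) : DifferentiableAt ℝ (energy μ p : H2 N → ℝ) u := by
  have h1 : DifferentiableAt ℝ (lapSq : H2 N → ℝ) u := by
    have : (lapSq : H2 N → ℝ) = fun u => ‖lapL u‖ ^ 2 := funext lapSq_eq
    rw [this]
    exact lapL.differentiableAt.norm_sq ℝ
  have h2 : DifferentiableAt ℝ (gradSq : H2 N → ℝ) u := by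
    have : (gradSq : H2 N → ℝ) = fun u => ‖gradL u‖ ^ 2 := funext gradSq_eq
    rw [this]
    exact gradL.differentiableAt.norm_sq ℝ
  exact (((h1.const_mul _).add (h2.const_mul _)).sub
    ((differentiableAt_powInt hN hp hp' u).const_mul _)).sub
    ((differentiableAt_powInt hN (two_lt_critExp hN) le_rfl u).const_mul _)

/-! ### The threshold radius -/

lemma lt_critExp (hN : 5 ≤ N) {p : ℝ} (hp' : p < 2 + 4 / N) : p < critExp N := by
  have hN' : (5 : ℝ) ≤ N := by exact_mod_cast hN
  refine hp'.trans ?_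
  have h4 : (0 : ℝ) < N - 4 := by linarith
  rw [critExp, lt_div_iff₀ h4]
  have : (4 : ℝ) / N * (N - 4) ≤ 4 := by
    rw [div_mul_eq_mul_div, div_le_iff₀ (by linarith)]
    linarith
  linarith

lemma mul_gam_lt_one (hN : 5 ≤ N) {p : ℝ} (hp : 2 < p) (hp' : p < 2 + 4 / N) :
    p * gam N p < 1 := by
  have hN' : (5 : ℝ) ≤ N := by exact_mod_cast hN
  rw [mul_gam (by linarith)]
  have : (N : ℝ) * (p - 2) < N * (4 / N) := mul_lt_mul_of_pos_left (by linarith) (by linarith)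
  rw [mul_div_cancel₀ _ (by linarith)] at this
  linarith

/-- The function `ρ ↦ K c^δ ρ^(-α) + ρ^β / Q` attains the value `1/2` at its minimum point when
`c` is the threshold value. -/
lemma threshold_identity {α β K Q δ : ℝ} (hα : 0 < α) (hβ : 0 < β) (hK : 0 < K) (hQ : 0 < Q)
    (hδ : 0 < δ) {E c r : ℝ}
    (hE : E = (α + β) / α * (α / β * K) ^ (β / (α + β)) * Q ^ (-α / (α + β)))
    (hc : c = (1 / (2 * E)) ^ ((α + β) / (δ * β)))
    (hr : r = (α / β * K * Q * c ^ δ) ^ (1 / (α + β))) :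
    0 < r ∧ 0 < c ∧ K * c ^ δ + 1 / Q * r ^ (α + β) = r ^ α / 2 := by
  have hαβ : 0 < α + β := by linarith
  have hE0 : 0 < E := by rw [hE]; positivity
  have hc0 : 0 < c := by rw [hc]; positivity
  have hcδ0 : 0 < c ^ δ := by positivity
  have hr0 : 0 < r := by rw [hr]; positivity
  refine ⟨hr0, hc0, ?_⟩
  have h1 : r ^ (α + β) = α / β * K * Q * c ^ δ := by
    rw [hr, ← Real.rpow_mul (by positivity), one_div_mul_cancel hαβ.ne', Real.rpow_one]
  have h2 : (c ^ δ) ^ (β / (α + β)) = 1 / (2 * E) := by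
    rw [hc, ← Real.rpow_mul (by positivity), ← Real.rpow_mul (by positivity)]
    rw [show (α + β) / (δ * β) * (δ * (β / (α + β))) = 1 by field_simp, Real.rpow_one]
  have h3 : r ^ β = (α / β * K) ^ (β / (α + β)) * Q ^ (β / (α + β)) * (1 / (2 * E)) := by
    rw [← h2, ← Real.mul_rpow (by positivity) (by positivity),
      ← Real.mul_rpow (by positivity) (by positivity), ← h1, ← Real.rpow_mul hr0.le,
      mul_div_cancel₀ _ hαβ.ne']
  have h4 : Q ^ (β / (α + β)) = Q * Q ^ (-α / (α + β)) := by
    rw [← Real.rpow_one_add' hQ.le]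
    · congr 1
      field_simp
      ring
    · have : 1 + -α / (α + β) = β / (α + β) := by field_simp; ring
      rw [this]
      positivity
  -- At the minimum point the two terms are in the ratio `β : α`, so the minimum is `(α+β)/(αQ)
  -- r^β`. In terms of `c` it equals `E (c^δ)^(β/(α+β))`, and the threshold `c` makes this `1/2`.
  have h5 : (α + β) / α * (1 / Q) * r ^ β = 1 / 2 := by
    rw [h3, h4]
    have h6 : (α + β) / α * (1 / Q) * ((α / β * K) ^ (β / (α + β)) *
        (Q * Q ^ (-α / (α + β))) * (1 / (2 * E))) = E * (1 / (2 * E)) := by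
      rw [hE]
      field_simp
    rw [h6]
    field_simp
  have h7 : K * c ^ δ = β / α * (1 / Q) * r ^ (α + β) := by
    rw [h1]
    field_simp
  rw [h7]
  calc _ = ((α + β) / α * (1 / Q) * r ^ β) * r ^ α := by
        rw [Real.rpow_add hr0]
        field_simp
        ring
    _ = _ := by rw [h5]; ring

/-- Below the threshold mass, the lower bound for the energy given by the Gagliardo–Nirenberg and
Sobolev inequalities is positive on the sphere of radius `r_*`. -/
lemma threshold_lt (hN : 5 ≤ N) {μ : ℝ} (hμ : 0 < μ) {p : ℝ} (hp : 2 < p) (hp' : p < 2 + 4 / N)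
    {c : ℝ} (hc0 : 0 ≤ c) (hc : c < cStar N μ p) :
    0 < rStar N μ p ∧
    μ / p * gnConst N p ^ p * c ^ (p * (1 - gam N p) / 2) *
        (rStar N μ p ^ 2) ^ (p * gam N p / 2) +
      1 / (critExp N * sobConst N ^ (critExp N / 2)) * (rStar N μ p ^ 2) ^ (critExp N / 2) <
      rStar N μ p ^ 2 / 2 := by
  have hq := two_lt_critExp hN
  have hpγ := mul_gam_lt_one hN hp hp'
  have hpq := lt_critExp hN hp'
  have hC := gnConst_pos hN hp.le hpq.le
  have hS := sobConst_pos hN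
  have hδ : 0 < p * (1 - gam N p) / 2 := by linarith
  set α := 2 - p * gam N p with hα
  set β := critExp N - 2 with hβ
  set K := μ / p * gnConst N p ^ p with hK
  set Q := critExp N * sobConst N ^ (critExp N / 2) with hQ
  set δ := p * (1 - gam N p) / 2 with hδe
  have hp0 : 0 < p := by linarith
  have hα0 : 0 < α := by linarith
  have hβ0 : 0 < β := by linarith
  have hsum : critExp N - p * gam N p = α + β := by rw [hα, hβ]; ring
  obtain ⟨hr0, hcs, hid⟩ := threshold_identity (α := α) (β := β) (K := K) (Q := Q) (δ := δ)
    (E := scriptE N μ p) (c := cStar N μ p) (r := rStar N μ p) hα0 hβ0 (by positivity)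
    (mul_pos (by linarith) (by positivity)) hδ
    (by
      rw [scriptE, hsum, ← hα, ← hβ, ← hQ]
      congr 3
      · rw [hK]; field_simp
      · rw [hα]; ring)
    (by
      rw [cStar, hsum, ← hβ]
      congr 1
      rw [hδe]
      field_simp)
    (by
      rw [rStar, rad, hsum, ← hα, ← hβ, ← hδe]
      congr 1
      rw [hK, hQ]
      field_simp)
  refine ⟨hr0, ?_⟩
  set r := rStar N μ p
  -- All three terms contain the factor `r^(2-α)`. Without it the inequality is
  -- `threshold_identity`, made strict by `c^δ < c_*^δ`.
  have e1 : (r ^ 2) ^ (p * gam N p / 2) = r ^ (2 - α) := by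
    rw [← Real.rpow_two, ← Real.rpow_mul hr0.le, hα]
    congr 1
    ring
  have e2 : (r ^ 2) ^ (critExp N / 2) = r ^ (α + β) * r ^ (2 - α) := by
    rw [← Real.rpow_two, ← Real.rpow_mul hr0.le, ← Real.rpow_add hr0]
    congr 1
    rw [hβ]
    ring
  have e3 : r ^ 2 = r ^ α * r ^ (2 - α) := by
    rw [← Real.rpow_add hr0, ← Real.rpow_two]
    congr 1
    ring
  have hlt : c ^ δ < cStar N μ p ^ δ := Real.rpow_lt_rpow hc0 hc hδ
  have hK0 : 0 < K := by positivity
  have hr2 : 0 < r ^ (2 - α) := by positivity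
  rw [e1, e2, e3]
  have := mul_lt_mul_of_pos_right (add_lt_add_left (mul_lt_mul_of_pos_left hlt hK0)
    (1 / Q * r ^ (α + β))) hr2
  rw [hid] at this
  linarith

/-- The squared seminorm `‖Δu‖₂² + ‖∇u‖₂²`. -/
def seminormSq (u : H2 N) : ℝ := lapSq u + gradSq u

lemma seminormSq_nonneg (u : H2 N) : 0 ≤ seminormSq u :=
  add_nonneg (lapSq_nonneg u) (gradSq_nonneg u)

lemma seminormSq_smul (a : ℝ) (u : H2 N) : seminormSq (a • u) = a ^ 2 * seminormSq u := by
  rw [seminormSq, seminormSq, lapSq_smul, gradSq_smul, mul_add]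

lemma energy_eq (μ p : ℝ) (u : H2 N) : energy μ p u =
    1 / 2 * seminormSq u - μ / p * powInt p u - 1 / critExp N * powInt (critExp N) u := by
  rw [energy, seminormSq]
  ring

lemma powInt_le_seminormSq (hN : 5 ≤ N) {p : ℝ} (hp : 2 ≤ p) (hp' : p ≤ critExp N) (u : H2 N) :
    powInt p u ≤ gnConst N p ^ p * mass u ^ (p * (1 - gam N p) / 2) *
      seminormSq u ^ (p * gam N p / 2) := by
  refine (powInt_le_gnConst hN hp hp' u).trans ?_
  have h0 := gnConst_nonneg N p
  have hm := mass_nonneg u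
  rw [mul_right_comm]
  refine mul_le_mul_of_nonneg_left (Real.rpow_le_rpow (lapSq_nonneg u) ?_ ?_) (by positivity)
  · exact le_add_of_nonneg_right (gradSq_nonneg u)
  · have := gam_nonneg (N := N) hp
    positivity

lemma powInt_critExp_le_seminormSq (hN : 5 ≤ N) (u : H2 N) :
    1 / critExp N * powInt (critExp N) u ≤
      1 / (critExp N * sobConst N ^ (critExp N / 2)) * seminormSq u ^ (critExp N / 2) := by
  have hq := two_lt_critExp hN
  have hS := sobConst_pos hN
  have h := (powInt_critExp_le hN u).trans (Real.rpow_le_rpow (z := critExp N / 2) (lapSq_nonneg u)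
    (le_add_of_nonneg_right (gradSq_nonneg u) : lapSq u ≤ seminormSq u) (by linarith))
  have hs : 0 < sobConst N ^ (critExp N / 2) := by positivity
  rw [one_div_mul_eq_div, one_div_mul_eq_div, div_le_div_iff₀ (by linarith)
    (mul_pos (by linarith) hs)]
  have := mul_le_mul_of_nonneg_left h (by linarith : 0 ≤ critExp N)
  change _ ≤ critExp N * seminormSq u ^ (critExp N / 2) at this
  linarith

lemma energy_pos_of_seminormSq_eq (hN : 5 ≤ N) {μ : ℝ} (hμ : 0 < μ) {p : ℝ} (hp : 2 < p)
    (hp' : p < 2 + 4 / N) {u : H2 N} (hu : mass u < cStar N μ p)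
    (hr : seminormSq u = rStar N μ p ^ 2) : 0 < energy μ p u := by
  have h := (threshold_lt hN hμ hp hp' (mass_nonneg u) hu).2
  have h1 := powInt_le_seminormSq hN hp.le (lt_critExp hN hp').le u
  have h2 := powInt_critExp_le_seminormSq hN u
  have h3 := mul_le_mul_of_nonneg_left h1 (by positivity : 0 ≤ μ / p)
  rw [← hr] at h
  rw [energy_eq]
  linarith

/-- Slightly beyond the threshold radius the critical term is still controlled by the quadratic
one. -/
lemma exists_radius_gt (hN : 5 ≤ N) {μ : ℝ} (hμ : 0 < μ) {p : ℝ} (hp : 2 < p)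
    (hp' : p < 2 + 4 / N) (hc : 0 < cStar N μ p) : ∃ R > rStar N μ p ^ 2, ∀ u : H2 N,
      seminormSq u ≤ R → 1 / critExp N * powInt (critExp N) u ≤ 1 / 2 * seminormSq u := by
  -- Used at mass zero: discarding the nonnegative subcritical term leaves a strict bound on the
  -- critical term alone, which persists for slightly larger radii by continuity.
  obtain ⟨hr0, h⟩ := threshold_lt hN hμ hp hp' le_rfl hc
  have hq := two_lt_critExp hN
  have hS := sobConst_pos hN
  set B := 1 / (critExp N * sobConst N ^ (critExp N / 2)) with hB
  have hB0 : 0 < B := by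
    have : 0 < critExp N := by linarith
    positivity
  set R₀ := rStar N μ p ^ 2 with hR₀
  have hR0 : 0 < R₀ := by positivity
  have hpos : 0 ≤ μ / p * gnConst N p ^ p * (0 : ℝ) ^ (p * (1 - gam N p) / 2) *
      R₀ ^ (p * gam N p / 2) := by
    have := gnConst_nonneg N p
    positivity
  have h1 : B * R₀ ^ (critExp N / 2 - 1) < 1 / 2 := by
    rw [Real.rpow_sub_one hR0.ne', ← mul_div_assoc, div_lt_iff₀ hR0]
    linarith
  have hcont : ContinuousAt (fun X : ℝ => B * X ^ (critExp N / 2 - 1)) R₀ :=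
    continuousAt_const.mul (Real.continuousAt_rpow_const _ _ (Or.inl hR0.ne'))
  have hev := hcont.eventually (gt_mem_nhds h1)
  obtain ⟨ε, hε, hball⟩ := Metric.eventually_nhds_iff.1 hev
  refine ⟨R₀ + ε / 2, by linarith, fun u hu => ?_⟩
  have h2 := hball (y := R₀ + ε / 2) (by
    rw [Real.dist_eq, add_sub_cancel_left, abs_of_pos (by linarith)]
    linarith)
  refine (powInt_critExp_le_seminormSq hN u).trans ?_
  rcases (seminormSq_nonneg u).eq_or_lt with h0 | h0
  · rw [← h0, Real.zero_rpow (by linarith)]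
    simp
  · have h3 : seminormSq u ^ (critExp N / 2) =
        seminormSq u ^ (critExp N / 2 - 1) * seminormSq u := by
      rw [Real.rpow_sub_one h0.ne', div_mul_cancel₀ _ h0.ne']
    rw [h3, ← mul_assoc]
    refine mul_le_mul_of_nonneg_right (le_trans ?_ h2.le) h0.le
    exact mul_le_mul_of_nonneg_left (Real.rpow_le_rpow h0.le hu (by linarith)) hB0.le

/-- The energy is bounded below on bounded sets. -/
lemma exists_le_energy (hN : 5 ≤ N) {μ : ℝ} (hμ : 0 < μ) {p : ℝ} (hp : 2 < p)
    (hp' : p ≤ critExp N) (c R : ℝ) : ∃ M : ℝ, ∀ u : H2 N, mass u = c → seminormSq u ≤ R →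
      M ≤ energy μ p u := by
  have hq := two_lt_critExp hN
  have hS := sobConst_pos hN
  refine ⟨-(μ / p * (gnConst N p ^ p * c ^ (p * (1 - gam N p) / 2) * R ^ (p * gam N p / 2))) -
    1 / (critExp N * sobConst N ^ (critExp N / 2)) * R ^ (critExp N / 2), fun u hm hR => ?_⟩
  have h0 := seminormSq_nonneg u
  have hg := gnConst_nonneg N p
  have hm0 := mass_nonneg u
  have h1 := mul_le_mul_of_nonneg_left (powInt_le_seminormSq hN hp.le hp' u)
    (by positivity : 0 ≤ μ / p)
  have h2 := powInt_critExp_le_seminormSq hN u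
  rw [hm] at h1 hm0
  have h3 : seminormSq u ^ (p * gam N p / 2) ≤ R ^ (p * gam N p / 2) :=
    Real.rpow_le_rpow h0 hR (by have := gam_nonneg (N := N) hp.le; positivity)
  have h4 : seminormSq u ^ (critExp N / 2) ≤ R ^ (critExp N / 2) :=
    Real.rpow_le_rpow h0 hR (by linarith)
  have h5 : μ / p * (gnConst N p ^ p * c ^ (p * (1 - gam N p) / 2) *
      seminormSq u ^ (p * gam N p / 2)) ≤ μ / p * (gnConst N p ^ p *
      c ^ (p * (1 - gam N p) / 2) * R ^ (p * gam N p / 2)) := by gcongr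
  have h6 : 1 / (critExp N * sobConst N ^ (critExp N / 2)) * seminormSq u ^ (critExp N / 2) ≤
      1 / (critExp N * sobConst N ^ (critExp N / 2)) * R ^ (critExp N / 2) := by
    have : 0 < critExp N := by linarith
    gcongr
  rw [energy_eq]
  linarith

/-! ### Functions of negative energy -/

lemma integral_comp_smul_eq (f : Sp N → ℝ) {t : ℝ} (ht : 0 < t) :
    ∫ x, f (t • x) = (t ^ N)⁻¹ * ∫ x, f x := by
  rw [Measure.integral_comp_smul volume f t, finrank_euclideanSpace_fin,
    abs_of_pos (by positivity), smul_eq_mul]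

lemma smoothGrad_comp_smul {φ : Sp N → ℝ} (hφ : ContDiff ℝ ∞ φ) (t : ℝ) (x : Sp N) :
    smoothGrad (fun x => φ (t • x)) x = t • smoothGrad φ (t • x) := by
  refine ext_inner_right ℝ fun e => ?_
  rw [inner_smoothGrad, dirDeriv_comp_smul hφ, inner_smul_left, inner_smoothGrad]
  rfl

section Dilation

variable {φ : Sp N → ℝ} (hφ : IsTest φ) {t : ℝ} (ht : 0 < t)

lemma powInt_ofTest (s : ℝ) : powInt s (ofTest φ hφ) = ∫ x, |φ x| ^ s := by
  refine integral_congr_ae ?_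
  filter_upwards [fn_ofTest hφ] with x hx
  rw [hx]

lemma mass_ofTest : mass (ofTest φ hφ) = ∫ x, φ x ^ 2 := by
  refine integral_congr_ae ?_
  filter_upwards [fn_ofTest hφ] with x hx
  rw [hx]

lemma gradSq_ofTest : gradSq (ofTest φ hφ) = ∫ x, ‖smoothGrad φ x‖ ^ 2 := by
  refine integral_congr_ae ?_
  filter_upwards [grad_ofTest hφ] with x hx
  rw [hx]

lemma lapSq_ofTest : lapSq (ofTest φ hφ) = ∫ x, Laplacian.laplacian φ x ^ 2 := by
  refine integral_congr_ae ?_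
  filter_upwards [lap_ofTest hφ] with x hx
  rw [hx]

/-- The dilation `x ↦ φ (t x)` of a test function. -/
def dilate : H2 N := ofTest (fun x => φ (t • x)) (hφ.comp_smul ht.ne')

lemma powInt_dilate (s : ℝ) :
    powInt s (dilate hφ ht) = (t ^ N)⁻¹ * powInt s (ofTest φ hφ) := by
  rw [dilate, powInt_ofTest, powInt_ofTest, ← integral_comp_smul_eq _ ht]

lemma mass_dilate : mass (dilate hφ ht) = (t ^ N)⁻¹ * mass (ofTest φ hφ) := by
  rw [dilate, mass_ofTest, mass_ofTest, ← integral_comp_smul_eq _ ht]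

lemma gradSq_dilate :
    gradSq (dilate hφ ht) = t ^ 2 * ((t ^ N)⁻¹ * gradSq (ofTest φ hφ)) := by
  rw [dilate, gradSq_ofTest, gradSq_ofTest, ← integral_comp_smul_eq _ ht, ← integral_const_mul]
  refine integral_congr_ae (Eventually.of_forall fun x => ?_)
  dsimp only
  rw [smoothGrad_comp_smul hφ.1, norm_smul, mul_pow, Real.norm_of_nonneg ht.le]

lemma lapSq_dilate :
    lapSq (dilate hφ ht) = t ^ 4 * ((t ^ N)⁻¹ * lapSq (ofTest φ hφ)) := by
  rw [dilate, lapSq_ofTest, lapSq_ofTest, ← integral_comp_smul_eq _ ht, ← integral_const_mul]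
  refine integral_congr_ae (Eventually.of_forall fun x => ?_)
  dsimp only
  rw [laplacian_comp_smul hφ.1]
  ring

end Dilation

lemma ofTest_cutoff_ne_zero : ofTest (cutoff : Sp N → ℝ) isTest_cutoff ≠ 0 := by
  intro h
  have h1 : mass (ofTest (cutoff : Sp N → ℝ) isTest_cutoff) = 0 := by
    rw [h, mass_eq, map_zero, norm_zero, zero_pow two_ne_zero]
  rw [mass_ofTest, integral_eq_zero_iff_of_nonneg (fun x => sq_nonneg _)
    isTest_cutoff.memLp.integrable_sq] at h1
  have h2 := Continuous.ae_eq_iff_eq (μ := (volume : Measure (Sp N)))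
    (isTest_cutoff.continuous.pow 2) continuous_zero |>.1 h1
  have h3 := congrFun h2 0
  simp [cutoff_eq_one] at h3

lemma isRadial_dilate_cutoff {t : ℝ} (ht : 0 < t) :
    IsRadial (dilate (N := N) isTest_cutoff ht) := by
  refine ⟨fun s => Real.smoothTransition (2 - (t * s) ^ 2), ?_⟩
  filter_upwards [fn_ofTest ((isTest_cutoff (N := N)).comp_smul ht.ne')] with x hx
  rw [dilate, hx, cutoff, norm_smul, Real.norm_of_nonneg ht.le]

/-- A radial function of prescribed mass, small seminorm and negative energy. -/
lemma exists_energy_neg (hN : 5 ≤ N) {μ : ℝ} (hμ : 0 < μ) {p : ℝ} (hp : 2 < p)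
    (hp' : p < 2 + 4 / N) {c : ℝ} (hc : 0 < c) {R : ℝ} (hR : 0 < R) :
    ∃ u : H2 N, IsRadial u ∧ mass u = c ∧ seminormSq u < R ∧ energy μ p u < 0 := by
  have hN0 : 0 < N := by omega
  have hp0 : 0 < p := by linarith
  set φ₀ := ofTest (cutoff : Sp N → ℝ) isTest_cutoff with hφ₀
  have hne : φ₀ ≠ 0 := ofTest_cutoff_ne_zero
  have hm := mass_pos hne
  have hP := powInt_pos hN hp.le (lt_critExp hN hp').le hne
  set m := mass φ₀
  set P := powInt p φ₀
  set D := c / m * seminormSq φ₀ with hD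
  have hD0 : 0 ≤ D := mul_nonneg (by positivity) (seminormSq_nonneg _)
  -- Under dilation by `t < 1` at fixed mass, `σ` is at most of order `t²` and the `L^p` term is
  -- exactly of order `t^κ`. The condition `p < 2 + 4/N` says `κ < 2`, so the `L^p` term wins as `t
  -- → 0`.
  set κ := 2 * (p * gam N p) with hκ
  have hκ2 : κ < 2 := by have := mul_gam_lt_one hN hp hp'; linarith
  have hκ' : κ = N * (p / 2) - N := by rw [hκ, mul_gam hp0.ne']; ring
  set F := μ / p * ((c / m) ^ (p / 2) * P) with hF
  have hF0 : 0 < F := by positivity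
  have h1 : Tendsto (fun t : ℝ => t ^ 2 * D) (𝓝[>] 0) (𝓝 0) := by
    have : Tendsto (fun t : ℝ => t ^ 2 * D) (𝓝 0) (𝓝 (0 ^ 2 * D)) :=
      ((continuous_pow 2).mul continuous_const).tendsto 0
    rw [zero_pow two_ne_zero, zero_mul] at this
    exact this.mono_left nhdsWithin_le_nhds
  have h2 : Tendsto (fun t : ℝ => t ^ (2 - κ) * D) (𝓝[>] 0) (𝓝 0) := by
    have : Tendsto (fun t : ℝ => t ^ (2 - κ) * D) (𝓝 0) (𝓝 (0 ^ (2 - κ) * D)) :=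
      ((Real.continuous_rpow_const (by linarith)).mul continuous_const).tendsto 0
    rw [Real.zero_rpow (by linarith), zero_mul] at this
    exact this.mono_left nhdsWithin_le_nhds
  have h3 : ∀ᶠ t : ℝ in 𝓝[>] 0, t < 1 :=
    nhdsWithin_le_nhds (gt_mem_nhds one_pos)
  obtain ⟨t, htR, htF, ht1, ht⟩ := ((h1.eventually (gt_mem_nhds hR)).and
    ((h2.eventually (gt_mem_nhds hF0)).and (h3.and self_mem_nhdsWithin))).exists
  have ht0 : 0 < t := ht
  -- The amplitude that restores mass `c` after the dilation.
  set a := √(c / m * t ^ N) with ha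
  have ha2 : a ^ 2 = c / m * t ^ N := Real.sq_sqrt (by positivity)
  set u := dilate (N := N) isTest_cutoff ht0 with hu
  have hsem : seminormSq (a • u) ≤ t ^ 2 * D := by
    rw [seminormSq_smul, seminormSq, lapSq_dilate, gradSq_dilate, ha2, hD, seminormSq]
    have hl : t ^ 4 * lapSq φ₀ ≤ t ^ 2 * lapSq φ₀ :=
      mul_le_mul_of_nonneg_right (pow_le_pow_of_le_one ht0.le ht1.le (by norm_num))
        (lapSq_nonneg _)
    have e : c / m * t ^ N * (t ^ 4 * ((t ^ N)⁻¹ * lapSq φ₀) + t ^ 2 * ((t ^ N)⁻¹ * gradSq φ₀)) =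
        c / m * (t ^ 4 * lapSq φ₀ + t ^ 2 * gradSq φ₀) := by
      field_simp
    rw [e]
    have := mul_le_mul_of_nonneg_left hl (by positivity : 0 ≤ c / m)
    linarith
  refine ⟨a • u, ?_, ?_, hsem.trans_lt htR, ?_⟩
  · rw [isRadial_iff hN0]
    exact Submodule.smul_mem _ _ ((isRadial_iff hN0).1 (isRadial_dilate_cutoff ht0))
  · rw [mass_smul, mass_dilate, ha2]
    change c / m * t ^ N * ((t ^ N)⁻¹ * m) = c
    field_simp
  · have hpow : powInt p (a • u) = (c / m) ^ (p / 2) * P * t ^ κ := by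
      rw [powInt_smul, powInt_dilate, abs_of_nonneg (Real.sqrt_nonneg _), Real.sqrt_eq_rpow,
        ← Real.rpow_mul (by positivity), Real.mul_rpow (by positivity) (by positivity),
        ← Real.rpow_natCast t N, ← Real.rpow_mul ht0.le, hκ', Real.rpow_sub ht0,
        show 1 / 2 * p = p / 2 by ring]
      change (c / m) ^ (p / 2) * t ^ (N * (p / 2)) * ((t ^ (N : ℝ))⁻¹ * P) = _
      field_simp
    have hq0 : 0 ≤ 1 / critExp N * powInt (critExp N) (a • u) :=
      mul_nonneg (one_div_nonneg.2 (by linarith [two_lt_critExp hN])) (powInt_nonneg _ _)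
    have htκ : 0 < t ^ κ := by positivity
    have h4 : t ^ 2 * D < F * t ^ κ := by
      have := mul_lt_mul_of_pos_right htF htκ
      rwa [mul_right_comm, ← Real.rpow_add ht0, sub_add_cancel, Real.rpow_two] at this
    rw [energy_eq, hpow]
    have h5 : μ / p * ((c / m) ^ (p / 2) * P * t ^ κ) = F * t ^ κ := by rw [hF]; ring
    have h6 := seminormSq_nonneg (a • u)
    rw [h5]
    linarith

/-! ### Weak convergence -/

section Weak

variable {E F : Type*} [NormedAddCommGroup E] [InnerProductSpace ℝ E] [CompleteSpace E]
  [NormedAddCommGroup F] [InnerProductSpace ℝ F]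

lemma exists_weak_subseq_of_separable [TopologicalSpace.SeparableSpace E] {x : ℕ → E} {M : ℝ}
    (hM : ∀ n, ‖x n‖ ≤ M) : ∃ (a : E) (φ : ℕ → ℕ), StrictMono φ ∧
      ∀ w, Tendsto (fun n => ⟪x (φ n), w⟫) atTop (𝓝 ⟪a, w⟫) := by
  obtain ⟨ℓ, -, φ, hφ, hlim⟩ := WeakDual.isSeqCompact_closedBall ℝ E (0 : StrongDual ℝ E) M
    (x := fun n => StrongDual.toWeakDual (InnerProductSpace.toDual ℝ E (x n))) fun n => by
      simpa using hM n
  refine ⟨(InnerProductSpace.toDual ℝ E).symm (WeakDual.toStrongDual ℓ), φ, hφ, fun w => ?_⟩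
  rw [InnerProductSpace.toDual_symm_apply]
  exact ((WeakDual.eval_continuous w).tendsto ℓ).comp hlim

/-- Separability is avoided by working in the closed span of the sequence; a general `w` is replaced
by its orthogonal projection onto that span. -/
lemma exists_weak_subseq {x : ℕ → E} {M : ℝ} (hM : ∀ n, ‖x n‖ ≤ M) :
    ∃ (a : E) (φ : ℕ → ℕ), StrictMono φ ∧
      ∀ w, Tendsto (fun n => ⟪x (φ n), w⟫) atTop (𝓝 ⟪a, w⟫) := by
  set K := (Submodule.span ℝ (Set.range x)).topologicalClosure with hK
  have hx : ∀ n, x n ∈ K := fun n =>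
    Submodule.le_topologicalClosure _ (Submodule.subset_span (Set.mem_range_self n))
  have hsep : TopologicalSpace.IsSeparable (K : Set E) := by
    rw [hK, Submodule.topologicalClosure_coe]
    exact ((Set.countable_range x).isSeparable.span (R := ℝ)).closure
  have : TopologicalSpace.SeparableSpace K := hsep.separableSpace
  have : CompleteSpace K := (Submodule.isClosed_topologicalClosure _).completeSpace_coe
  obtain ⟨a, φ, hφ, h⟩ := exists_weak_subseq_of_separable (x := fun n => (⟨x n, hx n⟩ : K))
    (M := M) hM
  refine ⟨a, φ, hφ, fun w => ?_⟩
  have := h (K.orthogonalProjectionOnto w)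
  simpa [Submodule.coe_inner] using this

variable {x : ℕ → E} {a : E}

lemma mem_of_weak_tendsto (h : ∀ w, Tendsto (fun n => ⟪x n, w⟫) atTop (𝓝 ⟪a, w⟫))
    {K : Submodule ℝ E} (hK : IsClosed (K : Set E)) (hx : ∀ n, x n ∈ K) :
    a ∈ K := by
  have : CompleteSpace K := hK.completeSpace_coe
  rw [← K.orthogonal_orthogonal, Submodule.mem_orthogonal']
  intro w hw
  refine tendsto_nhds_unique (h w) ?_
  simp [(Submodule.mem_orthogonal _ _).1 hw _ (hx _)]

lemma tendsto_apply_of_weak (h : ∀ w, Tendsto (fun n => ⟪x n, w⟫) atTop (𝓝 ⟪a, w⟫))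
    (ℓ : E →L[ℝ] ℝ) : Tendsto (fun n => ℓ (x n)) atTop (𝓝 (ℓ a)) := by
  have := h ((InnerProductSpace.toDual ℝ E).symm ℓ)
  simp only [real_inner_comm ((InnerProductSpace.toDual ℝ E).symm ℓ),
    InnerProductSpace.toDual_symm_apply] at this
  exact this

/-- The difference equals `2⟪T a, T x⟫ - ‖T a‖²`, which is affine in `x`. -/
lemma tendsto_norm_sq_sub_of_weak (h : ∀ w, Tendsto (fun n => ⟪x n, w⟫) atTop (𝓝 ⟪a, w⟫))
    (T : E →L[ℝ] F) :
    Tendsto (fun n => ‖T (x n)‖ ^ 2 - ‖T (x n - a)‖ ^ 2) atTop (𝓝 (‖T a‖ ^ 2)) := by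
  have h1 := ((tendsto_apply_of_weak h ((innerSL ℝ (T a)).comp T)).const_mul 2).sub_const
    (‖T a‖ ^ 2)
  have e : 2 * ((innerSL ℝ (T a)).comp T) a - ‖T a‖ ^ 2 = ‖T a‖ ^ 2 := by
    simp only [ContinuousLinearMap.comp_apply, innerSL_apply_apply, real_inner_self_eq_norm_sq]
    ring
  rw [e] at h1
  refine h1.congr fun n => ?_
  rw [map_sub, norm_sub_sq_real]
  simp only [ContinuousLinearMap.comp_apply, innerSL_apply_apply, real_inner_comm (T a)]
  ring

end Weak

/-- Brezis–Lieb splitting of `∫ |u|^t` along a sequence with an `L^p`-limit. -/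
lemma tendsto_powInt_sub (hN : 5 ≤ N) {t : ℝ} (ht : 2 ≤ t) (ht' : t ≤ critExp N) {v : ℕ → H2 N}
    {a : H2 N} {M : ℝ} (hM : ∀ n, ‖v n‖ ≤ M)
    (hlim : ∀ᵐ x, Tendsto (fun n => fn (v n) x) atTop (𝓝 0)) :
    Tendsto (fun n => powInt t (v n + a) - powInt t (v n)) atTop (𝓝 (powInt t a)) := by
  obtain ⟨K, hK0, hK⟩ := exists_powInt_le_norm hN ht ht'
  have hi := fun u : H2 N => integrable_abs_rpow hN ht ht' u
  have ht0 : 0 < t := by linarith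
  have hbl := tendsto_integral_brezisLieb (q := t) (by linarith)
    (fun n => (memLp_fn (v n)).1) (memLp_fn a).1 (fun n => hi (v n)) (hi a)
    (M := (K * M) ^ t) (fun n => ?_) hlim
  · have := hbl.add_const (powInt t a)
    rw [zero_add] at this
    refine this.congr fun n => ?_
    have e1 : powInt t (v n + a) = ∫ x, |fn (v n) x + fn a x| ^ t := by
      refine integral_congr_ae ?_
      filter_upwards [fn_add (v n) a] with x hx
      rw [hx, Pi.add_apply]
    have h1 : Integrable fun x => |fn (v n) x + fn a x| ^ t := by
      refine (hi (v n + a)).congr ?_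
      filter_upwards [fn_add (v n) a] with x hx
      rw [hx, Pi.add_apply]
    have h2 : Integrable fun x => |fn (v n) x + fn a x| ^ t - |fn (v n) x| ^ t := h1.sub (hi _)
    rw [integral_sub h2 (hi a), integral_sub h1 (hi _), e1, powInt, powInt]
    ring
  · have h1 := (hK (v n)).trans (mul_le_mul_of_nonneg_left (hM n) hK0)
    have h2 := Real.rpow_le_rpow (Real.rpow_nonneg (powInt_nonneg t (v n)) _) h1 ht0.le
    rwa [← Real.rpow_mul (powInt_nonneg t (v n)), one_div_mul_cancel ht0.ne', Real.rpow_one] at h2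

lemma exists_subseq_tendsto_ae (hN : 5 ≤ N) {t : ℝ} (ht : 2 ≤ t) (ht' : t ≤ critExp N)
    {v : ℕ → H2 N} (hv : Tendsto (fun n => powInt t (v n)) atTop (𝓝 0)) :
    ∃ φ : ℕ → ℕ, StrictMono φ ∧ ∀ᵐ x, Tendsto (fun n => fn (v (φ n)) x) atTop (𝓝 0) := by
  have ht0 : 0 < t := by linarith
  have h : Tendsto (fun n => eLpNorm (fn (v n) - fun _ => (0 : ℝ)) (ENNReal.ofReal t) volume)
      atTop (𝓝 0) := by
    have h1 : Tendsto (fun n => ENNReal.ofReal (powInt t (v n) ^ (1 / t))) atTop (𝓝 0) := by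
      have := ENNReal.tendsto_ofReal (hv.rpow_const (p := 1 / t) (Or.inr (by positivity)))
      rwa [Real.zero_rpow (by positivity), ENNReal.ofReal_zero] at this
    refine h1.congr fun n => ?_
    have e : (fn (v n) - fun _ => (0 : ℝ)) = fn (v n) := by
      funext x
      simp
    rw [e, eLpNorm_ofReal_eq (memLp_fn_ofReal hN ht ht' (v n)) ht0, powInt]
  exact (tendstoInMeasure_of_tendsto_eLpNorm (by simpa using ht0)
    (fun n => (memLp_fn (v n)).1) aestronglyMeasurable_const h).exists_seq_tendsto_ae

/-- Weak compactness of bounded sequences of radial functions. -/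
lemma exists_radial_subseq (hN : 5 ≤ N) {p : ℝ} (hp : 2 < p) (hp' : p < critExp N)
    {u : ℕ → H2 N} (hu : ∀ n, u n ∈ radialSubmodule N) {M : ℝ} (hM : ∀ n, ‖u n‖ ≤ M) :
    ∃ (a : H2 N) (φ : ℕ → ℕ), StrictMono φ ∧ a ∈ radialSubmodule N ∧
      Tendsto (fun n => mass (u (φ n)) - mass (u (φ n) - a)) atTop (𝓝 (mass a)) ∧
      Tendsto (fun n => seminormSq (u (φ n)) - seminormSq (u (φ n) - a)) atTop
        (𝓝 (seminormSq a)) ∧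
      Tendsto (fun n => powInt p (u (φ n))) atTop (𝓝 (powInt p a)) ∧
      Tendsto (fun n => powInt (critExp N) (u (φ n)) - powInt (critExp N) (u (φ n) - a)) atTop
        (𝓝 (powInt (critExp N) a)) := by
  obtain ⟨a, φ, hφ, hw⟩ := exists_weak_subseq (E := H2 N) hM
  have ha : a ∈ radialSubmodule N :=
    mem_of_weak_tendsto (E := H2 N) hw isClosed_radialSubmodule fun n => hu (φ n)
  have hvM : ∀ n, ‖u (φ n) - a‖ ≤ M + ‖a‖ := fun n =>
    (norm_sub_le _ _).trans (add_le_add (hM _) le_rfl)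
  have hvw : ∀ w, Tendsto (fun n => ⟪u (φ n) - a, w⟫) atTop (𝓝 0) := fun w => by
    have := (hw w).sub_const ⟪a, w⟫
    rw [sub_self] at this
    refine this.congr fun n => ?_
    rw [inner_sub_left]
  have hvp := tendsto_powInt_of_radial hN hp hp' (v := fun n => u (φ n) - a)
    (fun n => Submodule.sub_mem _ (hu _) ha) hvM hvw
  -- The `L^p` convergence also supplies the a.e. convergence that the Brezis–Lieb lemma requires at
  -- the critical exponent.
  obtain ⟨ψ, hψ, hae⟩ := exists_subseq_tendsto_ae hN hp.le hp'.le hvp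
  have hψt := hψ.tendsto_atTop
  have hsplit : ∀ t, 2 ≤ t → t ≤ critExp N → Tendsto (fun n => powInt t (u (φ (ψ n))) -
      powInt t (u (φ (ψ n)) - a)) atTop (𝓝 (powInt t a)) := fun t ht ht' => by
    have := tendsto_powInt_sub hN ht ht' (v := fun n => u (φ (ψ n)) - a) (a := a)
      (fun n => hvM _) hae
    simpa only [sub_add_cancel] using this
  have hws : ∀ w, Tendsto (fun n => ⟪u (φ (ψ n)), w⟫) atTop (𝓝 ⟪a, w⟫) := fun w =>
    (hw w).comp hψt
  refine ⟨a, φ ∘ ψ, hφ.comp hψ, ha, ?_, ?_, ?_, ?_⟩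
  · simp only [mass_eq, Function.comp_apply]
    exact tendsto_norm_sq_sub_of_weak (E := H2 N) hws fnL
  · have h1 := tendsto_norm_sq_sub_of_weak (E := H2 N) hws lapL
    have h2 := tendsto_norm_sq_sub_of_weak (E := H2 N) hws gradL
    simp only [seminormSq, lapSq_eq, gradSq_eq, Function.comp_apply]
    refine (h1.add h2).congr fun n => ?_
    ring
  · have := (hsplit p hp.le hp'.le).add (hvp.comp hψt)
    rw [add_zero] at this
    refine this.congr fun n => ?_
    simp only [Function.comp_apply]
    ring
  · exact hsplit _ (two_lt_critExp hN).le le_rfl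

/-! ### The minimiser -/

/-- The quadratic part scales exactly by `s²`, and the two negative terms by larger powers of `s`.
-/
lemma energy_smul_le (hN : 5 ≤ N) {μ : ℝ} (hμ : 0 < μ) {p : ℝ} (hp : 2 < p) {s : ℝ} (hs : 1 ≤ s)
    (u : H2 N) : energy μ p (s • u) ≤ s ^ 2 * energy μ p u := by
  have hq := two_lt_critExp hN
  rw [energy_eq, energy_eq, seminormSq_smul, powInt_smul, powInt_smul,
    abs_of_nonneg (by linarith)]
  have h : ∀ t, 2 < t → s ^ 2 * powInt t u ≤ s ^ t * powInt t u := fun t ht => by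
    refine mul_le_mul_of_nonneg_right ?_ (powInt_nonneg t u)
    rw [← Real.rpow_two]
    exact Real.rpow_le_rpow_of_exponent_le hs ht.le
  have h1 := mul_le_mul_of_nonneg_left (h p hp) (by positivity : 0 ≤ μ / p)
  have h2 := mul_le_mul_of_nonneg_left (h _ hq) (one_div_nonneg.2 (by linarith : 0 ≤ critExp N))
  linarith

/-- Rescaling a function of negative energy up to mass `c` keeps it within the threshold radius. -/
lemma exists_smul_mem_Vr (hN : 5 ≤ N) {μ : ℝ} (hμ : 0 < μ) {p : ℝ} (hp : 2 < p)
    (hp' : p < 2 + 4 / N) {c : ℝ} (hc : 0 < c) (hc' : c < cStar N μ p) {a : H2 N}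
    (har : a ∈ radialSubmodule N) (hac : mass a ≤ c) (haR : seminormSq a ≤ rStar N μ p ^ 2)
    (haE : energy μ p a < 0) :
    ∃ w ∈ Vr N μ p c, energy μ p w ≤ energy μ p a := by
  have hN0 : 0 < N := by omega
  have hr0 := (threshold_lt hN hμ hp hp' le_rfl (hc.trans hc')).1
  have ha0 : a ≠ 0 := by
    rintro rfl
    have h0 : ∀ t : ℝ, t ≠ 0 → powInt t (0 : H2 N) = 0 := fun t ht => by
      have := powInt_smul t 0 (0 : H2 N)
      rwa [zero_smul, abs_zero, Real.zero_rpow ht, zero_mul] at this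
    have h1 : seminormSq (0 : H2 N) = 0 := by
      have := seminormSq_smul 0 (0 : H2 N)
      rwa [zero_smul, zero_pow two_ne_zero, zero_mul] at this
    rw [energy_eq, h0 p (by linarith), h0 _ (by linarith [two_lt_critExp hN]), h1] at haE
    simp at haE
  have hm := mass_pos ha0
  set s := √(c / mass a) with hs
  have hs2 : s ^ 2 = c / mass a := Real.sq_sqrt (by positivity)
  have hs1 : 1 ≤ s := Real.one_le_sqrt.2 ((one_le_div hm).2 hac)
  have hms : s ^ 2 * mass a = c := by rw [hs2, div_mul_cancel₀ _ hm.ne']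
  have hE : energy μ p (s • a) ≤ energy μ p a := by
    have h1 := energy_smul_le hN hμ hp hs1 a
    have h2 : 1 ≤ s ^ 2 := one_le_pow₀ hs1
    nlinarith
  refine ⟨s • a, ⟨⟨(isRadial_iff hN0).2 (Submodule.smul_mem _ _ har), ?_⟩, ?_⟩, hE⟩
  · rw [mass_smul, hms]
  · change seminormSq (s • a) < _
    -- Otherwise some factor `s'` with `1 ≤ s' ≤ s` would put `s' • a` on the sphere `σ = r_*²` with
    -- mass at most `c`. Its energy would be positive there, whereas it is at most `s'² I(a) < 0`.
    by_contra! h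
    rw [seminormSq_smul] at h
    have hR0 : 0 < rStar N μ p ^ 2 := by positivity
    have hσ : 0 < seminormSq a := by
      refine (seminormSq_nonneg a).lt_of_ne fun h0 => ?_
      rw [← h0, mul_zero] at h
      linarith
    set s' := √(rStar N μ p ^ 2 / seminormSq a) with hs'
    have hs'2 : s' ^ 2 = rStar N μ p ^ 2 / seminormSq a := Real.sq_sqrt (by positivity)
    have hs'1 : 1 ≤ s' := Real.one_le_sqrt.2 ((one_le_div hσ).2 haR)
    have hle : s' ^ 2 ≤ s ^ 2 := by rwa [hs'2, div_le_iff₀ hσ]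
    have hpos := energy_pos_of_seminormSq_eq hN hμ hp hp' (u := s' • a)
      (by
        rw [mass_smul]
        exact ((mul_le_mul_of_nonneg_right hle hm.le).trans_eq hms).trans_lt hc')
      (by rw [seminormSq_smul, hs'2, div_mul_cancel₀ _ hσ.ne'])
    have hneg := energy_smul_le hN hμ hp hs'1 a
    have : s' ^ 2 * energy μ p a < 0 := mul_neg_of_pos_of_neg (by positivity) haE
    linarith

theorem exists_minimiser (hN : 5 ≤ N) {μ : ℝ} (hμ : 0 < μ) {p : ℝ} (hp : 2 < p)
    (hp' : p < 2 + 4 / N) {c : ℝ} (hc : 0 < c) (hc' : c < cStar N μ p) :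
    ∃ w ∈ Vr N μ p c, energy μ p w < 0 ∧ ∀ u ∈ Vr N μ p c, energy μ p w ≤ energy μ p u := by
  have hN0 : 0 < N := by omega
  have hpq := lt_critExp hN hp'
  have hr0 := (threshold_lt hN hμ hp hp' le_rfl (hc.trans hc')).1
  have hR0 : 0 < rStar N μ p ^ 2 := by positivity
  obtain ⟨u₀, hu₀r, hu₀m, hu₀R, hu₀E⟩ := exists_energy_neg hN hμ hp hp' hc hR0
  have hu₀ : u₀ ∈ Vr N μ p c := ⟨⟨hu₀r, hu₀m⟩, hu₀R⟩
  obtain ⟨B, hB⟩ := exists_le_energy hN hμ hp hpq.le c (rStar N μ p ^ 2)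
  have hbdd : BddBelow (energy μ p '' Vr N μ p c) := by
    refine ⟨B, ?_⟩
    rintro _ ⟨u, hu, rfl⟩
    exact hB u hu.1.2 hu.2.le
  set m := sInf (energy μ p '' Vr N μ p c) with hm
  have hm0 : m < 0 := (csInf_le hbdd ⟨u₀, hu₀, rfl⟩).trans_lt hu₀E
  obtain ⟨e, -, he, heV⟩ := exists_seq_tendsto_sInf
    (S := energy μ p '' Vr N μ p c) ⟨_, u₀, hu₀, rfl⟩ hbdd
  choose u huV hue using heV
  have hlimE : Tendsto (fun n => energy μ p (u n)) atTop (𝓝 m) := by simpa only [hue] using he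
  have hbound : ∀ n, ‖u n‖ ≤ √(c + rStar N μ p ^ 2) := fun n => by
    refine Real.le_sqrt_of_sq_le ?_
    have h1 : mass (u n) = c := (huV n).1.2
    have h2 := (huV n).2
    rw [norm_sq_eq]
    linarith
  obtain ⟨a, φ, hφ, har, hmass, hsem, hpow, hcrit⟩ := exists_radial_subseq hN hp hpq
    (fun n => (isRadial_iff hN0).1 (huV n).1.1) hbound
  have hac : mass a ≤ c := le_of_tendsto' hmass fun n => by
    have h1 : mass (u (φ n)) = c := (huV _).1.2
    linarith [mass_nonneg (u (φ n) - a)]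
  have haR : seminormSq a ≤ rStar N μ p ^ 2 := le_of_tendsto' hsem fun n => by
    have h1 : seminormSq (u (φ n)) < rStar N μ p ^ 2 := (huV _).2
    linarith [seminormSq_nonneg (u (φ n) - a)]
  obtain ⟨R₁, hR₁, hctrl⟩ := exists_radius_gt hN hμ hp hp' (hc.trans hc')
  -- The splitting of `σ` gives `limsup σ(u_n - a) ≤ r_*² - σ(a)`; the margin `R₁ > r_*²` allows for
  -- the error at finite `n`.
  have hev : ∀ᶠ n in atTop, seminormSq (u (φ n) - a) ≤ R₁ := by
    have h0 := seminormSq_nonneg a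
    filter_upwards [hsem.eventually (lt_mem_nhds
      (by linarith : seminormSq a - (R₁ - rStar N μ p ^ 2) < seminormSq a))] with n hn
    have h1 : seminormSq (u (φ n)) < rStar N μ p ^ 2 := (huV _).2
    linarith
  -- The energy of `u_n` minus the remainder's `σ/2` and critical contributions tends to `I(a)`. For
  -- large `n` those contributions have a nonnegative sum, because the remainder lies within radius
  -- `R₁`.
  have hEa : energy μ p a ≤ m := by
    have h1 := ((hsem.const_mul (1 / 2)).sub (hpow.const_mul (μ / p))).sub
      (hcrit.const_mul (1 / critExp N))
    rw [← energy_eq] at h1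
    refine le_of_tendsto_of_tendsto h1 (hlimE.comp hφ.tendsto_atTop) ?_
    filter_upwards [hev] with n hn
    have h2 := hctrl _ hn
    simp only [Function.comp_apply]
    rw [energy_eq]
    linarith
  obtain ⟨w, hw, hwE⟩ := exists_smul_mem_Vr hN hμ hp hp' hc hc' har hac haR (hEa.trans_lt hm0)
  refine ⟨w, hw, by linarith, fun v hv => ?_⟩
  exact (hwE.trans hEa).trans (csInf_le hbdd ⟨v, hv, rfl⟩)

/-! ### The Euler–Lagrange equation -/

section Calculus

variable {E : Type*} [NormedAddCommGroup E] [NormedSpace ℝ E]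

/-- The normalising factor is stationary at 0, so the curve leaves `w` with velocity `v`. -/
lemma fderiv_apply_eq_zero_of_curve {f : E → ℝ} {w v : E} (hf : DifferentiableAt ℝ f w)
    {k : ℝ → ℝ} (hk : HasDerivAt k 0 0) (hk0 : k 0 = 1)
    (hmin : ∀ᶠ s in 𝓝 (0 : ℝ), f w ≤ f (k s • (w + s • v))) : fderiv ℝ f w v = 0 := by
  have hg : HasDerivAt (fun s : ℝ => k s • (w + s • v)) v 0 := by
    have h1 : HasDerivAt (fun s : ℝ => w + s • v) v 0 := by
      simpa using ((hasDerivAt_id (0 : ℝ)).smul_const v).const_add w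
    simpa [hk0] using hk.fun_smul h1
  have hg0 : k 0 • (w + (0 : ℝ) • v) = w := by simp [hk0]
  have hf' : HasFDerivAt f (fderiv ℝ f w) (k 0 • (w + (0 : ℝ) • v)) := by
    rw [hg0]
    exact hf.hasFDerivAt
  have hcomp := hf'.comp_hasDerivAt (0 : ℝ) hg
  refine IsLocalMin.hasDerivAt_eq_zero ?_ hcomp
  filter_upwards [hmin] with s hs
  simpa only [Function.comp_apply, hg0] using hs

lemma fderiv_apply_of_invariant {f : E → ℝ} {w : E} (hf : DifferentiableAt ℝ f w)
    (T : E →L[ℝ] E) (hT : ∀ u, f (T u) = f u) (hw : T w = w) (v : E) :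
    fderiv ℝ f w (T v) = fderiv ℝ f w v := by
  have h1 : HasFDerivAt f (fderiv ℝ f w) (T w) := by
    rw [hw]
    exact hf.hasFDerivAt
  have h2 := h1.comp w T.hasFDerivAt
  have h3 : f ∘ T = f := funext hT
  rw [h3] at h2
  exact DFunLike.congr_fun (h2.unique hf.hasFDerivAt) v

lemma hasDerivAt_smul_self {f : E → ℝ} {w : E} (hf : DifferentiableAt ℝ f w) :
    HasDerivAt (fun s : ℝ => f (s • w)) (fderiv ℝ f w w) 1 := by
  have h1 : HasDerivAt (fun s : ℝ => s • w) w 1 := by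
    simpa using (hasDerivAt_id (1 : ℝ)).smul_const w
  have h2 : HasFDerivAt f (fderiv ℝ f w) ((1 : ℝ) • w) := by
    rw [one_smul]
    exact hf.hasFDerivAt
  exact h2.comp_hasDerivAt (1 : ℝ) h1

/-- This factor returns `w + s • v` to mass `c` when `w` has mass `c`, `v` has mass `b`, and they
are orthogonal in `L²`. -/
lemma hasDerivAt_sqrt_div {c : ℝ} (hc : 0 < c) (b : ℝ) :
    HasDerivAt (fun s : ℝ => √(c / (c + s ^ 2 * b))) 0 0 := by
  have h1 : HasDerivAt (fun s : ℝ => c + s ^ 2 * b) 0 0 := by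
    simpa using ((hasDerivAt_pow 2 (0 : ℝ)).mul_const b).const_add c
  have h2 : HasDerivAt (fun s : ℝ => c / (c + s ^ 2 * b)) 0 0 := by
    simpa using (hasDerivAt_const (0 : ℝ) c).fun_div h1 (by simpa using hc.ne')
  simpa using h2.sqrt (by simp [hc.ne'])

end Calculus

/-- Along the ray `s ↦ s • w` the energy is an explicit combination of powers of `s`, differentiated
at `s = 1`. -/
lemma fderiv_energy_self (hN : 5 ≤ N) (μ : ℝ) {p : ℝ} (hp : 2 < p) (hp' : p ≤ critExp N)
    (w : H2 N) : fderiv ℝ (energy μ p) w w =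
      seminormSq w - μ * powInt p w - powInt (critExp N) w := by
  have hq := two_lt_critExp hN
  have h1 := hasDerivAt_smul_self (E := H2 N) (differentiableAt_energy hN μ hp hp' w)
  have hpow : ∀ t : ℝ, HasDerivAt (fun s : ℝ => s ^ t) t 1 := fun t => by
    simpa using Real.hasDerivAt_rpow_const (x := 1) (p := t) (Or.inl one_ne_zero)
  have hsq : HasDerivAt (fun s : ℝ => s ^ 2) 2 1 := by simpa using hasDerivAt_pow 2 (1 : ℝ)
  have h2 := (((hsq.mul_const (seminormSq w)).const_mul (1 / 2)).fun_sub
    (((hpow p).mul_const (powInt p w)).const_mul (μ / p))).fun_sub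
    (((hpow (critExp N)).mul_const (powInt (critExp N) w)).const_mul (1 / critExp N))
  have he : (fun s : ℝ => energy μ p (s • w)) =ᶠ[𝓝 1] fun s =>
      1 / 2 * (s ^ 2 * seminormSq w) - μ / p * (s ^ p * powInt p w) -
        1 / critExp N * (s ^ critExp N * powInt (critExp N) w) := by
    filter_upwards [lt_mem_nhds (one_pos : (0 : ℝ) < 1)] with s hs
    rw [energy_eq, seminormSq_smul, powInt_smul, powInt_smul, abs_of_pos hs]
  rw [h1.unique (h2.congr_of_eventuallyEq he)]
  have hp0 : p ≠ 0 := by linarith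
  have hq0 : critExp N ≠ 0 := by linarith
  field_simp

/-- A minimiser has vanishing differential along radial directions orthogonal to it. -/
lemma fderiv_energy_eq_zero (hN : 5 ≤ N) {μ p c : ℝ} (hc : 0 < c) {w : H2 N}
    (hd : DifferentiableAt ℝ (energy μ p) w) (hw : w ∈ Vr N μ p c)
    (hmin : ∀ u ∈ Vr N μ p c, energy μ p w ≤ energy μ p u) {v : H2 N}
    (hv : v ∈ radialSubmodule N) (horth : ⟪fnL w, fnL v⟫ = 0) :
    fderiv ℝ (energy μ p) w v = 0 := by
  have hN0 : 0 < N := by omega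
  have hwm : mass w = c := hw.1.2
  have hmass : ∀ s : ℝ, mass (w + s • v) = c + s ^ 2 * mass v := fun s => by
    rw [mass_eq, map_add, map_smul, norm_add_sq_real, inner_smul_right, horth, norm_smul, mul_pow,
      Real.norm_eq_abs, sq_abs, ← mass_eq, ← mass_eq, hwm]
    ring
  have hk := hasDerivAt_sqrt_div hc (mass v)
  refine fderiv_apply_eq_zero_of_curve (E := H2 N) hd hk (by simp [hc.ne']) ?_
  have hσc : Continuous (seminormSq : H2 N → ℝ) := by
    have e : (seminormSq : H2 N → ℝ) = fun u => ‖lapL u‖ ^ 2 + ‖gradL u‖ ^ 2 := by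
      funext u
      rw [seminormSq, lapSq_eq, gradSq_eq]
    rw [e]
    exact (lapL.continuous.norm.pow 2).add (gradL.continuous.norm.pow 2)
  have hcont : ContinuousAt (fun s : ℝ => seminormSq (√(c / (c + s ^ 2 * mass v)) • (w + s • v)))
      0 := by
    refine hσc.continuousAt.comp (hk.continuousAt.smul ?_)
    exact (continuous_const.add (continuous_id.smul continuous_const)).continuousAt
  have hlt : seminormSq (√(c / (c + (0 : ℝ) ^ 2 * mass v)) • (w + (0 : ℝ) • v)) <
      rStar N μ p ^ 2 := by
    have h2 : seminormSq w < rStar N μ p ^ 2 := hw.2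
    simpa [hc.ne'] using h2
  -- The strict inequality `σ(w) < r_*²` keeps the curve inside `V_r(c)` for small `s`.
  filter_upwards [hcont.eventually (gt_mem_nhds hlt)] with s hs
  refine hmin _ ⟨⟨(isRadial_iff hN0).2 (Submodule.smul_mem _ _ (Submodule.add_mem _
    ((isRadial_iff hN0).1 hw.1.1) (Submodule.smul_mem _ _ hv))), ?_⟩, hs⟩
  have hpos : 0 < c + s ^ 2 * mass v := by
    have := mass_nonneg v
    positivity
  rw [mass_smul, hmass, Real.sq_sqrt (by positivity), div_mul_cancel₀ _ hpos.ne']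

/-- The value of the multiplier is forced by testing with `w`. The functional `I'(w) - l ⟪w, ·⟫₂` is
invariant under isometries, since `w` is radial. It vanishes on radial `v` after the `L²` component
of `v` along `w` is removed, so it is zero by symmetric criticality. -/
lemma isLagrangeMultiplier_of_minimiser (hN : 5 ≤ N) {μ p c : ℝ} (hc : 0 < c) {w : H2 N}
    (hd : DifferentiableAt ℝ (energy μ p) w) (hw : w ∈ Vr N μ p c)
    (hmin : ∀ u ∈ Vr N μ p c, energy μ p w ≤ energy μ p u) :
    IsLagrangeMultiplier μ p w (fderiv ℝ (energy μ p) w w / c) := by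
  have hN0 : 0 < N := by omega
  have hwm : mass w = c := hw.1.2
  have hwr := (isRadial_iff hN0).1 hw.1.1
  set l := fderiv ℝ (energy μ p) w w / c with hl
  set ℓ : H2 N →L[ℝ] ℝ := fderiv ℝ (energy μ p) w - l • (innerSL ℝ (fnL w)).comp fnL with hℓ
  have hℓv : ∀ v, ℓ v = fderiv ℝ (energy μ p) w v - l * ⟪fnL w, fnL v⟫ := fun v => rfl
  have hzero : ℓ = 0 := by
    refine eq_zero_of_invariant ℓ (fun R v => ?_) fun v hv => ?_
    · have h1 := fderiv_apply_of_invariant (E := H2 N) hd (rotateL R).toContinuousLinearMap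
        (energy_rotate μ p R) (mem_radialSubmodule.1 hwr R) v
      have h2 := integral_fn_mul_rotate R w v
      rw [mem_radialSubmodule.1 hwr R] at h2
      rw [hℓv, hℓv, inner_fnL, inner_fnL, h2]
      exact congrArg (fun y => y - _) h1
    · set b := ⟪fnL w, fnL v⟫ / c with hb
      have h1 := fderiv_energy_eq_zero hN hc hd hw hmin (v := v - b • w)
        (Submodule.sub_mem _ hv (Submodule.smul_mem _ _ hwr)) (by
          rw [map_sub, map_smul, inner_sub_right, inner_smul_right, real_inner_self_eq_norm_sq,
            ← mass_eq, hwm, hb, div_mul_cancel₀ _ hc.ne', sub_self])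
      rw [map_sub, map_smul, smul_eq_mul] at h1
      rw [hℓv, hl]
      rw [hb] at h1
      linear_combination h1
  refine ⟨hd, fun v => ?_⟩
  have := hℓv v
  rw [hzero, inner_fnL] at this
  simp only [zero_apply] at this
  linarith

end BiharmonicNLS

end

open BiharmonicNLS in
theorem theorem1p1 (N : ℕ) (hN : 5 ≤ N) (μ : ℝ) (hμ : 0 < μ)
    (p : ℝ) (hp : 2 < p) (hp' : p < 2 + 4 / N)
    (c : ℝ) (hc : 0 < c) (hc' : c < cStar N μ p) :
    ∃ u : H2 N, IsCriticalOnVr μ p c u ∧ energy μ p u < 0 ∧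
      ∃ l : ℝ, IsLagrangeMultiplier μ p u l ∧ l < 0 := by
  have hpq := (lt_critExp hN hp').le
  have hq := two_lt_critExp hN
  obtain ⟨w, hw, hwE, hmin⟩ := exists_minimiser hN hμ hp hp' hc hc'
  have hd := differentiableAt_energy hN μ hp hpq w
  have hL := isLagrangeMultiplier_of_minimiser hN hc hd hw hmin
  refine ⟨w, ⟨hw, hd, fun v _ hv => ?_⟩, hwE, _, hL, ?_⟩
  · rw [hL.2 v, hv, mul_zero]
  -- The numerator is `I'(w)w = σ - μ‖w‖_p^p - ‖w‖_{4^*}^{4^*}`. It is at most `2 I(w)`, because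
  -- `1/p` and `1/4^*` are below `1/2`.
  · refine div_neg_of_neg_of_pos ?_ hc
    rw [fderiv_energy_self hN μ hp hpq]
    rw [energy_eq] at hwE
    have h1 : μ / p * powInt p w ≤ μ / 2 * powInt p w :=
      mul_le_mul_of_nonneg_right (div_le_div_of_nonneg_left hμ.le two_pos hp.le)
        (powInt_nonneg p w)
    have h2 : 1 / critExp N * powInt (critExp N) w ≤ 1 / 2 * powInt (critExp N) w :=
      mul_le_mul_of_nonneg_right (one_div_le_one_div_of_le two_pos hq.le) (powInt_nonneg _ w)
    linarith
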